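/- **Setting.** Let $\mathfrak g$ be a finite-dimensional simple complex Lie algebra of simply laced type with Cartan subalgebra $\mathfrak h$, root system $\Delta$, simple roots $\alpha_1,\dots,\alpha_s$, simple coroots $\alpha_1^\vee,\dots,\alpha_s^\vee$, highest root $\theta=\sum_{i=1}^s k_i\alpha_i$ with coroot $\theta^\vee$, and invariant bilinear form $(\cdot|\cdot)$ normalised by $(\theta^\vee|\theta^\vee)=2$. Let $$\mathfrak T=\mathfrak g\otimes\mathbb C[t_1^{\pm1},t_2^{\pm1}]\oplus\mathbb Cc_1\oplus\mathbb Cc_2\oplus\mathbb Cd_1\oplus\mathbb Cd_2 ,$$ where, with $x(m_1,m_2)=x\otimes t_1^{m_1}t_2^{m_2}$, $$[x(m_1,m_2),y(n_1,n_2)]=[x,y](m_1+n_1,m_2+n_2)+(x|y)\,\delta_{m_1,-n_1}\delta_{m_2,-n_2}(m_1c_1+m_2c_2),$$ $c_1,c_2$ are central, $[d_i,x(m_1,m_2)]=m_ix(m_1,m_2)$ and $[d_1,d_2]=0$. Let $\hat{\mathfrak h}=\mathfrak h\oplus\mathbb Cc_1\oplus\mathbb Cc_2\oplus\mathbb Cd_1\oplus\mathbb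 Cd_2$; extend functionals on $\mathfrak h$ to $\hat{\mathfrak h}$ by $0$ on the $c_i,d_i$, and let $\delta_i\in\hat{\mathfrak h}^*$ vanish on $\mathfrak h,c_1,c_2$ with $\delta_i(d_j)=\delta_{ij}$. For $\beta\in\hat{\mathfrak h}^*$ let $\mathfrak T_\beta$ be the corresponding root subspace and $\Delta_{\mathfrak T}=\{\beta\ne0:\mathfrak T_\beta\ne0\}$. Put $\alpha_0=\delta_1-\theta$, $\alpha_{-1}=\delta_2-\theta$, $\alpha_0^\vee=c_1-\theta^\vee$, and let $\alpha_i^*\in\hat{\mathfrak h}$ ($-1\le i\le s$) satisfy $\alpha_j(\alpha_i^*)=\delta_{ij}$ for $-1\le j\le s$. Let $\varphi=\sum_{i=0}^s\alpha_i^*-\mathrm{ht}(\theta)\alpha_{-1}^*$ and $\mathcal I=\{\beta\in\Delta_{\mathfrak T}:\varphi(\beta)>0\}\cup\{n\delta_2:n\ge1\}$. Let $\mathcal B=\{0,1,\dots,s\}$. For $\mathcal A\subseteq\mathcal B$ let $$f_{\mathcal A}=\sum_{i\in\mathcal B\setminus\mathcal A}\alpha_i^*-\Big(\sum_{i\in\mathcal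 B\setminus\mathcal A,\ i\ne0}k_i\Big)\alpha_{-1}^*,\qquad Q(\mathcal A)=\{\beta\in\Delta_{\mathfrak T}:f_{\mathcal A}(\beta)\ge0\},\qquad \overline{Q(\mathcal A)}=Q(\mathcal A)\setminus(-Q(\mathcal A)),$$ and for a set $S$ of roots let $\mathfrak T_S=\bigoplus_{\beta\in S}\mathfrak T_\beta$. For $\lambda\in\hat{\mathfrak h}^*$ let $\overline M(\lambda)=U(\mathfrak T)\otimes_{U(\hat{\mathfrak h}\oplus\mathfrak T_{\mathcal I})}\mathbb C1_\lambda$, where $\mathfrak T_{\mathcal I}$ acts on $1_\lambda$ by $0$ and $\hat{\mathfrak h}$ by $\lambda$. Say that $\lambda$ is $\mathcal A$-admissible if $\lambda(c_2)=0$ and $\lambda(\alpha_i^\vee)=0$ for all $i\in\mathcal A$; for such $\lambda$ let $$M(\lambda,\mathcal A)=U(\mathfrak T)\otimes_{U(\hat{\mathfrak h}\oplus\mathfrak T_{Q(\mathcal A)})}\mathbb C1_\lambda,$$ where $\mathfrak T_{Q(\mathcal A)}$ acts on $1_\lambda$ by $0$ and $\hat{\mathfrak h}$ by $\lambda$. **Statement.**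 Let $\mathcal A\subseteq\mathcal B$ and let $\lambda\in\hat{\mathfrak h}^*$ be $\mathcal A$-admissible. Then: 1. $M(\lambda,\mathcal A)$ is a free $U(\mathfrak T_{-\overline{Q(\mathcal A)}})$-module with basis $1\otimes1_\lambda$. 2. $\dim M(\lambda,\mathcal A)_\lambda=1$. Let $\Lambda$ be the set of the weights $\lambda-\sum_{i\in\mathcal A}r_i\alpha_i-\alpha_j+r\delta_2$ with $r_i\in\mathbb Z_{\ge0}$, $j\in\mathcal B\setminus\mathcal A$, $r\in\mathbb Z$. If $\mu\in\Lambda$, then $\dim M(\lambda,\mathcal A)_\mu\in\{0,1\}$, unless $\mu=\lambda-\delta_1+r\delta_2$ for some $r\in\mathbb Z$, in which case $\dim M(\lambda,\mathcal A)_\mu=s=\dim\mathfrak h$. If $\mu\in\hat{\mathfrak h}^*$, $\mu\ne\lambda$ and $\mu\notin\Lambda$, then $\dim M(\lambda,\mathcal A)_\mu$ is $0$ or $\infty$. 3. $M(\lambda,\mathcal A)$ has a unique irreducible quotient, i.e. there is exactly one submodule with irreducible quotient. 4. For every $\mathcal A''\subseteq\mathcal A$ there are surjective $\mathfrak T$-homomorphisms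 $\overline M(\lambda)\to M(\lambda,\mathcal A'')\to M(\lambda,\mathcal A)$. 5. For every $\mathcal A$-admissible $\mu\in\hat{\mathfrak h}^*$, every nonzero element of $\mathrm{Hom}_{\mathfrak T}(M(\lambda,\mathcal A),M(\mu,\mathcal A))$ is injective. 6. $M(\lambda,\mathcal A)$ is irreducible if and only if $\lambda(\alpha_i^\vee)\ne0$ for all $i\in\mathcal B\setminus\mathcal A$, i.e. $\mathcal A$ is the maximal set of indices with $\lambda(\alpha_i^\vee)=0$ for all $i\in\mathcal A$. -/

import Mathlib

open scoped TensorProduct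

noncomputable section

namespace DoubleAffine

open Module LieAlgebra LieAlgebra.IsKilling

/-! ### Two-variable loop algebras: derivations and the cocycle -/

section Loop

variable {g : Type*} [LieRing g] [LieAlgebra ℂ g]

variable (g) in
/-- The 2-loop algebra `g ⊗ ℂ[t₁^{±1}, t₂^{±1}]`; the Laurent polynomial ring is the group algebra
of `ℤ × ℤ`. -/
def Loop : Type _ := loopAlgebra ℂ (ℤ × ℤ) g

instance : LieRing (Loop g) := inferInstanceAs (LieRing (loopAlgebra ℂ (ℤ × ℤ) g))
instance : LieAlgebra ℂ (Loop g) := inferInstanceAs (LieAlgebra ℂ (loopAlgebra ℂ (ℤ × ℤ) g))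

variable (g) in
/-- The coefficients of an element of the 2-loop algebra. -/
def coeffs : Loop g ≃ₗ[ℂ] ((ℤ × ℤ) →₀ g) := LoopAlgebra.toFinsupp ℂ (ℤ × ℤ) g

/-- The element `x(m₁, m₂) = x ⊗ t₁^{m₁} t₂^{m₂}`. -/
def mono (m : ℤ × ℤ) (x : g) : Loop g :=
  (AddMonoidAlgebra.single m (1 : ℂ) ⊗ₜ[ℂ] x : loopAlgebra ℂ (ℤ × ℤ) g)

lemma coeffs_mono (m : ℤ × ℤ) (x : g) : coeffs g (mono m x) = Finsupp.single m x :=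
  LoopAlgebra.toFinsupp_single_tmul ℂ (ℤ × ℤ) g m x

lemma mono_smul (m : ℤ × ℤ) (r : ℂ) (x : g) : mono m (r • x) = r • mono m x :=
  TensorProduct.tmul_smul r _ x

lemma coeffs_symm_single (m : ℤ × ℤ) (x : g) :
    (coeffs g).symm (Finsupp.single m x) = mono m x :=
  LoopAlgebra.toFinsupp_symm_single ℂ (ℤ × ℤ) g m x

/-- The two components of an exponent. -/
def expo (i : Fin 2) (m : ℤ × ℤ) : ℤ := if i = 0 then m.1 else m.2

lemma expo_add (i : Fin 2) (m n : ℤ × ℤ) : expo i (m + n) = expo i m + expo i n := by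
  unfold expo; split <;> rfl

lemma expo_neg (i : Fin 2) (m : ℤ × ℤ) : expo i (-m) = -expo i m := by
  unfold expo; split <;> rfl

/-- The degree derivation `∂ᵢ = tᵢ d/dtᵢ`, i.e. `x(m₁, m₂) ↦ mᵢ x(m₁, m₂)`. -/
def deg (i : Fin 2) : Loop g →ₗ[ℂ] Loop g :=
  (coeffs g).symm.toLinearMap ∘ₗ
    (Finsupp.lsum ℂ fun m : ℤ × ℤ => (expo i m : ℂ) • Finsupp.lsingle m) ∘ₗ
      (coeffs g).toLinearMap

/-- The bilinear map `ωᵢ(x(m₁, m₂), y(n₁, n₂)) = (x|y) mᵢ δ_{m₁, -n₁} δ_{m₂, -n₂}`. -/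
def cocycle (B : LinearMap.BilinForm ℂ g) (i : Fin 2) : Loop g →ₗ[ℂ] Loop g →ₗ[ℂ] ℂ :=
  (Finsupp.lsum ℂ fun m : ℤ × ℤ => (expo i m : ℂ) •
    (LinearMap.compl₂ B (Finsupp.lapply (-m) ∘ₗ
      (coeffs g).toLinearMap))) ∘ₗ
    (coeffs g).toLinearMap

lemma deg_mono (i : Fin 2) (m : ℤ × ℤ) (x : g) : deg i (mono m x) = (expo i m : ℂ) • mono m x := by
  simp [deg, coeffs_mono, coeffs_symm_single, mono_smul]

lemma cocycle_mono (B : LinearMap.BilinForm ℂ g) (i : Fin 2) (m n : ℤ × ℤ) (x y : g) :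
    cocycle B i (mono m x) (mono n y) = if m + n = 0 then (expo i m : ℂ) * B x y else 0 := by
  classical
  by_cases h : m + n = 0
  · obtain rfl : n = -m := (neg_eq_of_add_eq_zero_right h).symm
    simp [cocycle, coeffs_mono]
  · have h' : ¬ n = -m := fun e => h (by simp [e])
    simp [cocycle, coeffs_mono, h, h']

lemma lie_mono (m n : ℤ × ℤ) (x y : g) : ⁅mono m x, mono n y⁆ = mono (m + n) ⁅x, y⁆ := by
  refine (ExtendScalars.bracket_tmul ℂ (AddMonoidAlgebra ℂ (ℤ × ℤ)) g g _ _ x y).trans ?_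
  rw [AddMonoidAlgebra.single_mul_single, one_mul]; rfl

lemma loop_induction {p : Loop g → Prop} (h0 : p 0) (hm : ∀ m x, p (mono m x))
    (ha : ∀ u v, p u → p v → p (u + v)) (u : Loop g) : p u := by
  rw [← (coeffs g).symm_apply_apply u]
  induction (coeffs g) u using Finsupp.induction_linear with
  | zero => simpa using h0
  | add f k hf hk => rw [map_add]; exact ha _ _ hf hk
  | single m x => rw [coeffs_symm_single]; exact hm m x

lemma deg_lie (i : Fin 2) (u v : Loop g) : deg i ⁅u, v⁆ = ⁅deg i u, v⁆ + ⁅u, deg i v⁆ := by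
  induction u using loop_induction with
  | h0 => simp
  | ha u u' h h' => simp only [add_lie, map_add, h, h']; abel
  | hm m x =>
    induction v using loop_induction with
    | h0 => simp
    | ha u u' h h' => simp only [lie_add, map_add, h, h']; abel
    | hm n y =>
      simp only [lie_mono, deg_mono, smul_lie, lie_smul, expo_add, ← add_smul]
      push_cast; rfl

lemma deg_comm (i j : Fin 2) (u : Loop g) : deg i (deg j u) = deg j (deg i u) := by
  induction u using loop_induction with
  | h0 => simp
  | ha u u' h h' => simp only [map_add, h, h']
  | hm m x => simp only [deg_mono, map_smul]; rw [smul_comm]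

lemma cocycle_skew (B : LinearMap.BilinForm ℂ g) (hB : ∀ x y, B x y = B y x) (i : Fin 2)
    (u v : Loop g) : cocycle B i u v = -cocycle B i v u := by
  induction u using loop_induction with
  | h0 => simp
  | ha u u' h h' => simp only [map_add, LinearMap.add_apply, h, h']; ring
  | hm m x =>
    induction v using loop_induction with
    | h0 => simp
    | ha u u' h h' => simp only [map_add, LinearMap.add_apply, h, h']; ring
    | hm n y =>
      simp only [cocycle_mono, add_comm n m]
      split
      · next h =>
        obtain rfl : n = -m := (neg_eq_of_add_eq_zero_right h).symm
        rw [expo_neg, hB x y]; push_cast; ring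
      · simp

lemma cocycle_deg (B : LinearMap.BilinForm ℂ g) (i j : Fin 2)
    (u v : Loop g) : cocycle B i u (deg j v) = -cocycle B i (deg j u) v := by
  induction u using loop_induction with
  | h0 => simp
  | ha u u' h h' => simp only [map_add, LinearMap.add_apply, h, h']; ring
  | hm m x =>
    induction v using loop_induction with
    | h0 => simp
    | ha u u' h h' => simp only [map_add, h, h']; ring
    | hm n y =>
      simp only [deg_mono, map_smul, LinearMap.smul_apply, cocycle_mono]
      split
      · next h =>
        obtain rfl : n = -m := (neg_eq_of_add_eq_zero_right h).symm
        rw [expo_neg]; push_cast; simp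
      · simp

lemma cocycle_jacobi (B : LinearMap.BilinForm ℂ g)
    (hI : ∀ x y z, B ⁅x, y⁆ z = B x ⁅y, z⁆) (i : Fin 2) (u v w : Loop g) :
    cocycle B i u ⁅v, w⁆ = cocycle B i ⁅u, v⁆ w + cocycle B i v ⁅u, w⁆ := by
  induction u using loop_induction with
  | h0 => simp
  | ha u u' h h' => simp only [map_add, LinearMap.add_apply, add_lie, h, h']; ring
  | hm m x =>
    induction v using loop_induction with
    | h0 => simp
    | ha u u' h h' => simp only [map_add, LinearMap.add_apply, add_lie, lie_add, h, h']; ring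
    | hm n y =>
      induction w using loop_induction with
      | h0 => simp
      | ha u u' h h' => simp only [map_add, lie_add, h, h']; ring
      | hm k z =>
        simp only [lie_mono, cocycle_mono]
        have e1 : m + n + k = m + (n + k) := by abel
        have e2 : n + (m + k) = m + (n + k) := by abel
        rw [e1, e2]
        split
        · have h1 : B y ⁅x, z⁆ = -B x ⁅y, z⁆ := by
            rw [← hI y x z, ← lie_skew, map_neg, LinearMap.neg_apply, hI]
          rw [h1, hI, expo_add]; push_cast; ring
        · simp

end Loop

/-! ### The extended double affine Lie algebra -/

section Algebra

variable {g : Type*} [LieRing g] [LieAlgebra ℂ g] [FiniteDimensional ℂ g] [IsSimple ℂ g]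
  {H : LieSubalgebra ℂ g} [H.IsCartanSubalgebra]

lemma exists_highest (b : (rootSystem H).Base) : ∃ t : H.root, ∀ i, b.height i ≤ b.height t := by
  have : Nonempty H.root := by
    by_contra h
    rw [not_nonempty_iff] at h
    have h1 := RootPairing.IsRootSystem.span_root_eq_top (P := rootSystem H)
    rw [Set.range_eq_empty, Submodule.span_empty] at h1
    have := RootPairing.IsIrreducible.nontrivial (P := rootSystem H)
    exact bot_ne_top h1
  exact Finite.exists_max b.height

/-- The longest root `θ`: the root of greatest height with respect to the simple roots. -/
def theta (b : (rootSystem H).Base) : H.root := (exists_highest b).choose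

/-- The invariant bilinear form `(·|·)` of `g`: the multiple of the Killing form with
`(θ^∨|θ^∨) = 2`. -/
def form (b : (rootSystem H).Base) : LinearMap.BilinForm ℂ g :=
  (2 / killingForm ℂ g ((rootSystem H).coroot (theta b)) ((rootSystem H).coroot (theta b))) •
    killingForm ℂ g

lemma form_symm (b : (rootSystem H).Base) (x y : g) : form b x y = form b y x := by
  simp [form, LieModule.traceForm_comm ℂ g g x y]

lemma form_inv (b : (rootSystem H).Base) (x y z : g) : form b ⁅x, y⁆ z = form b x ⁅y, z⁆ := by
  simp [form, LieModule.traceForm_apply_lie_apply]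

/-- The extended double affine Lie algebra
`T = g ⊗ ℂ[t₁^{±1}, t₂^{±1}] ⊕ ℂ c₁ ⊕ ℂ c₂ ⊕ ℂ d₁ ⊕ ℂ d₂`, as a vector space. In a triple
`(u, c, d)` the pair `c` holds the coefficients of `c₁, c₂` and `d` those of `d₁, d₂`
(the indices `1, 2` being `0, 1 : Fin 2`). -/
def T (_b : (rootSystem H).Base) : Type _ := Loop g × (Fin 2 → ℂ) × (Fin 2 → ℂ)

variable (b : (rootSystem H).Base)

instance : AddCommGroup (T b) := inferInstanceAs (AddCommGroup (Loop g × (Fin 2 → ℂ) × (Fin 2 → ℂ)))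
instance : Module ℂ (T b) := inferInstanceAs (Module ℂ (Loop g × (Fin 2 → ℂ) × (Fin 2 → ℂ)))

variable {b} in
/-- Building an element of `T` from its components. -/
def T.mk (u : Loop g) (c d : Fin 2 → ℂ) : T b := (u, c, d)
variable {b} in
/-- The loop component. -/
def T.loop (x : T b) : Loop g := x.1
variable {b} in
/-- The coefficients of `c₁, c₂`. -/
def T.cen (x : T b) : Fin 2 → ℂ := x.2.1
variable {b} in
/-- The coefficients of `d₁, d₂`. -/
def T.der (x : T b) : Fin 2 → ℂ := x.2.2

variable {b} in
lemma T.ext' {x y : T b} (h : x.loop = y.loop) (h' : x.cen = y.cen) (h'' : x.der = y.der) :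
    x = y := Prod.ext h (Prod.ext h' h'')

/-- The bracket of `T`: `[x(m), y(n)] = [x, y](m + n) + (x|y) δ_{m,-n} (m₁ c₁ + m₂ c₂)`,
`[dᵢ, x(m)] = mᵢ x(m)`, the `cᵢ` are central and `[dᵢ, dⱼ] = 0`. -/
instance : Bracket (T b) (T b) where
  bracket x y := T.mk
    (⁅x.loop, y.loop⁆ + ∑ i, x.der i • deg i y.loop - ∑ i, y.der i • deg i x.loop)
    (fun i => cocycle (form b) i x.loop y.loop) 0

section
variable {b}
lemma loop_lie (x y : T b) : (⁅x, y⁆ : T b).loop =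
    ⁅x.loop, y.loop⁆ + ∑ i, x.der i • deg i y.loop - ∑ i, y.der i • deg i x.loop := rfl
lemma cen_lie (x y : T b) : (⁅x, y⁆ : T b).cen =
    fun i => cocycle (form b) i x.loop y.loop := rfl
lemma der_lie (x y : T b) : (⁅x, y⁆ : T b).der = 0 := rfl
lemma loop_add (x y : T b) : (x + y).loop = x.loop + y.loop := rfl
lemma cen_add (x y : T b) : (x + y).cen = x.cen + y.cen := rfl
lemma der_add (x y : T b) : (x + y).der = x.der + y.der := rfl
lemma loop_smul (r : ℂ) (x : T b) : (r • x).loop = r • x.loop := rfl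
lemma cen_smul (r : ℂ) (x : T b) : (r • x).cen = r • x.cen := rfl
lemma der_smul (r : ℂ) (x : T b) : (r • x).der = r • x.der := rfl
lemma loop_zero : (0 : T b).loop = 0 := rfl
lemma cen_zero : (0 : T b).cen = 0 := rfl
lemma der_zero : (0 : T b).der = 0 := rfl
end

instance : LieRing (T b) where
  add_lie x y z := by
    refine T.ext' ?_ ?_ ?_
    · simp only [loop_lie, loop_add, der_add, add_lie, map_add, Fin.sum_univ_two, Pi.add_apply,
        smul_add, add_smul]; abel
    · funext i; simp [cen_lie, cen_add, loop_add]
    · simp [der_lie, der_add]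
  lie_add x y z := by
    refine T.ext' ?_ ?_ ?_
    · simp only [loop_lie, loop_add, der_add, lie_add, map_add, Fin.sum_univ_two, Pi.add_apply,
        smul_add, add_smul]; abel
    · funext i; simp [cen_lie, cen_add, loop_add]
    · simp [der_lie, der_add]
  lie_self x := by
    refine T.ext' ?_ ?_ ?_
    · simp [loop_lie, loop_zero]
    · funext i
      have := cocycle_skew (form b) (form_symm b) i x.loop x.loop
      simpa [cen_lie, cen_zero, self_eq_neg] using this
    · simp [der_lie, der_zero]
  leibniz_lie x y z := by
    refine T.ext' ?_ ?_ ?_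
    · have hs (j : Fin 2) : ⁅y.loop, deg j x.loop⁆ = -⁅deg j x.loop, y.loop⁆ :=
        (lie_skew _ _).symm
      simp only [loop_lie, loop_add, der_lie, lie_add, add_lie, lie_sub, sub_lie, map_add, map_sub,
        Fin.sum_univ_two, Pi.zero_apply, zero_smul, smul_add, smul_sub, map_smul, lie_smul,
        smul_lie, deg_lie, leibniz_lie x.loop y.loop z.loop, deg_comm 1 0, hs, smul_neg]
      simp only [smul_comm (y.der _) (x.der _), smul_comm (z.der _) (x.der _),
        smul_comm (z.der _) (y.der _)]
      abel
    · funext i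
      have h (j : Fin 2) : cocycle (form b) i (deg j y.loop) x.loop =
          cocycle (form b) i (deg j x.loop) y.loop := by
        rw [cocycle_skew (form b) (form_symm b), cocycle_deg, neg_neg]
      simp only [cen_lie, cen_add, loop_lie, Pi.add_apply, map_add, map_sub, Fin.sum_univ_two,
        map_smul, LinearMap.add_apply, LinearMap.sub_apply, LinearMap.smul_apply,
        cocycle_jacobi (form b) (form_inv b) i x.loop y.loop z.loop, cocycle_deg,
        h, smul_eq_mul]
      ring
    · simp [der_lie, der_add]

instance : LieAlgebra ℂ (T b) where
  lie_smul r x y := by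
    refine T.ext' ?_ ?_ ?_
    · simp only [loop_lie, loop_smul, der_smul, lie_smul, map_smul, Fin.sum_univ_two,
        Pi.smul_apply, smul_eq_mul, mul_smul, smul_add, smul_sub]
      simp only [smul_comm (x.der _) r]
    · funext i; simp [cen_lie, cen_smul, loop_smul]
    · simp [der_lie, der_smul]

/-! ### The Cartan subalgebra, simple roots and coroots -/

variable (H) in
/-- The Cartan subalgebra `ĥ = h ⊕ ℂ c₁ ⊕ ℂ c₂ ⊕ ℂ d₁ ⊕ ℂ d₂`. -/
abbrev Cartan : Type _ := H × (Fin 2 → ℂ) × (Fin 2 → ℂ)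

/-- The inclusion of `ĥ` in `T`. -/
def incl : Cartan H →ₗ[ℂ] T b where
  toFun h := T.mk (mono 0 (h.1 : g)) h.2.1 h.2.2
  map_add' _ _ := T.ext' (TensorProduct.tmul_add _ _ _) rfl rfl
  map_smul' _ _ := T.ext' (TensorProduct.tmul_smul _ _ _) rfl rfl

variable (H) in
/-- The central elements `c₁, c₂`. -/
def c (i : Fin 2) : Cartan H := (0, Pi.single i 1, 0)

variable (H) in
/-- The derivations `d₁, d₂`. -/
def d (i : Fin 2) : Cartan H := (0, 0, Pi.single i 1)

variable (H) in
/-- `δᵢ` vanishes on `h`, `c₁`, `c₂`, and `δᵢ(dⱼ) = δᵢⱼ`. -/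
def delta (i : Fin 2) : Dual ℂ (Cartan H) :=
  LinearMap.proj i ∘ₗ LinearMap.snd ℂ (Fin 2 → ℂ) (Fin 2 → ℂ) ∘ₗ LinearMap.snd ℂ H _

variable (H) in
/-- A functional on `h`, extended by `0` to `ĥ`. -/
def ext (β : Dual ℂ H) : Dual ℂ (Cartan H) := β ∘ₗ LinearMap.fst ℂ H _

/-- The index set `{0, 1, …, s}` of the simple roots of the affine Lie algebra in `t₁`;
`none` is the index `0`. -/
abbrev Ix : Type _ := Option b.support

/-- The simple roots `α₀ = δ₁ - θ, α₁, …, αₛ`. -/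
def simpleRoot : Ix b → Dual ℂ (Cartan H)
  | none => delta H 0 - ext H ((rootSystem H).root (theta b))
  | some i => ext H ((rootSystem H).root i)

/-- The simple coroots `α₀^∨ = c₁ - θ^∨, α₁^∨, …, αₛ^∨`. -/
def simpleCoroot : Ix b → Cartan H
  | none => c H 0 - ((rootSystem H).coroot (theta b), 0, 0)
  | some i => ((rootSystem H).coroot i, 0, 0)

/-- The coefficients `kᵢ` in `θ = ∑ᵢ kᵢ αᵢ`. -/
def thetaCoeff (i : b.support) : ℂ := b.toWeightBasis.repr ((rootSystem H).root (theta b)) i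

/-- The elements `α₀^*, …, αₛ^*` of `ĥ` with `αᵢ^*(αⱼ) = δᵢⱼ` for `i, j ∈ {-1, 0, …, s}`, where
`α₋₁ = δ₂ - θ`. An element of `ĥ` is regarded as a functional on the dual of `ĥ`; on `h` the
condition singles out the fundamental coweights. -/
def dualElt : Ix b → Cartan H
  | none => d H 0
  | some i => ((Module.evalEquiv ℂ H).symm (b.toWeightBasis.coord i), 0, 0) +
      thetaCoeff b i • (d H 0 + d H 1)

/-- The element `α₋₁^*` of `ĥ`. -/
def dualEltNegOne (_b : (rootSystem H).Base) : Cartan H := d H 1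

open scoped Classical in
/-- `f_A = ∑_{i ∉ A} αᵢ^* - (∑_{i ∉ A, i ≠ 0} kᵢ) α₋₁^*`, which is `0` if `A` is everything. -/
def fElt (A : Set (Ix b)) : Cartan H :=
  ∑ i with i ∉ A, dualElt b i -
    (∑ i : b.support with (some i : Ix b) ∉ A, thetaCoeff b i) • dualEltNegOne b

/-- `φ = ∑_{i=0}^s αᵢ^* - ht(θ) α₋₁^*`. -/
def phiElt : Cartan H :=
  ∑ i, dualElt b i - (b.height (theta b) : ℂ) • dualEltNegOne b

/-! ### Roots and the subsets `I`, `Q(A)` -/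

/-- The root subspace `T_β`. -/
def rootSubspace (β : Dual ℂ (Cartan H)) : Submodule ℂ (T b) where
  carrier := {x | ∀ h, ⁅incl b h, x⁆ = β h • x}
  add_mem' hx hy h := by rw [lie_add, hx h, hy h, smul_add]
  zero_mem' h := by simp
  smul_mem' r x hx h := by rw [lie_smul, hx h, smul_comm]

/-- The root system of `T`. -/
def roots : Set (Dual ℂ (Cartan H)) := {β | β ≠ 0 ∧ rootSubspace b β ≠ ⊥}

/-- `I = {β root | φ(β) > 0} ∪ {n δ₂ | n ≥ 1}`. On roots the values of `φ` are integers. -/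
def setI : Set (Dual ℂ (Cartan H)) :=
  {β | β ∈ roots b ∧ 0 < (β (phiElt b)).re} ∪ {β | ∃ n : ℕ, 0 < n ∧ β = n • delta H 1}

/-- `Q(A) = {β root | f_A(β) ≥ 0}`. On roots the values of `f_A` are integers. -/
def setQ (A : Set (Ix b)) : Set (Dual ℂ (Cartan H)) :=
  {β | β ∈ roots b ∧ 0 ≤ (β (fElt b A)).re}

/-- `Q(A) \ (-Q(A))`. -/
def setQbar (A : Set (Ix b)) : Set (Dual ℂ (Cartan H)) := {β | β ∈ setQ b A ∧ -β ∉ setQ b A}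

/-- The subalgebra `T_{-(Q(A) \ (-Q(A)))}` of `T`, the span of the root subspaces `T_{-β}` with
`β ∈ Q(A) \ (-Q(A))`; since the set of these `β` is closed under addition within the roots, the
subalgebra generated by the root subspaces is their sum. -/
def nilMinus (A : Set (Ix b)) : LieSubalgebra ℂ (T b) :=
  LieSubalgebra.lieSpan ℂ (T b) (⋃ β ∈ setQbar b A, (rootSubspace b (-β) : Set (T b)))

/-! ### The modules

`T`-modules are treated as modules over the enveloping algebra `U(T)`. -/

/-- The enveloping algebra `U(T)`. -/
abbrev U : Type _ := UniversalEnvelopingAlgebra ℂ (T b)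

/-- The homomorphism from `U(T_{-(Q(A) \ (-Q(A)))})` to `U(T)` induced by the inclusion. -/
def nilMinusToU (A : Set (Ix b)) : UniversalEnvelopingAlgebra ℂ (nilMinus b A) →ₐ[ℂ] U b :=
  letI : LieRing (U b) := LieRing.ofAssociativeRing
  UniversalEnvelopingAlgebra.lift ℂ ((UniversalEnvelopingAlgebra.ι ℂ).comp (nilMinus b A).incl)

/-- For a set `S` of roots, the left ideal of `U(T)` generated by the `x ∈ T_β` with `β ∈ S` and by
the `h - λ(h)` with `h ∈ ĥ`. -/
def vermaIdeal (S : Set (Dual ℂ (Cartan H))) (l : Dual ℂ (Cartan H)) : Submodule (U b) (U b) :=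
  Submodule.span (U b)
    ({u | ∃ β ∈ S, ∃ x ∈ rootSubspace b β, u = UniversalEnvelopingAlgebra.ι ℂ x} ∪
     {u | ∃ h : Cartan H, u = UniversalEnvelopingAlgebra.ι ℂ (incl b h) - algebraMap ℂ (U b) (l h)})

/-- The module `U(T) ⊗_{U(ĥ ⊕ T_S)} ℂ 1_λ` induced from the one-dimensional module on which `T_S`
acts by `0` and `ĥ` by `λ`. Tensoring with a cyclic module `U(ĥ ⊕ T_S) / J` gives
`U(T) / U(T) J`, and here `J` is the left ideal generated by `T_S` and the `h - λ(h)`. -/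
abbrev Verma (S : Set (Dual ℂ (Cartan H))) (l : Dual ℂ (Cartan H)) : Type _ :=
  U b ⧸ vermaIdeal b S l

/-- The generator `1 ⊗ 1_λ`. -/
def vac (S : Set (Dual ℂ (Cartan H))) (l : Dual ℂ (Cartan H)) : Verma b S l :=
  Submodule.Quotient.mk 1

/-- The universal property of the induced module: homomorphisms to `V` correspond to the vectors of
`V` that are killed by `T_S` and on which `ĥ` acts by `λ`. -/
theorem verma_universal (S : Set (Dual ℂ (Cartan H))) (l : Dual ℂ (Cartan H))
    {V : Type*} [AddCommGroup V] [Module (U b) V] (v : V)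
    (h1 : ∀ β ∈ S, ∀ x ∈ rootSubspace b β, UniversalEnvelopingAlgebra.ι ℂ x • v = 0)
    (h2 : ∀ h : Cartan H, UniversalEnvelopingAlgebra.ι ℂ (incl b h) • v =
      algebraMap ℂ (U b) (l h) • v) :
    ∃! f : Verma b S l →ₗ[U b] V, f (vac b S l) = v := by
  refine ⟨(vermaIdeal b S l).liftQ (LinearMap.toSpanSingleton (U b) V v) ?_, ?_, ?_⟩
  · refine Submodule.span_le.2 ?_
    rintro u (⟨β, hβ, x, hx, rfl⟩ | ⟨h, rfl⟩)
    · simpa using h1 β hβ x hx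
    · simpa [sub_smul, sub_eq_zero] using h2 h
  · exact (Submodule.liftQ_apply _ _ _).trans (one_smul _ v)
  · intro f hf
    refine Submodule.linearMap_qext _ (LinearMap.ext_ring ?_)
    exact hf.trans (one_smul _ v).symm

/-- The imaginary Verma module of highest weight `λ`. -/
abbrev IVM (l : Dual ℂ (Cartan H)) : Type _ := Verma b (setI b) l

/-- The generalized imaginary Verma module `M(λ, A)`. -/
abbrev GIVM (l : Dual ℂ (Cartan H)) (A : Set (Ix b)) : Type _ := Verma b (setQ b A) l

/-- The weight space `V_μ` of a `T`-module. -/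
def weightSpace (V : Type*) [AddCommGroup V] [Module ℂ V] [Module (U b) V]
    [IsScalarTower ℂ (U b) V] (μ : Dual ℂ (Cartan H)) : Submodule ℂ V where
  carrier := {v | ∀ h, UniversalEnvelopingAlgebra.ι ℂ (incl b h) • v = μ h • v}
  add_mem' hx hy h := by rw [smul_add, hx h, hy h, smul_add]
  zero_mem' h := by simp
  smul_mem' r x hx h := by rw [smul_algebra_smul_comm, hx h, smul_comm]

/-- `λ` vanishes on `ĥ_A ⊕ ℂ c₂`, where `ĥ_A` is spanned by the `αᵢ^∨` with `i ∈ A`. -/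
def Vanishes (A : Set (Ix b)) (l : Dual ℂ (Cartan H)) : Prop :=
  (∀ h ∈ Submodule.span ℂ (simpleCoroot b '' A), l h = 0) ∧ l (c H 1) = 0

/-- `μ = λ - ∑_{i ∈ A} kᵢ αᵢ - αⱼ + k δ₂` for some integers `kᵢ ≥ 0`, `k`, and some `j ∉ A`. -/
def FirstLayer (A : Set (Ix b)) (l μ : Dual ℂ (Cartan H)) : Prop :=
  ∃ k : Ix b → ℕ, (∀ i ∉ A, k i = 0) ∧ ∃ j ∉ A, ∃ n : ℤ,
    μ = l - ∑ i, k i • simpleRoot b i - simpleRoot b j + n • delta H 1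

end Algebra

end DoubleAffine

end

/-!
Write `f` for the element `f_A` of `ĥ`. It grades `T` by integers (`AdaptedBasis.lev`): modulo `δ₂`
every root is a combination of the affine simple roots `α₀, …, αₛ` with coefficients of one sign
(`loopWt_eq_sum`), and its degree is the sum of the coefficients outside `A` (`eval_fElt`). So
`Q(A)` consists of the roots of nonnegative degree, and `nilMinus` is the part `n` of negative
degree. A root of degree `0` is a combination of `δ₂` and of the `αᵢ` with `i ∈ A`, whence an
admissible `λ` extends to a character `χ` of the part of nonnegative degree (`lie_mem_parabolic`).

*Freeness.* For a Lie algebra with a subalgebra `n` and a complementary subalgebra with a character,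
the induced module is realized on `U(n)` (`Induced.uact`); this needs no basis of the complement.
With the Poincaré–Birkhoff–Witt theorem, proved here over a field for a Lie algebra with an ordered
basis (`PBW.equiv`), the ordered monomials in negative root vectors form a basis of `M(λ, A)`
(`AdaptedBasis.basisM`).

*Weight multiplicities.* The monomials of degree `-1` are single root vectors, with weights in the
first layer. Any other monomial besides `1` either has two factors or is a root vector of degree at
most `-2`, whose weight is also a sum of two roots of negative degree, since an element of `g` that
commutes with the part of degree one is zero (`eq_zero_of_commutes`). The exponents of `t₂` in two
factors can be moved in opposite directions, so that such weights have infinite multiplicity.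

*Submodules and homomorphisms.* Submodules are graded, so the sum of all proper submodules is
proper. Homomorphisms are right multiplications in `U(n)`, which has no zero divisors
(`PBW.eq_zero_of_mul_eq_zero`). By sign coherence the sets `Q(A)` grow with `A`, which gives the
surjections.

*Irreducibility.* If `λ(αᵢ^∨) = 0` for some `i ∉ A`, the map to `M(λ, A ∪ {i})` has a nonzero proper
kernel. Otherwise, it suffices to show that no vector `v ≠ 0` of negative degree is killed by the
part of positive degree. Moving `x` to the right through the monomials of `v` gives a sum of
products `t · z` of words `t` with elements `z` of `T` (`AdaptedBasis.normal`). The exponent of `t₂`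
in `x` is at our disposal, and if it is large, then the `z` of negative degree exceed all factors of
the words `t` in the order of the basis. There is no cancellation, and every single `z` is in the
kernel of `χ` (`AdaptedBasis.normal_eq_zero`). For a word `t` of the greatest possible length this
says that `[x, y]` is in the kernel of `χ` for an element `y ≠ 0` of `n`. If `y` has degree at most
`-2`, it commutes with the part of degree one, which is impossible. If it has degree `-1`, the
bracket of `y` with a root vector `x` of opposite weight is a multiple of some element of `ĥ` on
which `λ` is a nonzero multiple of `λ(αⱼ^∨)` with `j ∉ A`, again a contradiction.
-/

set_option linter.unusedSectionVars false

noncomputable section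

/-! ### The Poincaré–Birkhoff–Witt theorem -/

namespace PBW

section

open Module

variable {K L I : Type*} [Field K] [LieRing L] [LieAlgebra K L] [LinearOrder I]

/-- Polynomials of total degree at most `d`, presented as the span of the monomials. -/
def fil (K I : Type*) [Field K] (d : ℕ) : Submodule K (MvPolynomial I K) :=
  Submodule.span K {p | ∃ a : I →₀ ℕ, a.degree ≤ d ∧ p = MvPolynomial.monomial a 1}

lemma monomial_mem_fil {a : I →₀ ℕ} {d : ℕ} (h : a.degree ≤ d) :
    MvPolynomial.monomial a (1 : K) ∈ fil K I d := Submodule.subset_span ⟨a, h, rfl⟩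

lemma fil_mono {d e : ℕ} (h : d ≤ e) : fil K I d ≤ fil K I e :=
  Submodule.span_mono fun _ ⟨a, ha, e⟩ => ⟨a, ha.trans h, e⟩

lemma fil_induction {d : ℕ} {P : MvPolynomial I K → Prop}
    (hm : ∀ a : I →₀ ℕ, a.degree ≤ d → P (MvPolynomial.monomial a 1)) (h0 : P 0)
    (ha : ∀ p q, P p → P q → P (p + q)) (hs : ∀ (r : K) p, P p → P (r • p))
    {p : MvPolynomial I K} (hp : p ∈ fil K I d) : P p := by
  induction hp using Submodule.span_induction with
  | mem x h => obtain ⟨a, h, rfl⟩ := h; exact hm a h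
  | zero => exact h0
  | add x y _ _ hx hy => exact ha x y hx hy
  | smul r x _ hx => exact hs r x hx

lemma mem_fil_totalDegree (p : MvPolynomial I K) : p ∈ fil K I p.totalDegree := by
  rw [p.as_sum]
  have h (a) (ha : a ∈ p.support) :
      MvPolynomial.monomial a (p.coeff a) ∈ fil K I p.totalDegree := by
    rw [← mul_one (p.coeff a), ← smul_eq_mul, ← MvPolynomial.smul_monomial]
    refine Submodule.smul_mem _ _ (monomial_mem_fil ?_)
    exact MvPolynomial.le_totalDegree ha
  convert! Submodule.sum_mem _ h using 1
  exact congrArg (fun q => fil K I (MvPolynomial.totalDegree q)) p.as_sum.symm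

lemma totalDegree_le_of_mem_fil {p : MvPolynomial I K} {d : ℕ} (h : p ∈ fil K I d) :
    p.totalDegree ≤ d := by
  refine fil_induction (P := fun p => p.totalDegree ≤ d) ?_ (by simp) ?_ ?_ h
  · intro a ha
    exact (MvPolynomial.totalDegree_monomial_le _ _).trans ha
  · intro p q hp hq
    exact (MvPolynomial.totalDegree_add p q).trans (max_le hp hq)
  · intro r p hp
    exact (MvPolynomial.totalDegree_smul_le r p).trans hp

lemma X_mul_monomial (i : I) (a : I →₀ ℕ) : MvPolynomial.X i * MvPolynomial.monomial a (1 : K) =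
    MvPolynomial.monomial (Finsupp.single i 1 + a) 1 := by
  rw [MvPolynomial.X, MvPolynomial.monomial_mul, one_mul]

lemma X_mul_mem_fil (i : I) {p : MvPolynomial I K} {d : ℕ} (h : p ∈ fil K I d) :
    MvPolynomial.X i * p ∈ fil K I (d + 1) := by
  refine fil_induction (P := fun p => MvPolynomial.X i * p ∈ fil K I (d + 1)) ?_ ?_ ?_ ?_ h
  · intro a ha
    rw [X_mul_monomial]
    refine monomial_mem_fil ?_
    rw [map_add, Finsupp.degree_single]; omega
  · simp
  · intro p q hp hq; rw [mul_add]; exact add_mem hp hq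
  · intro r p hp; rw [mul_smul_comm]; exact Submodule.smul_mem _ _ hp

/-- The smallest variable of a monomial that has one below `i`. -/
def low (i : I) (a : I →₀ ℕ) (h : ¬ ∀ k ∈ a.support, i ≤ k) : I :=
  a.support.min' (by
    rw [Finset.nonempty_iff_ne_empty]; rintro e; simp [e] at h)

lemma low_lt {i : I} {a : I →₀ ℕ} (h : ¬ ∀ k ∈ a.support, i ≤ k) : low i a h < i := by
  obtain ⟨k, hk, hki⟩ : ∃ k ∈ a.support, k < i := by push Not at h; exact h
  exact (Finset.min'_le _ k hk).trans_lt hki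

lemma low_le {i : I} {a : I →₀ ℕ} (h : ¬ ∀ k ∈ a.support, i ≤ k) :
    ∀ k ∈ a.support, low i a h ≤ k := fun k hk => Finset.min'_le _ k hk

lemma low_mem {i : I} {a : I →₀ ℕ} (h : ¬ ∀ k ∈ a.support, i ≤ k) : low i a h ∈ a.support :=
  Finset.min'_mem _ _

lemma single_add_sub {j : I} {a : I →₀ ℕ} (h : j ∈ a.support) :
    Finsupp.single j 1 + (a - Finsupp.single j 1) = a := by
  rw [add_comm]
  refine tsub_add_cancel_of_le ?_
  rw [Finsupp.single_le_iff]
  exact Nat.one_le_iff_ne_zero.2 (Finsupp.mem_support_iff.1 h)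

lemma support_sub_subset (j : I) (a : I →₀ ℕ) : (a - Finsupp.single j 1).support ⊆ a.support := by
  intro k hk
  simp only [Finsupp.mem_support_iff, Finsupp.coe_tsub, Pi.sub_apply] at hk ⊢
  omega

lemma degree_sub {j : I} {a : I →₀ ℕ} (h : j ∈ a.support) :
    (a - Finsupp.single j 1).degree + 1 = a.degree := by
  conv_rhs => rw [← single_add_sub h]
  rw [map_add, Finsupp.degree_single, add_comm]

lemma basis_induction (y : Basis I K L) {P : L → Prop} (zero : P 0)
    (add : ∀ u v, P u → P v → P (u + v)) (smul : ∀ (r : K) u, P u → P (r • u))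
    (basis : ∀ i, P (y i)) (x : L) : P x := by
  have hx : x ∈ Submodule.span K (Set.range y) := by rw [y.span_eq]; trivial
  induction hx using Submodule.span_induction with
  | mem x h => obtain ⟨i, rfl⟩ := h; exact basis i
  | zero => exact zero
  | add x y _ _ hx hy => exact add x y hx hy
  | smul r x _ hx => exact smul r x hx

open Classical in
/-- One step of the recursive definition of the action of a Lie algebra on the polynomials in the
elements of a basis `y`: the value of `y i` on a monomial `a`, given the action `ρ` on the monomials
of smaller degree. -/
def step (y : Basis I K L) (ρ : L →ₗ[K] MvPolynomial I K →ₗ[K] MvPolynomial I K)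
    (i : I) (a : I →₀ ℕ) : MvPolynomial I K :=
  if h : ∀ k ∈ a.support, i ≤ k then MvPolynomial.X i * MvPolynomial.monomial a 1 else
    let j := low i a h
    let m := MvPolynomial.monomial (a - Finsupp.single j 1) (1 : K)
    MvPolynomial.X j * (MvPolynomial.X i * m) + ρ (y j) (ρ (y i) m - MvPolynomial.X i * m) +
      ρ ⁅y i, y j⁆ m

/-- The linear extension of `fun i a => φ i a` from basis vectors and monomials. -/
def extend (y : Basis I K L) (φ : I → (I →₀ ℕ) → MvPolynomial I K) :
    L →ₗ[K] MvPolynomial I K →ₗ[K] MvPolynomial I K :=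
  y.constr K fun i => (MvPolynomial.basisMonomials I K).constr K (φ i)

lemma extend_apply (y : Basis I K L) (φ : I → (I →₀ ℕ) → MvPolynomial I K) (i : I) (a : I →₀ ℕ) :
    extend y φ (y i) (MvPolynomial.monomial a 1) = φ i a := by
  rw [extend, Basis.constr_basis]
  have := (MvPolynomial.basisMonomials I K).constr_basis K (φ i) a
  rwa [MvPolynomial.coe_basisMonomials] at this

/-- The approximations to the action; the `n`-th one is correct on polynomials of degree `≤ n`. -/
def act (y : Basis I K L) : ℕ → L →ₗ[K] MvPolynomial I K →ₗ[K] MvPolynomial I K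
  | 0 => extend y fun i a => MvPolynomial.X i * MvPolynomial.monomial a 1
  | n + 1 => extend y (step y (act y n))

/-- The action of a basis vector is multiplication by the variable, up to terms that do not raise
the degree; this is what makes the recursion well founded. -/
lemma act_symbol (y : Basis I K L) (n d : ℕ) (i : I) {p : MvPolynomial I K} (hp : p ∈ fil K I d) :
    act y n (y i) p - MvPolynomial.X i * p ∈ fil K I d := by
  induction n generalizing d i p with
  | zero =>
    refine fil_induction (P := fun p => act y 0 (y i) p - MvPolynomial.X i * p ∈ fil K I d)
      ?_ ?_ ?_ ?_ hp
    · intro a ha; rw [act, extend_apply, sub_self]; exact zero_mem _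
    · simp
    · intro p q hp hq
      rw [map_add, mul_add, add_sub_add_comm]; exact add_mem hp hq
    · intro r p hp
      rw [map_smul, mul_smul_comm, ← smul_sub]; exact Submodule.smul_mem _ _ hp
  | succ n ih =>
    have ih' (d : ℕ) (x : L) {p : MvPolynomial I K} (hp : p ∈ fil K I d) :
        act y n x p ∈ fil K I (d + 1) := by
      induction x using basis_induction y with
      | zero => simp
      | add u v hu hv => rw [map_add, LinearMap.add_apply]; exact add_mem hu hv
      | smul r u hu => rw [map_smul, LinearMap.smul_apply]; exact Submodule.smul_mem _ _ hu
      | basis i =>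
        rw [← sub_add_cancel (act y n (y i) p) (MvPolynomial.X i * p)]
        exact add_mem (fil_mono (Nat.le_succ d) (ih d i hp)) (X_mul_mem_fil i hp)
    refine fil_induction (P := fun p => act y (n + 1) (y i) p - MvPolynomial.X i * p ∈ fil K I d)
      ?_ ?_ ?_ ?_ hp
    · intro a ha
      rw [act, extend_apply, step]
      split_ifs with h
      · rw [sub_self]; exact zero_mem _
      · have hd := degree_sub (low_mem h)
        have hm : MvPolynomial.monomial (a - Finsupp.single (low i a h) 1) (1 : K) ∈
          fil K I (d - 1) := monomial_mem_fil (by omega)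
        have hd' : d - 1 + 1 = d := by omega
        have e : MvPolynomial.X i * MvPolynomial.monomial a (1 : K) =
            MvPolynomial.X (low i a h) * (MvPolynomial.X i *
              MvPolynomial.monomial (a - Finsupp.single (low i a h) 1) (1 : K)) := by
          rw [mul_left_comm, X_mul_monomial (low i a h), single_add_sub (low_mem h)]
        rw [e]
        simp only
        rw [add_assoc, add_sub_cancel_left]
        refine add_mem ?_ ?_
        · have := ih' _ (y (low i a h)) (ih _ i hm)
          rwa [hd'] at this
        · have := ih' _ ⁅y i, y (low i a h)⁆ hm
          rwa [hd'] at this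
    · simp
    · intro p q hp hq
      rw [map_add, mul_add, add_sub_add_comm]; exact add_mem hp hq
    · intro r p hp
      rw [map_smul, mul_smul_comm, ← smul_sub]; exact Submodule.smul_mem _ _ hp

/-- Two bilinear maps that agree on basis vectors and monomials of degree `≤ d` agree on all
polynomials of degree `≤ d`. -/
lemma bilin_ext (y : Basis I K L) {S : Type*} [AddCommGroup S] [Module K S]
    {φ ψ : L →ₗ[K] MvPolynomial I K →ₗ[K] S} {d : ℕ}
    (h : ∀ i (a : I →₀ ℕ), a.degree ≤ d →
      φ (y i) (MvPolynomial.monomial a 1) = ψ (y i) (MvPolynomial.monomial a 1))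
    (x : L) {p : MvPolynomial I K} (hp : p ∈ fil K I d) : φ x p = ψ x p := by
  refine fil_induction (P := fun p => φ x p = ψ x p) ?_ ?_ ?_ ?_ hp
  · intro a ha
    induction x using basis_induction y with
    | zero => simp
    | add u v hu hv => rw [map_add, map_add, LinearMap.add_apply, LinearMap.add_apply, hu, hv]
    | smul r u hu => rw [map_smul, map_smul, LinearMap.smul_apply, LinearMap.smul_apply, hu]
    | basis i => exact h i a ha
  · simp
  · intro p q hp hq; rw [map_add, map_add, hp, hq]
  · intro r p hp; rw [map_smul, map_smul, hp]

lemma act_mem_fil (y : Basis I K L) (n d : ℕ) (x : L) {p : MvPolynomial I K} (hp : p ∈ fil K I d) :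
    act y n x p ∈ fil K I (d + 1) := by
  induction x using basis_induction y with
  | zero => simp
  | add u v hu hv => rw [map_add, LinearMap.add_apply]; exact add_mem hu hv
  | smul r u hu => rw [map_smul, LinearMap.smul_apply]; exact Submodule.smul_mem _ _ hu
  | basis i =>
    rw [← sub_add_cancel (act y n (y i) p) (MvPolynomial.X i * p)]
    exact add_mem (fil_mono (Nat.le_succ d) (act_symbol y n d i hp)) (X_mul_mem_fil i hp)

lemma act_succ_eq (y : Basis I K L) (n : ℕ) (x : L) {p : MvPolynomial I K}
    (hp : p ∈ fil K I n) : act y (n + 1) x p = act y n x p := by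
  induction n generalizing x p with
  | zero =>
    refine bilin_ext y ?_ x hp
    intro i a ha
    rw [act, act, extend_apply, extend_apply, step, dif_pos]
    have : a = 0 := by rwa [← Finsupp.degree_eq_zero_iff, ← Nat.le_zero]
    simp [this]
  | succ n ih =>
    refine bilin_ext y ?_ x hp
    intro i a ha
    rw [show act y (n + 1 + 1) = extend y (step y (act y (n + 1))) from rfl,
      show act y (n + 1) (y i) = extend y (step y (act y n)) (y i) from rfl,
      extend_apply, extend_apply, step, step]
    split_ifs with h
    · rfl
    · have hd := degree_sub (low_mem h)
      have hm : MvPolynomial.monomial (a - Finsupp.single (low i a h) 1) (1 : K) ∈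
        fil K I n := monomial_mem_fil (by omega)
      simp only
      rw [ih _ hm, ih _ hm, ih _ (act_symbol y n n i hm)]

lemma act_eq_of_le (y : Basis I K L) {m n : ℕ} (hmn : m ≤ n) (x : L) {p : MvPolynomial I K}
    (hp : p ∈ fil K I m) : act y n x p = act y m x p := by
  induction n, hmn using Nat.le_induction with
  | base => rfl
  | succ n hmn ih => rw [act_succ_eq y n x (fil_mono hmn hp), ih]

/-- The action of a Lie algebra on the polynomials in the elements of an ordered basis. -/
def rho (y : Basis I K L) : L →ₗ[K] MvPolynomial I K →ₗ[K] MvPolynomial I K :=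
  extend y fun i a => act y a.degree (y i) (MvPolynomial.monomial a 1)

lemma rho_eq (y : Basis I K L) (d : ℕ) (x : L) {p : MvPolynomial I K} (hp : p ∈ fil K I d) :
    rho y x p = act y d x p := by
  refine bilin_ext y ?_ x hp
  intro i a ha
  rw [rho, extend_apply]
  exact (act_eq_of_le y ha _ (monomial_mem_fil le_rfl)).symm

lemma rho_symbol (y : Basis I K L) (i : I) {d : ℕ} {p : MvPolynomial I K} (hp : p ∈ fil K I d) :
    rho y (y i) p - MvPolynomial.X i * p ∈ fil K I d := by
  rw [rho_eq y d _ hp]; exact act_symbol y d d i hp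

lemma rho_mem_fil (y : Basis I K L) (x : L) {d : ℕ} {p : MvPolynomial I K} (hp : p ∈ fil K I d) :
    rho y x p ∈ fil K I (d + 1) := by
  rw [rho_eq y d _ hp]; exact act_mem_fil y d d x hp

lemma rho_of_le (y : Basis I K L) {i : I} {a : I →₀ ℕ} (h : ∀ k ∈ a.support, i ≤ k) :
    rho y (y i) (MvPolynomial.monomial a 1) = MvPolynomial.X i * MvPolynomial.monomial a 1 := by
  rw [rho_eq y (a.degree + 1) _ (monomial_mem_fil (Nat.le_succ _)), act, extend_apply, step,
    dif_pos h]

/-- The recursion that defines the action: `y i` moves past the smallest variable `y j`. -/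
lemma rho_of_lt (y : Basis I K L) {i j : I} {a : I →₀ ℕ} (h : ∀ k ∈ a.support, j ≤ k)
    (hji : j < i) :
    rho y (y i) (rho y (y j) (MvPolynomial.monomial a 1)) =
      rho y (y j) (rho y (y i) (MvPolynomial.monomial a 1)) +
      rho y ⁅y i, y j⁆ (MvPolynomial.monomial a 1) := by
  set a' := Finsupp.single j 1 + a with ha'
  have hj : j ∈ a'.support := by simp [ha']
  have hn : ¬ ∀ k ∈ a'.support, i ≤ k := fun H => (H j hj).not_gt hji
  have hlow : low i a' hn = j := by
    refine le_antisymm (low_le hn j hj) (Finset.le_min' _ _ _ ?_)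
    intro k hk
    have : k ∈ (Finsupp.single j 1).support ∪ a.support := Finsupp.support_add hk
    rcases Finset.mem_union.1 this with hk | hk
    · rw [Finset.mem_singleton.1 (Finsupp.support_single_subset hk)]
    · exact h k hk
  have hsub : a' - Finsupp.single j 1 = a := by rw [ha', add_comm, add_tsub_cancel_right]
  have hd : a'.degree = a.degree + 1 := by
    rw [ha', map_add, Finsupp.degree_single, add_comm]
  have hm : MvPolynomial.monomial a (1 : K) ∈ fil K I a.degree := monomial_mem_fil le_rfl
  rw [rho_of_le y h, X_mul_monomial, ← ha', rho_eq y (a.degree + 1) _ (monomial_mem_fil hd.le), act,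
    extend_apply, step, dif_neg hn]
  simp only [hlow, hsub]
  rw [← rho_eq y _ _ hm, ← rho_eq y _ _ hm, ← rho_eq y _ _ (rho_symbol y i hm), map_sub]
  have hX : rho y (y j) (MvPolynomial.X i * MvPolynomial.monomial a 1) =
      MvPolynomial.X j * (MvPolynomial.X i * MvPolynomial.monomial a 1) := by
    rw [X_mul_monomial]
    refine rho_of_le y ?_
    intro k hk
    have : k ∈ (Finsupp.single i 1).support ∪ a.support := Finsupp.support_add hk
    rcases Finset.mem_union.1 this with hk | hk
    · rw [Finset.mem_singleton.1 (Finsupp.support_single_subset hk)]; exact hji.le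
    · exact h k hk
  rw [hX]; abel

/-- The commutation defect of the action. -/
def defect (y : Basis I K L) (u v : L) : MvPolynomial I K →ₗ[K] MvPolynomial I K :=
  rho y u ∘ₗ rho y v - rho y v ∘ₗ rho y u - rho y ⁅u, v⁆

lemma defect_apply (y : Basis I K L) (u v : L) (p : MvPolynomial I K) :
    defect y u v p = rho y u (rho y v p) - rho y v (rho y u p) - rho y ⁅u, v⁆ p := rfl

lemma defect_swap (y : Basis I K L) (u v : L) (p : MvPolynomial I K) :
    defect y u v p = - defect y v u p := by
  simp only [defect_apply]
  rw [← lie_skew u v, map_neg, LinearMap.neg_apply]; abel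

lemma defect_of_le (y : Basis I K L) {i j : I} {a : I →₀ ℕ} (h : ∀ k ∈ a.support, j ≤ k) :
    defect y (y i) (y j) (MvPolynomial.monomial a 1) = 0 := by
  rcases lt_trichotomy i j with hij | rfl | hij
  · rw [defect_swap, defect_apply, rho_of_lt y (fun k hk => hij.le.trans (h k hk)) hij]; abel
  · simp [defect_apply]
  · rw [defect_apply, rho_of_lt y h hij]; abel

lemma defect_eq_zero_of_basis (y : Basis I K L) {p : MvPolynomial I K}
    (h : ∀ i j, defect y (y i) (y j) p = 0) (u v : L) : defect y u v p = 0 := by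
  induction u using basis_induction y with
  | zero => simp [defect_apply]
  | add u u' hu hu' =>
    have : defect y (u + u') v p = defect y u v p + defect y u' v p := by
      simp only [defect_apply, add_lie, map_add, LinearMap.add_apply]; abel
    rw [this, hu, hu', add_zero]
  | smul r u hu =>
    have : defect y (r • u) v p = r • defect y u v p := by
      simp only [defect_apply, smul_lie, map_smul, LinearMap.smul_apply, smul_sub]
    rw [this, hu, smul_zero]
  | basis i =>
    induction v using basis_induction y with
    | zero => simp [defect_apply]
    | add u u' hu hu' =>
      have : defect y (y i) (u + u') p = defect y (y i) u p + defect y (y i) u' p := by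
        simp only [defect_apply, lie_add, map_add, LinearMap.add_apply]; abel
      rw [this, hu, hu', add_zero]
    | smul r u hu =>
      have : defect y (y i) (r • u) p = r • defect y (y i) u p := by
        simp only [defect_apply, lie_smul, map_smul, LinearMap.smul_apply, smul_sub]
      rw [this, hu, smul_zero]
    | basis j => exact h i j

/-- The action respects brackets; the case of a monomial whose smallest variable is below both basis
vectors reduces, by the Jacobi identity, to smaller degree. -/
lemma defect_eq_zero (y : Basis I K L) (d : ℕ) (u v : L) {p : MvPolynomial I K}
    (hp : p ∈ fil K I d) : defect y u v p = 0 := by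
  induction d using Nat.strong_induction_on generalizing u v p with
  | _ d ih =>
  refine fil_induction (P := fun p => defect y u v p = 0) ?_ (map_zero _) ?_ ?_ hp
  · intro a ha
    refine defect_eq_zero_of_basis y ?_ u v
    intro i j
    by_cases hj : ∀ k ∈ a.support, j ≤ k
    · exact defect_of_le y hj
    by_cases hi : ∀ k ∈ a.support, i ≤ k
    · rw [defect_swap, defect_of_le y hi, neg_zero]
    set k := low i a hi with hk
    have hlow : ∀ l ∈ a.support, k ≤ l := low_le hi
    have hki : k < i := low_lt hi
    have hkj : k < j := low_lt hj
    have hd := degree_sub (low_mem hi)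
    rw [← hk] at hd
    set a' := a - Finsupp.single k 1 with ha'
    have hlow' : ∀ l ∈ a'.support, k ≤ l := fun l hl => hlow l (support_sub_subset k a hl)
    set m := MvPolynomial.monomial a' (1 : K) with hm
    have hmem : m ∈ fil K I (d - 1) := monomial_mem_fil (by omega)
    have hX : MvPolynomial.monomial a (1 : K) = rho y (y k) m := by
      rw [rho_of_le y hlow', X_mul_monomial, single_add_sub (low_mem hi)]
    have low_case (l l' : I) (hl : k < l) :
        defect y (y l') (y k) (rho y (y l) m) = 0 := by
      rw [← sub_add_cancel (rho y (y l) m) (MvPolynomial.X l * m), map_add,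
        ih (d - 1) (by omega) _ _ (rho_symbol y l hmem), zero_add, X_mul_monomial]
      refine defect_of_le y ?_
      intro q hq
      rcases Finset.mem_union.1 (Finsupp.support_add hq) with hq | hq
      · rw [Finset.mem_singleton.1 (Finsupp.support_single_subset hq)]; exact hl.le
      · exact hlow' q hq
    have D (u v : L) : defect y u v m = 0 := ih (d - 1) (by omega) u v hmem
    have c1 := low_case j i hkj
    have c2 := low_case i j hki
    have c3 := D (y j) (y k)
    have c4 := D (y i) (y k)
    have c5 := D (y i) ⁅y j, y k⁆
    have c6 := D (y j) ⁅y i, y k⁆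
    have c7 := D (y i) (y j)
    have c8 := D ⁅y i, y j⁆ (y k)
    have hJ : (⁅⁅y i, y j⁆, y k⁆ : L) = ⁅y i, ⁅y j, y k⁆⁆ - ⁅y j, ⁅y i, y k⁆⁆ := lie_lie _ _ _
    rw [hX]
    simp only [defect_apply, sub_sub, sub_eq_zero] at D c1 c2 c3 c4 c5 c6 c7 c8 ⊢
    simp only [c3, c4]
    simp only [map_add]
    rw [c1, c2, c5, c6, c8, c7, hJ]
    simp only [map_add, map_sub, LinearMap.sub_apply]
    abel
  · intro p q hp hq; rw [map_add, hp, hq, add_zero]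
  · intro r p hp; rw [map_smul, hp, smul_zero]

attribute [local instance 100] LieRing.ofAssociativeRing

/-- The action on polynomials, as a homomorphism of Lie algebras. -/
def rhoHom (y : Basis I K L) : L →ₗ⁅K⁆ Module.End K (MvPolynomial I K) :=
  { rho y with
    map_lie' := by
      intro u v
      refine LinearMap.ext fun p => ?_
      have h := defect_eq_zero y _ u v (mem_fil_totalDegree p)
      rw [defect_apply, sub_eq_zero] at h
      exact h.symm }

/-- The action of the enveloping algebra on polynomials. -/
def uact (y : Basis I K L) : UniversalEnvelopingAlgebra K L →ₐ[K] Module.End K (MvPolynomial I K) :=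
  UniversalEnvelopingAlgebra.lift K (rhoHom y)

lemma uact_ι (y : Basis I K L) (x : L) (p : MvPolynomial I K) :
    uact y (UniversalEnvelopingAlgebra.ι K x) p = rho y x p := by
  rw [uact, UniversalEnvelopingAlgebra.lift_ι_apply]; rfl

/-- The product in `U(L)` of a list of basis vectors. -/
def word (y : Basis I K L) (l : List I) : UniversalEnvelopingAlgebra K L :=
  (l.map fun i => UniversalEnvelopingAlgebra.ι K (y i)).prod

/-- The map that sends a monomial to the product in increasing order. -/
def tau (y : Basis I K L) : MvPolynomial I K →ₗ[K] UniversalEnvelopingAlgebra K L :=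
  (MvPolynomial.basisMonomials I K).constr K fun a => word y ((Finsupp.toMultiset a).sort (· ≤ ·))

lemma tau_monomial (y : Basis I K L) (a : I →₀ ℕ) :
    tau y (MvPolynomial.monomial a 1) = word y ((Finsupp.toMultiset a).sort (· ≤ ·)) := by
  have := (MvPolynomial.basisMonomials I K).constr_basis K
    (fun a => word y ((Finsupp.toMultiset a).sort (· ≤ ·))) a
  rwa [MvPolynomial.coe_basisMonomials] at this

lemma tau_X_mul (y : Basis I K L) {i : I} {a : I →₀ ℕ} (h : ∀ k ∈ a.support, i ≤ k) :
    tau y (MvPolynomial.X i * MvPolynomial.monomial a 1) =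
      UniversalEnvelopingAlgebra.ι K (y i) * tau y (MvPolynomial.monomial a 1) := by
  rw [X_mul_monomial, tau_monomial, tau_monomial]
  have : Finsupp.toMultiset (Finsupp.single i 1 + a) = i ::ₘ Finsupp.toMultiset a := by
    rw [map_add, Finsupp.toMultiset_single, one_smul, Multiset.singleton_add]
  rw [this, Multiset.sort_cons]
  · simp [word]
  · intro b hb
    exact h b (by simpa using hb)

/-- The ordered product map intertwines the action on polynomials with left multiplication. -/
lemma tau_rho (y : Basis I K L) (d : ℕ) (x : L) {p : MvPolynomial I K} (hp : p ∈ fil K I d) :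
    tau y (rho y x p) = UniversalEnvelopingAlgebra.ι K x * tau y p := by
  induction d using Nat.strong_induction_on generalizing x p with
  | _ d ih =>
  refine bilin_ext y (φ := (rho y).compr₂ (tau y)) (ψ := (LinearMap.mul K _).compl₁₂
    (UniversalEnvelopingAlgebra.ι K : L →ₗ⁅K⁆ UniversalEnvelopingAlgebra K L).toLinearMap (tau y))
    ?_ x hp
  intro i a ha
  change tau y (rho y (y i) _) = UniversalEnvelopingAlgebra.ι K (y i) * tau y _
  by_cases hi : ∀ k ∈ a.support, i ≤ k
  · rw [rho_of_le y hi, tau_X_mul y hi]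
  set k := low i a hi with hk
  have hlow : ∀ l ∈ a.support, k ≤ l := low_le hi
  have hki : k < i := low_lt hi
  have hd := degree_sub (low_mem hi)
  rw [← hk] at hd
  set a' := a - Finsupp.single k 1 with ha'
  have hlow' : ∀ l ∈ a'.support, k ≤ l := fun l hl => hlow l (support_sub_subset k a hl)
  have hmem : MvPolynomial.monomial a' (1 : K) ∈ fil K I (d - 1) := monomial_mem_fil (by omega)
  have hlt : d - 1 < d := by omega
  have hX : MvPolynomial.monomial a (1 : K) = rho y (y k) (MvPolynomial.monomial a' 1) := by
    rw [rho_of_le y hlow', X_mul_monomial, single_add_sub (low_mem hi)]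
  have hc : tau y (rho y (y k) (MvPolynomial.X i * MvPolynomial.monomial a' 1)) =
      UniversalEnvelopingAlgebra.ι K (y k) *
        tau y (MvPolynomial.X i * MvPolynomial.monomial a' 1) := by
    have h' : ∀ l ∈ (Finsupp.single i 1 + a').support, k ≤ l := by
      intro l hl
      rcases Finset.mem_union.1 (Finsupp.support_add hl) with hl | hl
      · rw [Finset.mem_singleton.1 (Finsupp.support_single_subset hl)]; exact hki.le
      · exact hlow' l hl
    rw [X_mul_monomial, rho_of_le y h', tau_X_mul y h']
  have hc' : tau y (rho y (y k) (rho y (y i) (MvPolynomial.monomial a' 1))) =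
      UniversalEnvelopingAlgebra.ι K (y k) * tau y (rho y (y i) (MvPolynomial.monomial a' 1)) := by
    rw [← sub_add_cancel (rho y (y i) (MvPolynomial.monomial a' 1))
      (MvPolynomial.X i * MvPolynomial.monomial a' 1), map_add, map_add, hc,
      ih _ hlt _ (rho_symbol y i hmem), map_add, mul_add]
  rw [hX, rho_of_lt y hlow' hki, map_add, hc', ih _ hlt _ hmem, ih _ hlt _ hmem, ih _ hlt _ hmem,
    LieHom.map_lie, LieRing.of_associative_ring_bracket]
  noncomm_ring

lemma tau_one (y : Basis I K L) : tau y 1 = 1 := by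
  rw [← MvPolynomial.C_1, ← MvPolynomial.monomial_zero', tau_monomial]
  simp [word]

/-- Induction on the enveloping algebra by left multiplication with elements of `L`. -/
lemma induction_left {P : UniversalEnvelopingAlgebra K L → Prop} (h1 : P 1) (h0 : P 0)
    (ha : ∀ u v, P u → P v → P (u + v)) (hs : ∀ (r : K) u, P u → P (r • u))
    (hm : ∀ x u, P u → P (UniversalEnvelopingAlgebra.ι K x * u))
    (u : UniversalEnvelopingAlgebra K L) : P u := by
  let S : Submodule K (UniversalEnvelopingAlgebra K L) :=
    { carrier := {u | P u}, add_mem' := fun hx hy => ha _ _ hx hy, zero_mem' := h0,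
      smul_mem' := fun r x hx => hs r x hx }
  -- the subalgebra of those elements whose left multiplication preserves `P`
  let A : Subalgebra K (UniversalEnvelopingAlgebra K L) :=
    { carrier := {u | ∀ v ∈ S, u * v ∈ S}
      mul_mem' := fun {a b} ha hb v hv => by rw [mul_assoc]; exact ha _ (hb _ hv)
      add_mem' := fun {a b} ha hb v hv => by rw [add_mul]; exact S.add_mem (ha _ hv) (hb _ hv)
      algebraMap_mem' := fun r v hv => by rw [← Algebra.smul_def]; exact S.smul_mem r hv }
  let f : L →ₗ⁅K⁆ A :=
    { toFun := fun x => ⟨UniversalEnvelopingAlgebra.ι K x, fun v hv => hm x v hv⟩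
      map_add' := fun a b => Subtype.ext (map_add _ a b)
      map_smul' := fun r a => Subtype.ext (map_smul _ r a)
      map_lie' := fun {a b} => Subtype.ext (LieHom.map_lie _ a b) }
  have h : A.val.comp (UniversalEnvelopingAlgebra.lift K f) = AlgHom.id K _ := by
    refine UniversalEnvelopingAlgebra.hom_ext K (LieHom.ext fun x => ?_)
    change ((UniversalEnvelopingAlgebra.lift K f (UniversalEnvelopingAlgebra.ι K x) : A) :
      UniversalEnvelopingAlgebra K L) = _
    rw [UniversalEnvelopingAlgebra.lift_ι_apply]; rfl
  have hu : u ∈ A := by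
    have := (UniversalEnvelopingAlgebra.lift K f u).2
    have e := DFunLike.congr_fun h u
    change ((UniversalEnvelopingAlgebra.lift K f u : A) : UniversalEnvelopingAlgebra K L) = u at e
    rwa [e] at this
  have := hu 1 h1
  rwa [mul_one] at this

lemma tau_uact (y : Basis I K L) (u : UniversalEnvelopingAlgebra K L) (p : MvPolynomial I K) :
    tau y (uact y u p) = u * tau y p := by
  induction u using induction_left generalizing p with
  | h1 => simp
  | h0 => simp
  | ha u v hu hv => rw [map_add, LinearMap.add_apply, map_add, hu, hv, add_mul]
  | hs r u hu => rw [map_smul, LinearMap.smul_apply, map_smul, hu, smul_mul_assoc]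
  | hm x u hu =>
    rw [map_mul, Module.End.mul_apply, uact_ι, tau_rho y _ x (mem_fil_totalDegree _), hu, mul_assoc]

/-- Acting on `1` is a left inverse of the ordered product map, so ordered monomials are linearly
independent. -/
lemma uact_tau_one (y : Basis I K L) (p : MvPolynomial I K) : uact y (tau y p) 1 = p := by
  suffices h : (LinearMap.applyₗ (1 : MvPolynomial I K) ∘ₗ (uact y).toLinearMap) ∘ₗ tau y =
      LinearMap.id from DFunLike.congr_fun h p
  refine (MvPolynomial.basisMonomials I K).ext fun a => ?_
  rw [MvPolynomial.coe_basisMonomials]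
  change uact y (tau y (MvPolynomial.monomial a 1)) 1 = MvPolynomial.monomial a 1
  induction h : a.degree generalizing a with
  | zero =>
    obtain rfl : a = 0 := (Finsupp.degree_eq_zero_iff a).1 h
    rw [MvPolynomial.monomial_zero', MvPolynomial.C_1, tau_one, map_one (uact y),
      Module.End.one_apply]
  | succ n ih =>
    have hne : a.support.Nonempty := by
      rw [Finset.nonempty_iff_ne_empty]
      intro e
      rw [Finsupp.support_eq_empty] at e
      simp [e] at h
    set k := a.support.min' hne with hk
    have hka : k ∈ a.support := Finset.min'_mem _ _
    have hd := degree_sub hka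
    have hlow : ∀ l ∈ (a - Finsupp.single k 1).support, k ≤ l :=
      fun l hl => Finset.min'_le _ _ (support_sub_subset k a hl)
    have ih' := ih (a - Finsupp.single k 1) (by omega)
    rw [← single_add_sub hka, ← X_mul_monomial, tau_X_mul y hlow, map_mul, Module.End.mul_apply,
      ih', uact_ι, rho_of_le y hlow]

/-- The Poincaré–Birkhoff–Witt theorem: increasing products of basis vectors form a basis of the
enveloping algebra. -/
def equiv (y : Basis I K L) : MvPolynomial I K ≃ₗ[K] UniversalEnvelopingAlgebra K L :=
  LinearEquiv.ofBijective (tau y) ⟨(fun p q h => by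
    rw [← uact_tau_one y p, h, uact_tau_one]), fun u => ⟨uact y u 1, by
    rw [tau_uact, tau_one, mul_one]⟩⟩

lemma equiv_monomial (y : Basis I K L) (a : I →₀ ℕ) :
    equiv y (MvPolynomial.monomial a 1) = word y ((Finsupp.toMultiset a).sort (· ≤ ·)) :=
  tau_monomial y a

lemma uact_word_symbol (y : Basis I K L) {n d : ℕ} {a : I →₀ ℕ} (ha : a.degree = n + 1)
    {p : MvPolynomial I K} (hp : p ∈ fil K I d) :
    uact y (tau y (MvPolynomial.monomial a 1)) p - MvPolynomial.monomial a 1 * p ∈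
      fil K I (n + d) := by
  induction n generalizing a with
  | zero =>
    obtain ⟨i, rfl⟩ : ∃ i, a = Finsupp.single i 1 := by
      have h1 : (Finsupp.toMultiset a).card = 1 := by rw [Finsupp.card_toMultiset]; exact ha
      obtain ⟨i, hi⟩ := Multiset.card_eq_one.1 h1
      exact ⟨i, Multiset.toFinsupp.symm.injective (by
        rw [Multiset.toFinsupp_symm_apply, Multiset.toFinsupp_symm_apply, hi,
          Finsupp.toMultiset_single, one_smul])⟩
    have : MvPolynomial.monomial (Finsupp.single i 1) (1 : K) =
        MvPolynomial.X i * MvPolynomial.monomial 0 1 := by rw [X_mul_monomial, add_zero]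
    rw [this, tau_X_mul y (by simp), MvPolynomial.monomial_zero', MvPolynomial.C_1, tau_one,
      mul_one, mul_one, uact_ι, zero_add]
    exact rho_symbol y i hp
  | succ n ih =>
    have hne : a.support.Nonempty := by
      rw [Finset.nonempty_iff_ne_empty]
      intro e
      rw [Finsupp.support_eq_empty] at e
      simp [e] at ha
    set k := a.support.min' hne with hk
    have hka : k ∈ a.support := Finset.min'_mem _ _
    have hd := degree_sub hka
    have hlow : ∀ l ∈ (a - Finsupp.single k 1).support, k ≤ l :=
      fun l hl => Finset.min'_le _ _ (support_sub_subset k a hl)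
    set a' := a - Finsupp.single k 1 with ha'
    have ih' := ih (a := a') (by omega)
    have hm : MvPolynomial.monomial a' 1 * p ∈ fil K I (n + 1 + d) := by
      rw [← sub_sub_self (uact y (tau y (MvPolynomial.monomial a' 1)) p)
        (MvPolynomial.monomial a' 1 * p)]
      refine sub_mem ?_ (fil_mono (by omega) ih')
      suffices h : ∀ (l : List I) (p : MvPolynomial I K), p ∈ fil K I d →
          uact y (word y l) p ∈ fil K I (l.length + d) by
        have := h ((Finsupp.toMultiset a').sort (· ≤ ·)) p hp
        rw [Multiset.length_sort, Finsupp.card_toMultiset] at this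
        rw [tau_monomial]
        have e : (a'.sum fun _ => id) = a'.degree := rfl
        rw [e, show a'.degree = n + 1 by omega] at this
        exact this
      intro l p hp
      induction l with
      | nil => simpa [word] using hp
      | cons i l ihl =>
        have : word y (i :: l) = UniversalEnvelopingAlgebra.ι K (y i) * word y l := by simp [word]
        rw [this, map_mul, Module.End.mul_apply, uact_ι]
        exact fil_mono (by rw [List.length_cons]; omega) (rho_mem_fil y (y i) ihl)
    rw [← single_add_sub hka, ← X_mul_monomial, tau_X_mul y hlow, map_mul, Module.End.mul_apply,
      uact_ι, mul_assoc, ← sub_add_sub_cancel _ (rho y (y k) (MvPolynomial.monomial a' 1 * p)),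
      ← map_sub]
    refine add_mem ?_ (rho_symbol y k hm)
    exact fil_mono (by omega) (rho_mem_fil y (y k) ih')

/-- An element of the enveloping algebra acts on polynomials, up to terms of lower degree, as
multiplication by its symbol. -/
lemma uact_tau_symbol (y : Basis I K L) {n d : ℕ} {q p : MvPolynomial I K}
    (hq : q ∈ fil K I (n + 1)) (hp : p ∈ fil K I d) :
    uact y (tau y q) p - q * p ∈ fil K I (n + d) := by
  refine fil_induction (P := fun q => uact y (tau y q) p - q * p ∈ fil K I (n + d)) ?_ ?_ ?_ ?_ hq
  · intro a ha
    rcases Nat.eq_zero_or_pos a.degree with h | h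
    · obtain rfl : a = 0 := (Finsupp.degree_eq_zero_iff a).1 h
      rw [MvPolynomial.monomial_zero', MvPolynomial.C_1, tau_one, map_one, one_mul,
        Module.End.one_apply, sub_self]
      exact zero_mem _
    · exact fil_mono (by omega) (uact_word_symbol y (n := a.degree - 1) (by omega) hp)
  · simp
  · intro q q' h h'
    rw [map_add, map_add, LinearMap.add_apply, add_mul, add_sub_add_comm]
    exact add_mem h h'
  · intro r q h
    rw [map_smul, map_smul, LinearMap.smul_apply, smul_mul_assoc, ← smul_sub]
    exact Submodule.smul_mem _ _ h

/-- The enveloping algebra of a Lie algebra over a field has no zero divisors, because symbols are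
multiplicative. -/
theorem eq_zero_of_mul_eq_zero (y : Basis I K L) {u v : UniversalEnvelopingAlgebra K L}
    (h : u * v = 0) (hv : v ≠ 0) : u = 0 := by
  obtain ⟨q, rfl⟩ := (equiv y).surjective u
  obtain ⟨p, rfl⟩ := (equiv y).surjective v
  have hp : p ≠ 0 := by rintro rfl; simp at hv
  by_contra hq
  replace hq : q ≠ 0 := by rintro rfl; simp at hq
  have hz : uact y (tau y q) p = 0 := by
    have h' : tau y q * tau y p = 0 := h
    rw [← uact_tau_one y p, ← Module.End.mul_apply, ← map_mul, h', map_zero]; rfl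
  rcases Nat.eq_zero_or_pos q.totalDegree with h0 | h0
  · rw [MvPolynomial.totalDegree_eq_zero_iff_eq_C] at h0
    have hc : q.coeff 0 ≠ 0 := by intro e; rw [e, map_zero] at h0; exact hq h0
    rw [h0, ← mul_one (MvPolynomial.C _), ← MvPolynomial.smul_eq_C_mul, map_smul, tau_one, map_smul,
      map_one, LinearMap.smul_apply, Module.End.one_apply] at hz
    exact hp ((smul_eq_zero.1 hz).resolve_left hc)
  · obtain ⟨n, hn⟩ : ∃ n, q.totalDegree = n + 1 := ⟨q.totalDegree - 1, by omega⟩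
    have hs := uact_tau_symbol y (hn ▸ mem_fil_totalDegree q) (mem_fil_totalDegree p)
    rw [hz, zero_sub, neg_mem_iff] at hs
    have := totalDegree_le_of_mem_fil hs
    rw [MvPolynomial.totalDegree_mul_of_isDomain hq hp] at this
    omega

end
end PBW

namespace Induced

/-! ### Modules induced from a character of a complementary subspace -/

section

open Module

variable {K L : Type*} [Field K] [LieRing L] [LieAlgebra K L]

attribute [local instance 100] LieRing.ofAssociativeRing

variable (n : LieSubalgebra K L)

/-- The map `U(n) → U(L)` induced by the inclusion of a subalgebra. -/
def toU : UniversalEnvelopingAlgebra K n →ₐ[K] UniversalEnvelopingAlgebra K L :=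
  UniversalEnvelopingAlgebra.lift K ((UniversalEnvelopingAlgebra.ι K).comp n.incl)

lemma toU_ι (x : n) : toU n (UniversalEnvelopingAlgebra.ι K x) =
    UniversalEnvelopingAlgebra.ι K (x : L) := UniversalEnvelopingAlgebra.lift_ι_apply K _ x

/-- The natural action of a subalgebra `n` on `Hom(L, U(n))`, where `n` acts on `L` by the adjoint
action and on `U(n)` by left multiplication. -/
def homAct : n →ₗ⁅K⁆ Module.End K (L →ₗ[K] UniversalEnvelopingAlgebra K n) where
  toFun x :=
    { toFun := fun R => (LinearMap.mulLeft K (UniversalEnvelopingAlgebra.ι K x)) ∘ₗ R -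
        R ∘ₗ (LieAlgebra.ad K L (x : L) : L →ₗ[K] L)
      map_add' := fun R S => by
        ext p; simp [mul_add]; abel
      map_smul' := fun r R => by
        ext p; simp [smul_sub] }
  map_add' x y := by ext R p; simp [add_mul]; abel
  map_smul' r x := by ext R p; simp [smul_sub]
  map_lie' {x y} := by
    ext R p
    simp [LieRing.of_associative_ring_bracket, sub_mul, mul_sub, mul_assoc]
    abel

lemma homAct_apply (x : n) (R : L →ₗ[K] UniversalEnvelopingAlgebra K n) (p : L) :
    homAct n x R p = UniversalEnvelopingAlgebra.ι K x * R p + R ⁅p, (x : L)⁆ := by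
  have : R ⁅p, (x : L)⁆ = - R ⁅(x : L), p⁆ := by rw [← lie_skew, map_neg]
  rw [this, ← sub_eq_add_neg]; rfl

variable {n} (π : L →ₗ[K] n) (χ : L →ₗ[K] K)

/-- The element `x ↦ π(x) + χ(x)` of `Hom(L, U(n))`. -/
def base : L →ₗ[K] UniversalEnvelopingAlgebra K n :=
  (UniversalEnvelopingAlgebra.ι K : n →ₗ⁅K⁆ UniversalEnvelopingAlgebra K n).toLinearMap ∘ₗ π +
    (Algebra.linearMap K _) ∘ₗ χ

/-- For `x` in `L` and `u` in `U(n)`, the product `x · u` in the module induced from the character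
`χ` of the complement `ker π` of `n`, as an element of `U(n)`. As a function of `x`, it is the
element `u · base π χ` of the `U(n)`-module `Hom(L, U(n))`. -/
def opp (x : L) (u : UniversalEnvelopingAlgebra K n) : UniversalEnvelopingAlgebra K n :=
  UniversalEnvelopingAlgebra.lift K (homAct n) u (base π χ) x

lemma opp_one (x : L) : opp π χ x 1 =
    UniversalEnvelopingAlgebra.ι K (π x) + algebraMap K _ (χ x) := by
  rw [opp, map_one]; rfl

lemma opp_mul (x : L) (y : n) (u : UniversalEnvelopingAlgebra K n) :
    opp π χ x (UniversalEnvelopingAlgebra.ι K y * u) =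
      UniversalEnvelopingAlgebra.ι K y * opp π χ x u + opp π χ ⁅x, (y : L)⁆ u := by
  rw [opp, map_mul, UniversalEnvelopingAlgebra.lift_ι_apply, Module.End.mul_apply, homAct_apply]
  rfl

/-- The operator `u ↦ x · u`, depending linearly on `x`. -/
def op : L →ₗ[K] Module.End K (UniversalEnvelopingAlgebra K n) where
  toFun x :=
    { toFun := opp π χ x
      map_add' := fun u v => by
        simp only [opp, map_add (UniversalEnvelopingAlgebra.lift K (homAct n)), LinearMap.add_apply]
      map_smul' := fun r u => by
        simp only [opp, map_smul (UniversalEnvelopingAlgebra.lift K (homAct n)),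
          LinearMap.smul_apply, RingHom.id_apply] }
  map_add' x y := LinearMap.ext fun u =>
    map_add (UniversalEnvelopingAlgebra.lift K (homAct n) u (base π χ)) x y
  map_smul' r x := LinearMap.ext fun u =>
    map_smul (UniversalEnvelopingAlgebra.lift K (homAct n) u (base π χ)) r x

lemma op_one (x : L) : op π χ x 1 =
    UniversalEnvelopingAlgebra.ι K (π x) + algebraMap K _ (χ x) := opp_one π χ x

lemma op_mul (x : L) (y : n) (u : UniversalEnvelopingAlgebra K n) :
    op π χ x (UniversalEnvelopingAlgebra.ι K y * u) =
      UniversalEnvelopingAlgebra.ι K y * op π χ x u + op π χ ⁅x, (y : L)⁆ u := opp_mul π χ x y u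

variable {π χ} (hπ : ∀ x : n, π x = x) (hχ : ∀ x : n, χ x = 0)
include hπ hχ

/-- On `n` the action is left multiplication. -/
lemma op_sub (x : n) (u : UniversalEnvelopingAlgebra K n) :
    op π χ x u = UniversalEnvelopingAlgebra.ι K x * u := by
  induction u using PBW.induction_left generalizing x with
  | h1 => rw [op_one, hπ, hχ, (algebraMap K _).map_zero, add_zero, mul_one]
  | h0 => simp
  | ha u v hu hv => rw [map_add, hu, hv, mul_add]
  | hs r u hu => rw [map_smul, hu, mul_smul_comm]
  | hm y u hu =>
    rw [op_mul, hu, show (⁅(x : L), (y : L)⁆ : L) = ((⁅x, y⁆ : n) : L) from rfl, hu, LieHom.map_lie,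
      LieRing.of_associative_ring_bracket]
    noncomm_ring

variable (hk : ∀ x y, π x = 0 → π y = 0 → π ⁅x, y⁆ = 0 ∧ χ ⁅x, y⁆ = 0)
include hk

/-- The action respects brackets at `1`, where the hypothesis that `χ` is a character of the
complement `ker π` enters. -/
lemma op_lie_one (x y : L) : op π χ ⁅x, y⁆ 1 =
    op π χ x (op π χ y 1) - op π χ y (op π χ x 1) := by
  -- the identity is clear if one of the elements is in `n`, or if both are in `ker π`
  have h1 (x : L) (y : n) (u) : op π χ ⁅x, (y : L)⁆ u =
      op π χ x (op π χ y u) - op π χ y (op π χ x u) := by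
    rw [op_sub hπ hχ y, op_sub hπ hχ y, op_mul]; abel
  have h2 (x : n) (y : L) (u) : op π χ ⁅(x : L), y⁆ u =
      op π χ x (op π χ y u) - op π χ y (op π χ x u) := by
    rw [← lie_skew, map_neg, LinearMap.neg_apply, h1]; abel
  have h3 (x y : L) (hx : π x = 0) (hy : π y = 0) : op π χ ⁅x, y⁆ 1 =
      op π χ x (op π χ y 1) - op π χ y (op π χ x 1) := by
    obtain ⟨a, b⟩ := hk x y hx hy
    simp only [op_one, a, b, hx, hy, map_zero, zero_add, Algebra.algebraMap_eq_smul_one, map_smul]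
    rw [smul_comm, sub_self]
  have hp (x : L) : π (x - π x) = 0 := by rw [map_sub, hπ, sub_self]
  have hd (x : L) : x = π x + (x - π x) := by abel
  have e := h3 (x - π x) (y - π y) (hp x) (hp y)
  have e1 := h1 (x - π x) (π y) 1
  have e2 := h2 (π x) y 1
  rw [sub_lie] at e1 e
  have e3 : op π χ ⁅x, y⁆ 1 = op π χ ⁅(π x : L), y⁆ 1 + (op π χ ⁅x - π x, (π y : L)⁆ 1 +
      op π χ ⁅x - π x, y - π y⁆ 1) := by
    rw [← LinearMap.add_apply, ← map_add, ← LinearMap.add_apply, ← map_add]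
    congr 2
    simp only [sub_lie, lie_sub]; abel
  rw [e3, h3 _ _ (hp x) (hp y), h1, h2]
  simp only [map_sub, LinearMap.sub_apply]
  abel

/-- The operators `x ↦ (u ↦ x · u)` form a representation of `L` on `U(n)`. -/
lemma op_lie (x y : L) (u : UniversalEnvelopingAlgebra K n) : op π χ ⁅x, y⁆ u =
    op π χ x (op π χ y u) - op π χ y (op π χ x u) := by
  induction u using PBW.induction_left generalizing x y with
  | h1 => exact op_lie_one hπ hχ hk x y
  | h0 => simp
  | ha u v hu hv => simp only [map_add, hu, hv]; abel
  | hs r u hu => simp only [map_smul, hu, smul_sub]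
  | hm z u hu =>
    simp only [op_mul, map_add, lie_lie x y (z : L), map_sub, LinearMap.sub_apply, hu]
    rw [mul_sub]; abel

/-- The action of `U(L)` on `U(n)`. -/
def uact : UniversalEnvelopingAlgebra K L →ₐ[K] Module.End K (UniversalEnvelopingAlgebra K n) :=
  UniversalEnvelopingAlgebra.lift K
    { op π χ with
      map_lie' := fun {x y} => LinearMap.ext fun u => op_lie hπ hχ hk x y u }

lemma uact_ι (x : L) (u : UniversalEnvelopingAlgebra K n) :
    uact hπ hχ hk (UniversalEnvelopingAlgebra.ι K x) u = op π χ x u := by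
  rw [uact, UniversalEnvelopingAlgebra.lift_ι_apply]; rfl

lemma uact_toU (w u : UniversalEnvelopingAlgebra K n) : uact hπ hχ hk (toU n w) u = w * u := by
  induction w using PBW.induction_left with
  | h1 => simp
  | h0 => simp
  | ha v w hv hw => rw [map_add, map_add, LinearMap.add_apply, hv, hw, add_mul]
  | hs r w hw => rw [map_smul, map_smul, LinearMap.smul_apply, hw, smul_mul_assoc]
  | hm z w hw =>
    rw [map_mul, map_mul, Module.End.mul_apply, hw, toU_ι, uact_ι, op_sub hπ hχ, mul_assoc]

omit hπ hχ hk in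
/-- A vector on which `ker π` acts by the character `χ` generates a quotient of the induced module:
the action of `L` on its `U(n)`-multiples is given by `op`. -/
lemma ι_smul_toU_smul {M : Type*} [AddCommGroup M] [Module (UniversalEnvelopingAlgebra K L) M]
    (v : M) (hπ' : ∀ x : n, π x = x) (hv : ∀ x, π x = 0 → UniversalEnvelopingAlgebra.ι K x • v =
      algebraMap K (UniversalEnvelopingAlgebra K L) (χ x) • v) (hχ' : ∀ x : n, χ x = 0)
    (x : L) (u : UniversalEnvelopingAlgebra K n) :
    UniversalEnvelopingAlgebra.ι K x • toU n u • v = toU n (op π χ x u) • v := by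
  induction u using PBW.induction_left generalizing x with
  | h1 =>
    rw [op_one, map_add, add_smul, toU_ι, map_one, one_smul, AlgHom.commutes]
    have h := hv (x - π x) (by rw [map_sub, hπ', sub_self])
    rw [map_sub, map_sub, hχ', sub_zero, sub_smul, sub_eq_iff_eq_add] at h
    rw [h, add_comm]
  | h0 => simp
  | ha u v hu hv => simp only [map_add, add_smul, smul_add, hu, hv]
  | hs r u hu =>
    rw [map_smul, map_smul, map_smul, Algebra.smul_def, Algebra.smul_def, mul_smul, mul_smul, ← hu,
      ← mul_smul, ← Algebra.commutes, mul_smul]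
  | hm z u hu =>
    rw [op_mul, map_add, map_mul, map_mul, toU_ι, add_smul, mul_smul, mul_smul, ← hu, ← hu,
      LieHom.map_lie, LieRing.of_associative_ring_bracket, sub_smul, mul_smul, mul_smul]
    abel

lemma smul_eq_toU_smul {M : Type*} [AddCommGroup M] [Module (UniversalEnvelopingAlgebra K L) M]
    (v : M) (hv : ∀ x, π x = 0 → UniversalEnvelopingAlgebra.ι K x • v =
      algebraMap K (UniversalEnvelopingAlgebra K L) (χ x) • v)
    (w : UniversalEnvelopingAlgebra K L) : w • v = toU n (uact hπ hχ hk w 1) • v := by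
  induction w using PBW.induction_left with
  | h1 => simp
  | h0 => simp
  | ha u v hu hv => simp only [map_add, add_smul, hu, hv, LinearMap.add_apply]
  | hs r u hu =>
    rw [map_smul, LinearMap.smul_apply, map_smul, Algebra.smul_def, Algebra.smul_def, mul_smul, hu,
      mul_smul]
  | hm z u hu =>
    rw [map_mul, Module.End.mul_apply, uact_ι, mul_smul, hu,
      ι_smul_toU_smul v hπ hv hχ]

end
end Induced

/-! ### Normal ordering -/

namespace Induced

section

open Module

variable {K L I : Type*} [Field K] [LieRing L] [LieAlgebra K L]

attribute [local instance 100] LieRing.ofAssociativeRing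

lemma mapDomain_cons_nil {I M : Type*} [AddCommMonoid M] (i : I) (f : List I →₀ M) :
    Finsupp.mapDomain (List.cons i) f [] = 0 :=
  Finsupp.mapDomain_of_notMem_range _ _ (by simp)

lemma mapDomain_cons_self {I M : Type*} [AddCommMonoid M] (i : I) (f : List I →₀ M) (t : List I) :
    Finsupp.mapDomain (List.cons i) f (i :: t) = f t :=
  Finsupp.mapDomain_apply (List.cons_injective) _ _

lemma mapDomain_cons_of_ne {I M : Type*} [AddCommMonoid M] {i j : I} (h : i ≠ j) (f : List I →₀ M)
    (t : List I) : Finsupp.mapDomain (List.cons i) f (j :: t) = 0 :=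
  Finsupp.mapDomain_of_notMem_range _ _ (by rintro ⟨s, hs⟩; exact h (List.cons.inj hs).1)

/-- The map `x ↦ [x, y]`. -/
def rad (K : Type*) {L : Type*} [Field K] [LieRing L] [LieAlgebra K L] (y : L) : L →ₗ[K] L where
  toFun x := ⁅x, y⁆
  map_add' x x' := add_lie x x' y
  map_smul' r x := smul_lie r x y

/-- Moving `x` to the right through the product `y_{i₁} ⋯ y_{iᵣ}`: the result is the sum over all
subsets `S` of the product of the factors outside `S` times the iterated bracket of `x` with the
factors in `S`. The terms are collected by the lists of the remaining factors. -/
def kap (K : Type*) {L I : Type*} [Field K] [LieRing L] [LieAlgebra K L] (y : I → L) :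
    List I → L →ₗ[K] (List I →₀ L)
  | [] => Finsupp.lsingle []
  | i :: s => Finsupp.lmapDomain L K (List.cons i) ∘ₗ kap K y s + kap K y s ∘ₗ rad K (y i)

variable (y : I → L)

lemma kap_nil (x : L) : kap K y [] x = Finsupp.single [] x := rfl

lemma kap_cons (i : I) (s : List I) (x : L) : kap K y (i :: s) x =
    Finsupp.mapDomain (List.cons i) (kap K y s x) + kap K y s ⁅x, y i⁆ := rfl

lemma sublist_of_kap_ne_zero {s t : List I} {x : L} (h : kap K y s x t ≠ 0) : t.Sublist s := by
  classical
  induction s generalizing t x with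
  | nil =>
    rw [kap_nil, Finsupp.single_apply] at h
    split at h
    · next e => rw [← e]
    · exact absurd rfl h
  | cons i s ih =>
    rw [kap_cons, Finsupp.add_apply] at h
    by_cases h2 : kap K y s ⁅x, y i⁆ t = 0
    · rw [h2, add_zero] at h
      cases t with
      | nil => exact List.nil_sublist _
      | cons j t =>
        by_cases hij : i = j
        · subst hij
          rw [mapDomain_cons_self] at h
          exact (ih h).cons_cons i
        · rw [mapDomain_cons_of_ne hij] at h; exact absurd rfl h
    · exact (ih h2).cons i

/-- The ways to remove one factor from a product, collected by the lists of remaining factors. -/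
def del : List I → (List I →₀ (I →₀ ℕ))
  | [] => 0
  | i :: s => Finsupp.mapDomain (List.cons i) (del s) + Finsupp.single s (Finsupp.single i 1)

lemma del_cons (i : I) (s : List I) : del (i :: s) =
    Finsupp.mapDomain (List.cons i) (del s) + Finsupp.single s (Finsupp.single i 1) := rfl

lemma perm_of_del_ne_zero {s t : List I} {i : I} (h : del s t i ≠ 0) : s.Perm (i :: t) := by
  classical
  induction s generalizing t with
  | nil => exact absurd rfl h
  | cons j s ih =>
    rw [del_cons, Finsupp.add_apply, Finsupp.add_apply] at h
    by_cases h2 : (Finsupp.single s (Finsupp.single j 1) : List I →₀ (I →₀ ℕ)) t i = 0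
    · rw [h2, add_zero] at h
      cases t with
      | nil => rw [mapDomain_cons_nil] at h; exact absurd rfl h
      | cons k t =>
        by_cases hjk : j = k
        · subst hjk
          rw [mapDomain_cons_self] at h
          exact ((ih h).cons j).trans (List.Perm.swap i j t)
        · rw [mapDomain_cons_of_ne hjk] at h; exact absurd rfl h
    · rw [Finsupp.single_apply] at h2
      split at h2
      · next e =>
        subst e
        rw [Finsupp.single_apply] at h2
        split at h2
        · next e => rw [e]
        · exact absurd rfl h2
      · exact absurd rfl h2

lemma del_cons_self_ne_zero (i : I) (t : List I) : del (i :: t) t i ≠ 0 := by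
  rw [del_cons, Finsupp.add_apply, Finsupp.add_apply, Finsupp.single_eq_same,
    Finsupp.single_eq_same]
  omega

open scoped Classical in
lemma kap_apply_of_length_le {s t : List I} (h : s.length ≤ t.length) (x : L) :
    kap K y s x t = if s = t then x else 0 := by
  induction s generalizing t x with
  | nil => rw [kap_nil, Finsupp.single_apply]
  | cons i s ih =>
    rw [List.length_cons] at h
    have h2 : s ≠ t := by rintro rfl; omega
    rw [kap_cons, Finsupp.add_apply, ih (by omega), if_neg h2, add_zero]
    cases t with
    | nil => simp at h
    | cons j t =>
      by_cases hij : i = j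
      · subst hij
        rw [mapDomain_cons_self, ih (by simpa using h)]
        simp
      · rw [mapDomain_cons_of_ne hij, if_neg (by simp [hij])]

open scoped Classical in
/-- The terms of `kap` in which at most one factor is removed. -/
lemma kap_apply_of_length_le_succ {s t : List I} (h : s.length ≤ t.length + 1) (x : L) :
    kap K y s x t = ⁅x, Finsupp.linearCombination ℕ y (del s t)⁆ + if s = t then x else 0 := by
  induction s generalizing t with
  | nil => rw [kap_nil, Finsupp.single_apply, del]; simp
  | cons i s ih =>
    rw [List.length_cons] at h
    rw [kap_cons, Finsupp.add_apply, kap_apply_of_length_le y (by omega), del_cons,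
      Finsupp.add_apply, map_add, lie_add]
    have h3 : ⁅x, Finsupp.linearCombination ℕ y
        ((Finsupp.single s (Finsupp.single i 1) : List I →₀ (I →₀ ℕ)) t)⁆ =
        if s = t then ⁅x, y i⁆ else 0 := by
      rw [Finsupp.single_apply]
      split <;> simp
    rw [h3]
    suffices h4 : Finsupp.mapDomain (List.cons i) (kap K y s x) t =
        ⁅x, Finsupp.linearCombination ℕ y (Finsupp.mapDomain (List.cons i) (del s) t)⁆ +
          if i :: s = t then x else 0 by
      rw [h4]; abel
    cases t with
    | nil => rw [mapDomain_cons_nil, mapDomain_cons_nil]; simp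
    | cons j t =>
      by_cases hij : i = j
      · subst hij
        rw [mapDomain_cons_self, mapDomain_cons_self, ih (by simpa using h)]
        simp
      · rw [mapDomain_cons_of_ne hij, mapDomain_cons_of_ne hij, if_neg (by simp [hij])]; simp

end

section

open Module

variable {K L I : Type*} [Field K] [LieRing L] [LieAlgebra K L] [LinearOrder I]

attribute [local instance 100] LieRing.ofAssociativeRing

variable {n : LieSubalgebra K L} (π : L →ₗ[K] n) (χ : L →ₗ[K] K) (y : Basis I K n)

/-- The element `∑ₜ y_t (π(Zₜ) + χ(Zₜ))` of the enveloping algebra. -/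
def ev : (List I →₀ L) →ₗ[K] UniversalEnvelopingAlgebra K n :=
  Finsupp.lsum K fun t => LinearMap.mulLeft K (PBW.word y t) ∘ₗ base π χ

lemma ev_single (t : List I) (z : L) :
    ev π χ y (Finsupp.single t z) = PBW.word y t * base π χ z := by
  rw [ev, Finsupp.lsum_single]; rfl

lemma word_cons (i : I) (t : List I) :
    PBW.word y (i :: t) = UniversalEnvelopingAlgebra.ι K (y i) * PBW.word y t := by
  simp [PBW.word]

lemma word_append_singleton (t : List I) (i : I) :
    PBW.word y (t ++ [i]) = PBW.word y t * UniversalEnvelopingAlgebra.ι K (y i) := by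
  simp [PBW.word]

lemma ev_mapDomain_cons (i : I) (f : List I →₀ L) :
    ev π χ y (Finsupp.mapDomain (List.cons i) f) =
      UniversalEnvelopingAlgebra.ι K (y i) * ev π χ y f := by
  induction f using Finsupp.induction_linear with
  | zero => simp
  | add f f' h h' => rw [Finsupp.mapDomain_add, map_add, h, h', map_add, mul_add]
  | single t z => rw [Finsupp.mapDomain_single, ev_single, ev_single, word_cons, mul_assoc]

/-- The action on a product is computed by normal ordering. -/
lemma op_word (s : List I) (x : L) : op π χ x (PBW.word y s) =
    ev π χ y (kap K (fun i => (y i : L)) s x) := by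
  induction s generalizing x with
  | nil =>
    rw [kap_nil, ev_single]
    simp only [PBW.word, List.map_nil, List.prod_nil, one_mul]
    exact op_one π χ x
  | cons i s ih => rw [word_cons, op_mul, ih, ih, kap_cons, map_add, ev_mapDomain_cons]

/-- The coefficient of a monomial with respect to the Poincaré–Birkhoff–Witt basis. -/
def coef (s : List I) : UniversalEnvelopingAlgebra K n →ₗ[K] K :=
  (MvPolynomial.lcoeff K (Multiset.toFinsupp (s : Multiset I))) ∘ₗ (PBW.equiv y).symm.toLinearMap

lemma coef_word {s t : List I} (hs : s.Pairwise (· ≤ ·)) (ht : t.Pairwise (· ≤ ·)) :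
    coef y s (PBW.word y t) = if t = s then 1 else 0 := by
  have h1 : PBW.word y t =
      PBW.equiv y (MvPolynomial.monomial (Multiset.toFinsupp (t : Multiset I)) 1) := by
    rw [PBW.equiv_monomial, Multiset.toFinsupp_toMultiset, Multiset.coe_sort,
      List.mergeSort_of_pairwise]
    simpa using ht
  rw [coef, h1, LinearMap.comp_apply, LinearEquiv.coe_coe, LinearEquiv.symm_apply_apply,
    MvPolynomial.lcoeff_apply, MvPolynomial.coeff_monomial]
  congr 1
  rw [EmbeddingLike.apply_eq_iff_eq, Multiset.coe_eq_coe, eq_iff_iff]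
  exact ⟨fun h => h.eq_of_pairwise' ht hs, fun h => h ▸ List.Perm.refl _⟩

lemma ev_apply (Z : List I →₀ L) : ev π χ y Z = Z.sum fun t z =>
    ((y.repr (π z)).sum fun i r => r • PBW.word y (t ++ [i])) + χ z • PBW.word y t := by
  rw [ev, Finsupp.lsum_apply]
  refine Finsupp.sum_congr fun t _ => ?_
  change PBW.word y t * (UniversalEnvelopingAlgebra.ι K (π (Z t)) + algebraMap K _ (χ (Z t))) = _
  rw [mul_add, ← Algebra.commutes, ← Algebra.smul_def]
  congr 1
  conv_lhs => rw [← y.linearCombination_repr (π (Z t)), Finsupp.linearCombination_apply,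
    Finsupp.sum, map_sum, Finset.mul_sum]
  refine Finset.sum_congr rfl fun i _ => ?_
  rw [map_smul, mul_smul_comm, ← word_append_singleton]

/-- If the variables of the elements `π(Zₜ)` are larger than those of the words `t`, then there is
no cancellation. -/
lemma proj_eq_zero_of_ev_eq_zero {Z : List I →₀ L} (h : ev π χ y Z = 0)
    (hs : ∀ t ∈ Z.support, t.Pairwise (· ≤ ·))
    (hlt : ∀ t ∈ Z.support, ∀ i, y.repr (π (Z t)) i ≠ 0 → ∀ t' ∈ Z.support, ∀ j ∈ t', j < i)
    (t : List I) : π (Z t) = 0 := by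
  classical
  by_contra h0
  have ht : t ∈ Z.support := by
    rw [Finsupp.mem_support_iff]; intro e; rw [e, map_zero] at h0; exact h0 rfl
  obtain ⟨i, hi⟩ : ∃ i, y.repr (π (Z t)) i ≠ 0 := by
    by_contra hc
    push Not at hc
    exact h0 (y.repr.map_eq_zero_iff.1 (Finsupp.ext hc))
  have hsort (t') (ht' : t' ∈ Z.support) (j) (hj : ∀ k ∈ t', k < j) :
      (t' ++ [j]).Pairwise (· ≤ ·) := by
    rw [List.pairwise_append]
    refine ⟨hs t' ht', List.pairwise_singleton _ _, fun a ha c hc => ?_⟩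
    rw [List.mem_singleton.1 hc]
    exact (hj a ha).le
  have hti := hsort t ht i (hlt t ht i hi t ht)
  have h1 := congrArg (coef y (t ++ [i])) h
  rw [ev_apply, map_zero, Finsupp.sum, map_sum, Finset.sum_eq_single t] at h1
  · rw [map_add, map_smul, coef_word y hti (hs t ht), if_neg (by simp), smul_zero, add_zero,
      Finsupp.sum, map_sum, Finset.sum_eq_single i] at h1
    · rw [map_smul, coef_word y hti hti, if_pos rfl, smul_eq_mul, mul_one] at h1
      exact hi h1
    · intro j hj hji
      rw [map_smul, coef_word y hti (hsort t ht j
        (hlt t ht j (Finsupp.mem_support_iff.1 hj) t ht)), if_neg (by simpa using hji), smul_zero]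
    · intro hi'
      rw [Finsupp.notMem_support_iff.1 hi', zero_smul, map_zero]
  · intro t' ht' htt
    rw [map_add, map_smul, coef_word y hti (hs t' ht'), if_neg, smul_zero, add_zero, Finsupp.sum,
      map_sum]
    · refine Finset.sum_eq_zero fun j hj => ?_
      rw [map_smul, coef_word y hti (hsort t' ht' j
        (hlt t' ht' j (Finsupp.mem_support_iff.1 hj) t' ht')), if_neg, smul_zero]
      intro e
      exact htt (List.append_inj_left' e rfl)
    · intro e
      have := hlt t ht i hi t' ht' i (by rw [e]; simp)
      exact lt_irrefl _ this
  · intro ht'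
    exact absurd ht ht'

lemma chi_eq_zero_of_ev_eq_zero {Z : List I →₀ L} (h : ev π χ y Z = 0)
    (hs : ∀ t ∈ Z.support, t.Pairwise (· ≤ ·)) (hπ : ∀ t, π (Z t) = 0) (t : List I) :
    χ (Z t) = 0 := by
  classical
  by_cases ht : t ∈ Z.support
  · have h1 := congrArg (coef y t) h
    rw [ev_apply, map_zero, Finsupp.sum, map_sum, Finset.sum_eq_single t] at h1
    · rw [hπ, map_zero, Finsupp.sum_zero_index, zero_add, map_smul, coef_word y (hs t ht) (hs t ht),
        if_pos rfl, smul_eq_mul, mul_one] at h1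
      exact h1
    · intro t' ht' htt
      rw [hπ, map_zero, Finsupp.sum_zero_index, zero_add, map_smul,
        coef_word y (hs t ht) (hs t' ht'),
        if_neg htt, smul_zero]
    · intro ht'
      exact absurd ht ht'
  · rw [Finsupp.notMem_support_iff.1 ht, map_zero]

end

end Induced

/-! ### Diagonal operators -/

/-- The coordinates of the image of a vector under a diagonal operator. -/
lemma Module.Basis.repr_diag {κ V : Type*} [AddCommGroup V] [Module ℂ V] (B : Module.Basis κ ℂ V)
    (D : V →ₗ[ℂ] V) (c : κ → ℂ) (hD : ∀ k, D (B k) = c k • B k) (x : V) (k : κ) :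
    B.repr (D x) k = c k * B.repr x k := by
  suffices h : B.coord k ∘ₗ D = c k • B.coord k from DFunLike.congr_fun h x
  refine B.ext fun l => ?_
  classical
  simp only [LinearMap.comp_apply, hD, map_smul, LinearMap.smul_apply, Module.Basis.coord_apply,
    Module.Basis.repr_self, smul_eq_mul]
  rcases eq_or_ne l k with rfl | h
  · rfl
  · rw [Finsupp.single_eq_of_ne h.symm, mul_zero, mul_zero]

/-- An eigenvector of a diagonal operator is supported on the basis vectors with its eigenvalue. -/
lemma Module.Basis.repr_eq_zero_of_diag {κ V : Type*} [AddCommGroup V] [Module ℂ V]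
    (B : Module.Basis κ ℂ V) {D : V →ₗ[ℂ] V} {c : κ → ℂ} (hD : ∀ k, D (B k) = c k • B k) {x : V}
    {μ : ℂ} (hx : D x = μ • x) {k : κ} (hk : c k ≠ μ) : B.repr x k = 0 := by
  have h := B.repr_diag D c hD x k
  rw [hx, map_smul, Finsupp.smul_apply, smul_eq_mul] at h
  by_contra h0
  exact hk (mul_right_cancel₀ h0 h).symm

/-- A subspace that is stable under a diagonal operator contains the components of its elements in
the eigenspaces. -/
lemma Module.Basis.exists_component {κ V : Type*} [AddCommGroup V] [Module ℂ V]
    (B : Module.Basis κ ℂ V) (D : V →ₗ[ℂ] V) (c : κ → ℂ) (hD : ∀ k, D (B k) = c k • B k)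
    (N : Submodule ℂ V) (hN : ∀ v ∈ N, D v ∈ N) {v : V} (hv : v ∈ N) (μ : ℂ) :
    ∃ v' ∈ N, ∀ k, (c k = μ → B.repr v' k = B.repr v k) ∧ (c k ≠ μ → B.repr v' k = 0) := by
  classical
  let s : Finset ℂ := (B.repr v).support.image c
  let P : Polynomial ℂ := Lagrange.interpolate s id fun x => if x = μ then 1 else 0
  have hP (x) (hx : x ∈ s) : P.eval x = if x = μ then 1 else 0 :=
    Lagrange.eval_interpolate_at_node (v := id) _ Function.injective_id.injOn hx
  have hd (Q : Polynomial ℂ) (k) : Polynomial.aeval D Q (B k) = Q.eval (c k) • B k :=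
    Module.End.aeval_apply_of_hasEigenvector
      ⟨Module.End.mem_eigenspace_iff.2 (hD k), B.ne_zero k⟩
  refine ⟨Polynomial.aeval D P v, ?_, fun k => ?_⟩
  · generalize P = Q
    induction Q using Polynomial.induction_on with
    | C a => rw [Polynomial.aeval_C]; exact N.smul_mem a hv
    | add p q hp hq => rw [map_add]; exact add_mem hp hq
    | monomial n a h =>
      rw [pow_succ', ← mul_assoc, mul_comm (Polynomial.C a), mul_assoc, map_mul, Polynomial.aeval_X]
      exact hN _ h
  · rw [B.repr_diag _ _ (hd P)]
    by_cases h0 : B.repr v k = 0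
    · rw [h0, mul_zero]; exact ⟨fun _ => rfl, fun _ => rfl⟩
    · rw [hP _ (Finset.mem_image_of_mem c (Finsupp.mem_support_iff.2 h0))]
      constructor
      · intro h; rw [if_pos h, one_mul]
      · intro h; rw [if_neg h, zero_mul]

namespace DoubleAffine

open Module LieAlgebra LieAlgebra.IsKilling

section Finite

variable {g : Type*} [LieRing g] [LieAlgebra ℂ g] [FiniteDimensional ℂ g] [IsSimple ℂ g]
  {H : LieSubalgebra ℂ g} [H.IsCartanSubalgebra]

/-! ### Weight spaces of a simple Lie algebra -/

variable (H) in
/-- The weight space of `g` for the functional `w` on the Cartan subalgebra. -/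
def eig (w : Dual ℂ H) : Submodule ℂ g where
  carrier := {x | ∀ h : H, ⁅(h : g), x⁆ = w h • x}
  add_mem' hx hy h := by rw [lie_add, hx h, hy h, smul_add]
  zero_mem' h := by simp
  smul_mem' r x hx h := by rw [lie_smul, hx h, smul_comm]

lemma mem_eig {w : Dual ℂ H} {x : g} : x ∈ eig H w ↔ ∀ h : H, ⁅(h : g), x⁆ = w h • x := Iff.rfl

lemma mem_eig_iff_rootSpace {w : Dual ℂ H} {x : g} : x ∈ eig H w ↔ x ∈ rootSpace H w := by
  constructor
  · intro hx
    refine LieModule.weightSpace_le_genWeightSpace g (w : H → ℂ) ?_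
    rw [LieModule.mem_weightSpace]
    exact hx
  · intro hx h
    exact lie_eq_smul_of_mem_rootSpace hx h

lemma lie_mem_eig {v w : Dual ℂ H} {x y : g} (hx : x ∈ eig H v) (hy : y ∈ eig H w) :
    ⁅x, y⁆ ∈ eig H (v + w) := by
  intro h
  rw [leibniz_lie, hx h, hy h, smul_lie, lie_smul, ← add_smul]; rfl

lemma mem_eig_zero {x : g} : x ∈ eig H (0 : Dual ℂ H) ↔ x ∈ H := by
  rw [mem_eig_iff_rootSpace]
  change x ∈ rootSpace H (0 : H → ℂ) ↔ _
  rw [rootSpace_zero_eq]; simp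

/-- A weight of `g` is zero or a root. -/
lemma exists_root_of_mem_eig {w : Dual ℂ H} {x : g} (hx : x ∈ eig H w) (h0 : x ≠ 0) (hw : w ≠ 0) :
    ∃ α : H.root, (rootSystem H).root α = w := by
  have hne : LieModule.genWeightSpace g (w : H → ℂ) ≠ ⊥ := by
    intro e
    rw [mem_eig_iff_rootSpace] at hx
    change x ∈ LieModule.genWeightSpace g (w : H → ℂ) at hx
    rw [e] at hx
    exact h0 (by simpa using hx)
  let W : LieModule.Weight ℂ H g := ⟨w, hne⟩
  have hW : W.IsNonZero := by
    intro e
    exact hw (LinearMap.ext fun h => congrFun e h)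
  refine ⟨⟨W, by simpa using hW⟩, ?_⟩
  ext h; rfl

lemma exists_mem_eig_root (α : H.root) : ∃ x ∈ eig H ((rootSystem H).root α), x ≠ 0 := by
  obtain ⟨x, hx, h0⟩ := α.1.exists_ne_zero
  exact ⟨x, mem_eig_iff_rootSpace.2 hx, h0⟩

lemma finrank_eig_root (α : H.root) : finrank ℂ (eig H ((rootSystem H).root α)) = 1 := by
  rw [← finrank_rootSpace_eq_one α.1 (LieSubalgebra.isNonZero_coe_root α)]
  have : eig H ((rootSystem H).root α) = (rootSpace H (α.1 : H → ℂ)).toSubmodule := by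
    ext x; exact mem_eig_iff_rootSpace
  rw [this]; rfl

lemma exists_smul_eq {α : H.root} {x y : g} (hx : x ∈ eig H ((rootSystem H).root α)) (h0 : x ≠ 0)
    (hy : y ∈ eig H ((rootSystem H).root α)) : ∃ c : ℂ, c • x = y := by
  have h := (finrank_eq_one_iff_of_nonzero' (⟨x, hx⟩ : eig H ((rootSystem H).root α))
    (fun e => h0 (congrArg Subtype.val e))).mp (finrank_eig_root α) ⟨y, hy⟩
  obtain ⟨c, hc⟩ := h
  exact ⟨c, congrArg Subtype.val hc⟩

lemma root_reflectionPerm_self (α : H.root) :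
    (rootSystem H).root ((rootSystem H).reflectionPerm α α) = - (rootSystem H).root α := by
  rw [RootPairing.root_reflectionPerm, RootPairing.reflection_apply_self]

lemma eig_zero_eq : eig H (0 : Dual ℂ H) = H.toSubmodule := by
  ext x; exact mem_eig_zero

/-- Induction on `g` through weight vectors. -/
lemma eig_induction {P : g → Prop} (h0 : P 0) (ha : ∀ x y, P x → P y → P (x + y))
    (hw : ∀ (w : Dual ℂ H) x, x ∈ eig H w → P x) (x : g) : P x := by
  have hx : x ∈ ⨆ χ : LieModule.Weight ℂ H g, LieModule.genWeightSpace g (χ : H → ℂ) := by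
    rw [LieModule.iSup_genWeightSpace_eq_top']; trivial
  induction hx using LieSubmodule.iSup_induction' with
  | mem χ y hy => exact hw χ.toLinear y (mem_eig_iff_rootSpace.2 hy)
  | zero => exact h0
  | add x y _ _ hx hy => exact ha x y hx hy

/-- If `α`, `β` and `α + β` are roots, then `[g_α, g_β] ≠ 0`, by the representation theory of
`sl₂` on the `α`-chain through `β`. -/
lemma lie_ne_zero_of_add_root {α β γ : H.root}
    (hγ : (rootSystem H).root γ = (rootSystem H).root α + (rootSystem H).root β) {x y : g}
    (hx : x ∈ eig H ((rootSystem H).root α)) (hy : y ∈ eig H ((rootSystem H).root β))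
    (hx0 : x ≠ 0) (hy0 : y ≠ 0) : ⁅x, y⁆ ≠ 0 := by
  have hα := LieSubalgebra.isNonZero_coe_root α
  have hβ := LieSubalgebra.isNonZero_coe_root β
  obtain ⟨v, hv, hv0⟩ := (LieModule.chainTop (α.1 : H → ℂ) β.1).exists_ne_zero
  obtain ⟨h, e, f, isSl2, he, hf⟩ := exists_isSl2Triple_of_weight_isNonZero hα
  obtain rfl := isSl2.h_eq_coroot hα he hf
  have prim : isSl2.HasPrimitiveVectorWith v (chainLength α.1 β.1 : ℂ) :=
    have := lie_mem_genWeightSpace_of_mem_genWeightSpace he hv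
    ⟨hv0, (chainLength_smul _ _ hv).symm,
      by rwa [LieModule.genWeightSpace_add_chainTop _ _ hα] at this⟩
  have htop : 1 ≤ LieModule.chainTopCoeff (α.1 : H → ℂ) β.1 := by
    have h1 : rootSpace H ((1 : ℤ) • (α.1 : H → ℂ) + β.1) ≠ ⊥ := by
      have : ((1 : ℤ) • (α.1 : H → ℂ) + (β.1 : H → ℂ)) = (γ.1 : H → ℂ) := by
        rw [one_smul]; funext h; exact (LinearMap.congr_fun hγ h).symm
      rw [this]; exact γ.1.2
    have := ((rootSpace_zsmul_add_ne_bot_iff α.1 β.1 hα 1).1 h1).1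
    exact_mod_cast this
  obtain ⟨r, hr⟩ : ∃ r, LieModule.chainTopCoeff (α.1 : H → ℂ) β.1 = r + 1 :=
    ⟨LieModule.chainTopCoeff (α.1 : H → ℂ) β.1 - 1, by omega⟩
  have hle := chainTopCoeff_le_chainLength α.1 β.1
  -- `u` spans `g_β` and `e` maps it to a nonzero vector
  set u := ((LieModule.toEnd ℂ g g f) ^ (r + 1)) v with hu
  have hu0 : u ≠ 0 := prim.pow_toEnd_f_ne_zero_of_eq_nat rfl (by omega)
  have huβ : u ∈ rootSpace H (β.1 : H → ℂ) := by
    have := toEnd_pow_apply_mem hf hv (r + 1)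
    rw [LieModule.coe_chainTop, hr] at this
    convert this using 2
    funext h
    simp
  have heu : ⁅e, u⁆ ≠ 0 := by
    rw [hu, prim.lie_e_pow_succ_toEnd_f]
    refine smul_ne_zero (mul_ne_zero (Nat.cast_add_one_ne_zero r) ?_)
      (prim.pow_toEnd_f_ne_zero_of_eq_nat rfl (by omega))
    rw [sub_ne_zero]
    exact_mod_cast (by omega : chainLength α.1 β.1 ≠ r)
  obtain ⟨c, hc⟩ := exists_smul_eq hx hx0 (mem_eig_iff_rootSpace.2 he)
  obtain ⟨c', hc'⟩ := exists_smul_eq hy hy0 (mem_eig_iff_rootSpace.2 huβ)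
  intro e0
  rw [← hc, ← hc', smul_lie, lie_smul, e0, smul_zero, smul_zero] at heu
  exact heu rfl

/-! ### The lowest root space as a generator -/

variable (b : (rootSystem H).Base)

lemma height_le_theta (i : H.root) : b.height i ≤ b.height (theta b) :=
  (exists_highest b).choose_spec i

lemma theta_isPos : b.IsPos (theta b) := by
  have : Nonempty H.root := ⟨theta b⟩
  obtain ⟨i, hi⟩ := b.support_nonempty
  have h1 := b.height_one_of_mem_support hi
  have := height_le_theta b i
  rw [RootPairing.Base.isPos_iff]; omega

lemma neg_root_isPos {γ : H.root} (h : ¬ b.IsPos γ) :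
    ∃ δ : H.root, b.IsPos δ ∧ (rootSystem H).root δ = - (rootSystem H).root γ := by
  exact ⟨(rootSystem H).reflectionPerm γ γ, (RootPairing.Base.IsPos.or_neg b γ).resolve_left h,
    root_reflectionPerm_self γ⟩

/-- The elements obtained from the lowest root vectors by brackets with positive root vectors, with
their weights. -/
inductive FromLowest : Dual ℂ H → g → Prop
  | base {x : g} (hx : x ∈ eig H (-(rootSystem H).root (theta b))) :
      FromLowest (-(rootSystem H).root (theta b)) x
  | step {w : Dual ℂ H} {x e : g} {α : H.root} (hα : b.IsPos α)
      (he : e ∈ eig H ((rootSystem H).root α)) (hx : FromLowest w x) :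
      FromLowest ((rootSystem H).root α + w) ⁅e, x⁆

variable {b} in
lemma FromLowest.mem_eig {w : Dual ℂ H} {x : g} (h : FromLowest b w x) : x ∈ eig H w := by
  induction h with
  | base hx => exact hx
  | step hα he hx ih => exact lie_mem_eig he ih

/-- The span of the elements obtained from the lowest root vectors. -/
def lowestSpan : Submodule ℂ g := Submodule.span ℂ {x | ∃ w, FromLowest b w x}

lemma lie_pos_mem_lowestSpan {α : H.root} (hα : b.IsPos α) {e x : g}
    (he : e ∈ eig H ((rootSystem H).root α)) (hx : x ∈ lowestSpan b) : ⁅e, x⁆ ∈ lowestSpan b := by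
  induction hx using Submodule.span_induction with
  | mem x h => obtain ⟨w, h⟩ := h; exact Submodule.subset_span ⟨_, h.step hα he⟩
  | zero => simp
  | add x y _ _ hx hy => rw [lie_add]; exact add_mem hx hy
  | smul r x _ hx => rw [lie_smul]; exact Submodule.smul_mem _ _ hx

lemma lie_zero_mem_lowestSpan {h x : g} (hh : h ∈ H) (hx : x ∈ lowestSpan b) :
    ⁅h, x⁆ ∈ lowestSpan b := by
  induction hx using Submodule.span_induction with
  | mem x hx =>
    obtain ⟨w, hx⟩ := hx
    have := hx.mem_eig ⟨h, hh⟩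
    change ⁅h, x⁆ = _ at this
    rw [this]
    exact Submodule.smul_mem _ _ (Submodule.subset_span ⟨_, hx⟩)
  | zero => simp
  | add x y _ _ hx hy => rw [lie_add]; exact add_mem hx hy
  | smul r x _ hx => rw [lie_smul]; exact Submodule.smul_mem _ _ hx

/-- Brackets with negative root vectors do not lead out of the span: they kill the lowest root
vectors and otherwise can be moved past the positive root vectors. -/
lemma FromLowest.lie_neg_mem {w : Dual ℂ H} {x : g} (hx : FromLowest b w x) {α : H.root}
    (hα : b.IsPos α) {f : g} (hf : f ∈ eig H (-(rootSystem H).root α)) :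
    ⁅f, x⁆ ∈ lowestSpan b := by
  induction hx generalizing α f with
  | @base x hx =>
    by_cases h0 : ⁅f, x⁆ = 0
    · rw [h0]; exact zero_mem _
    exfalso
    have hm := lie_mem_eig hf hx
    have hnz : -(rootSystem H).root α + -(rootSystem H).root (theta b) ≠ 0 := by
      intro e
      have e' : (rootSystem H).root α = - (rootSystem H).root (theta b) := by
        rw [← neg_eq_iff_eq_neg]; exact eq_neg_of_add_eq_zero_left e |>.trans (neg_neg _)
      let := (rootSystem H).indexNeg
      have : α = - theta b := (rootSystem H).root.injective
        (e'.trans (root_reflectionPerm_self _).symm)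
      exact (RootPairing.Base.IsPos.neg_iff_not b (theta b)).1 (this ▸ hα) (theta_isPos b)
    obtain ⟨γ, hγ⟩ := exists_root_of_mem_eig hm h0 hnz
    have hγ' : (rootSystem H).root ((rootSystem H).reflectionPerm γ γ) =
        (rootSystem H).root (theta b) + (rootSystem H).root α := by
      rw [root_reflectionPerm_self, hγ]; abel
    have h1 := b.height_add hγ'
    have h2 := height_le_theta b ((rootSystem H).reflectionPerm γ γ)
    have h3 : 0 < b.height α := hα
    omega
  | @step w x e β hβ he hx ih =>
    rw [leibniz_lie]
    refine add_mem ?_ (lie_pos_mem_lowestSpan b hβ he (ih hα hf))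
    have hm := lie_mem_eig hf he
    by_cases hnz : -(rootSystem H).root α + (rootSystem H).root β = 0
    · rw [hnz, mem_eig_zero] at hm
      exact lie_zero_mem_lowestSpan b hm (Submodule.subset_span ⟨_, hx⟩)
    by_cases h0 : ⁅f, e⁆ = 0
    · rw [h0, zero_lie]; exact zero_mem _
    obtain ⟨γ, hγ⟩ := exists_root_of_mem_eig hm h0 hnz
    rw [← hγ] at hm
    by_cases hp : b.IsPos γ
    · exact lie_pos_mem_lowestSpan b hp hm (Submodule.subset_span ⟨_, hx⟩)
    · obtain ⟨δ, hδ, hδ'⟩ := neg_root_isPos b hp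
      refine ih hδ ?_
      rwa [hδ', neg_neg]

/-- The lowest root vectors generate `g` under the positive root spaces, since what they generate is
an ideal. -/
lemma lowestSpan_eq_top : lowestSpan b = ⊤ := by
  let J : LieIdeal ℂ g :=
    { lowestSpan b with
      lie_mem := by
        intro x m hm
        change m ∈ lowestSpan b at hm
        change ⁅x, m⁆ ∈ lowestSpan b
        induction x using eig_induction (H := H) with
        | h0 => simp
        | ha x y hx hy => rw [add_lie]; exact add_mem hx hy
        | hw w x hx =>
          by_cases hnz : w = 0
          · rw [hnz, mem_eig_zero] at hx
            exact lie_zero_mem_lowestSpan b hx hm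
          by_cases h0 : x = 0
          · rw [h0, zero_lie]; exact zero_mem _
          obtain ⟨γ, rfl⟩ := exists_root_of_mem_eig hx h0 hnz
          by_cases hp : b.IsPos γ
          · exact lie_pos_mem_lowestSpan b hp hx hm
          · obtain ⟨δ, hδ, hδ'⟩ := neg_root_isPos b hp
            rw [← neg_eq_iff_eq_neg] at hδ'
            rw [← hδ'] at hx
            induction hm using Submodule.span_induction with
            | mem m hm => obtain ⟨w, hm⟩ := hm; exact hm.lie_neg_mem b hδ hx
            | zero => simp
            | add x y _ _ hx hy => rw [lie_add]; exact add_mem hx hy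
            | smul r x _ hx => rw [lie_smul]; exact Submodule.smul_mem _ _ hx }
  have hJ : J = ⊤ := by
    refine (LieAlgebra.IsSimple.eq_bot_or_eq_top J).resolve_left ?_
    intro e
    obtain ⟨x, hx, h0⟩ := exists_mem_eig_root ((rootSystem H).reflectionPerm (theta b) (theta b))
    rw [root_reflectionPerm_self] at hx
    have hx' : x ∈ J := Submodule.subset_span ⟨_, FromLowest.base hx⟩
    rw [e] at hx'
    exact h0 (by simpa using hx')
  have : lowestSpan b = J.toSubmodule := rfl
  rw [this, hJ]; rfl

/-- A subalgebra that contains the simple root spaces and the lowest root space is everything. -/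
lemma subalgebra_eq_top (S : LieSubalgebra ℂ g)
    (h1 : ∀ i ∈ b.support, ∀ x ∈ eig H ((rootSystem H).root i), x ∈ S)
    (h2 : ∀ x ∈ eig H (-(rootSystem H).root (theta b)), x ∈ S) (x : g) : x ∈ S := by
  have hpos (α : H.root) (hα : b.IsPos α) : ∀ x ∈ eig H ((rootSystem H).root α), x ∈ S := by
    refine hα.induction_on_add (p := fun α => ∀ x ∈ eig H ((rootSystem H).root α), x ∈ S) h1 ?_
    intro i j k hk hi hj x hx
    obtain ⟨u, hu, hu0⟩ := exists_mem_eig_root i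
    obtain ⟨v, hv, hv0⟩ := exists_mem_eig_root j
    have hm := lie_mem_eig hu hv
    rw [← hk] at hm
    obtain ⟨c, hc⟩ := exists_smul_eq hm (lie_ne_zero_of_add_root hk hu hv hu0 hv0) hx
    rw [← hc]
    exact S.smul_mem c (S.lie_mem (hi u hu) (h1 j hj v hv))
  have hx : x ∈ lowestSpan b := by rw [lowestSpan_eq_top]; trivial
  induction hx using Submodule.span_induction with
  | mem x h =>
    obtain ⟨w, h⟩ := h
    induction h with
    | base hx => exact h2 _ hx
    | step hα he hx ih => exact S.lie_mem (hpos _ hα _ he) ih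
  | zero => exact S.zero_mem
  | add x y _ _ hx hy => exact S.add_mem hx hy
  | smul r x _ hx => exact S.smul_mem r hx

lemma IsPos.exists_eq_sum {α : H.root} (hα : b.IsPos α) :
    ∃ c : b.support → ℕ, (rootSystem H).root α = ∑ i, c i • (rootSystem H).root i := by
  obtain ⟨f, hf, h⟩ := b.exists_root_eq_sum_nat_or_neg α
  rcases h with h | h
  · exact ⟨fun i => f i, h.trans (Finset.sum_coe_sort b.support
      (fun i => f i • (rootSystem H).root i)).symm⟩
  · exfalso
    have := RootPairing.Base.height_eq_sum (b := b) (f := fun i => -(f i : ℤ)) (i := α) (by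
      rw [h]; simp)
    have h3 : 0 < b.height α := hα
    rw [this, Finset.sum_neg_distrib] at h3
    have : 0 ≤ ∑ j ∈ b.support, (f j : ℤ) := Finset.sum_nonneg fun _ _ => by positivity
    omega

variable {b} in
lemma FromLowest.weight {w : Dual ℂ H} {x : g} (h : FromLowest b w x) :
    ∃ c : b.support → ℕ, w + (rootSystem H).root (theta b) = ∑ i, c i • (rootSystem H).root i := by
  induction h with
  | base hx => exact ⟨0, by simp⟩
  | step hα he hx ih =>
    obtain ⟨c, hc⟩ := ih
    obtain ⟨c', hc'⟩ := IsPos.exists_eq_sum b hα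
    exact ⟨c' + c, by rw [add_assoc, hc, hc', ← Finset.sum_add_distrib]; simp [add_smul]⟩

end Finite

section Adapted

variable {g : Type*} [LieRing g] [LieAlgebra ℂ g] [FiniteDimensional ℂ g] [IsSimple ℂ g]
  {H : LieSubalgebra ℂ g} [H.IsCartanSubalgebra]

/-! ### Bases of weight vectors -/

variable (H) in
/-- A basis of `g` that consists of weight vectors. -/
structure AdaptedBasis where
  /-- The dimension of `g`. -/
  N : ℕ
  /-- The basis. -/
  e : Basis (Fin N) ℂ g
  /-- The weights of the basis vectors. -/
  w : Fin N → Dual ℂ H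
  mem : ∀ j, e j ∈ eig H (w j)

variable (H) in
/-- Such a basis exists, since `g` is spanned by weight vectors. -/
lemma exists_adaptedBasis : Nonempty (AdaptedBasis H) := by
  have hs : ⊤ ≤ Submodule.span ℂ {x : g | ∃ w, x ∈ eig H w} := by
    intro x _
    induction x using eig_induction (H := H) with
    | h0 => exact zero_mem _
    | ha x y hx hy => exact add_mem (hx trivial) (hy trivial)
    | hw w x hx => exact Submodule.subset_span ⟨w, hx⟩
  let B := Basis.ofSpan hs
  have : Finite ((linearIndepOn_empty ℂ id).extend (Set.empty_subset {x : g | ∃ w, x ∈ eig H w})) :=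
    Module.Finite.finite_basis B
  have := Fintype.ofFinite
    ((linearIndepOn_empty ℂ id).extend (Set.empty_subset {x : g | ∃ w, x ∈ eig H w}))
  have hB (j) : ∃ w, B j ∈ eig H w := Basis.ofSpan_subset hs ⟨j, rfl⟩
  choose w hw using hB
  exact ⟨⟨_, B.reindex (Fintype.equivFin _), fun j => w ((Fintype.equivFin _).symm j), fun j => by
    rw [Basis.reindex_apply]; exact hw _⟩⟩

variable (E : AdaptedBasis H)

namespace AdaptedBasis

variable {E} in
lemma repr_eq_zero {v : Dual ℂ H} {x : g} (hx : x ∈ eig H v) {j : Fin E.N} (hj : E.w j ≠ v) :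
    E.e.repr x j = 0 := by
  obtain ⟨h, hh⟩ : ∃ h, E.w j h ≠ v h := by
    by_contra hc; push Not at hc; exact hj (LinearMap.ext hc)
  exact E.e.repr_eq_zero_of_diag (D := (LieAlgebra.ad ℂ g (h : g) : g →ₗ[ℂ] g))
    (c := fun j => E.w j h) (fun j => E.mem j h) (hx h) hh

lemma eig_eq_span (v : Dual ℂ H) : eig H v = Submodule.span ℂ (E.e '' {j | E.w j = v}) := by
  ext x
  rw [Basis.mem_span_image]
  constructor
  · intro hx j hj
    by_contra h
    exact (Finsupp.mem_support_iff.1 hj) (repr_eq_zero hx h)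
  · intro hx
    rw [← E.e.linearCombination_repr x, Finsupp.linearCombination_apply]
    refine Submodule.sum_mem _ fun j hj => Submodule.smul_mem _ _ ?_
    have : E.w j = v := hx hj
    rw [← this]; exact E.mem j

lemma rank_eig (v : Dual ℂ H) :
    Module.rank ℂ (eig H v) = Cardinal.mk (E.e '' {j | E.w j = v}) := by
  rw [E.eig_eq_span v]
  exact rank_span_set (LinearIndepOn.id_image (E.e.linearIndependent.comp _ Subtype.val_injective))

lemma exists_root {j : Fin E.N} (h : E.w j ≠ 0) : ∃ α : H.root, (rootSystem H).root α = E.w j :=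
  exists_root_of_mem_eig (E.mem j) (E.e.ne_zero j) h

lemma exists_index (α : H.root) : ∃ j, E.w j = (rootSystem H).root α := by
  by_contra hc
  push Not at hc
  obtain ⟨x, hx, h0⟩ := exists_mem_eig_root α
  refine h0 (E.e.repr.map_eq_zero_iff.1 (Finsupp.ext fun j => repr_eq_zero hx (hc j)))

/-- Nonzero weights have multiplicity one. -/
lemma eq_of_w_eq {j k : Fin E.N} (h : E.w j = E.w k) (h0 : E.w j ≠ 0) : j = k := by
  obtain ⟨α, hα⟩ := E.exists_root h0
  have hj := E.mem j
  have hk := E.mem k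
  rw [← h, ← hα] at hk
  rw [← hα] at hj
  obtain ⟨c, hc⟩ := exists_smul_eq hj (E.e.ne_zero j) hk
  by_contra hjk
  have h2 := congrArg (fun x => E.e.repr x k) hc
  simp only [map_smul, Basis.repr_self, Finsupp.smul_apply, Finsupp.single_eq_same] at h2
  rw [Finsupp.single_eq_of_ne (Ne.symm hjk), smul_zero] at h2
  exact zero_ne_one h2

end AdaptedBasis

/-! ### Values of functionals on the defining elements of the parabolic sets -/

variable (b : (rootSystem H).Base)

lemma delta_zero_d_zero : delta H 0 (d H 0) = 1 := by simp [delta, d]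
lemma delta_zero_d_one : delta H 0 (d H 1) = 0 := by simp [delta, d]
lemma delta_one_d_zero : delta H 1 (d H 0) = 0 := by simp [delta, d]
lemma delta_one_d_one : delta H 1 (d H 1) = 1 := by simp [delta, d]
lemma ext_d (v : Dual ℂ H) (i : Fin 2) : ext H v (d H i) = 0 := by simp [ext, d]

lemma ext_add (v w : Dual ℂ H) : ext H (v + w) = ext H v + ext H w := LinearMap.add_comp _ _ _
lemma ext_neg (v : Dual ℂ H) : ext H (-v) = -ext H v := LinearMap.neg_comp _ _
lemma ext_zero : ext H (0 : Dual ℂ H) = 0 := LinearMap.zero_comp _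
lemma ext_smul (r : ℂ) (v : Dual ℂ H) : ext H (r • v) = r • ext H v := LinearMap.smul_comp _ _ _
lemma ext_sum {κ : Type*} (s : Finset κ) (v : κ → Dual ℂ H) :
    ext H (∑ i ∈ s, v i) = ∑ i ∈ s, ext H (v i) := map_sum
      ({ toFun := ext H, map_add' := ext_add, map_smul' := ext_smul } : Dual ℂ H →ₗ[ℂ] _) _ _

lemma ext_dualElt_some (v : Dual ℂ H) (i : b.support) :
    ext H v (dualElt b (some i)) = b.toWeightBasis.repr v i := by
  simp only [dualElt, map_add, map_smul, ext_d, smul_zero, add_zero]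
  simp [ext]

lemma delta_dualElt_some (i : b.support) (k : Fin 2) :
    delta H k (dualElt b (some i)) = thetaCoeff b i := by
  simp only [dualElt, map_add, map_smul]
  fin_cases k
  · simp [delta_zero_d_zero, delta_zero_d_one]; simp [delta]
  · simp [delta_one_d_zero, delta_one_d_one]; simp [delta]

open scoped Classical in
lemma simpleRoot_dualElt (i j : Ix b) : simpleRoot b j (dualElt b i) = if i = j then 1 else 0 := by
  cases j with
  | none =>
    cases i with
    | none => simp [simpleRoot, dualElt, delta_zero_d_zero, ext_d]
    | some i =>
      simp only [simpleRoot, LinearMap.sub_apply, delta_dualElt_some, ext_dualElt_some]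
      simp [thetaCoeff]
  | some j =>
    cases i with
    | none => simp [simpleRoot, dualElt, ext_d]
    | some i =>
      simp only [simpleRoot, ext_dualElt_some, RootPairing.Base.toWeightBasis_repr_root]
      simp [Finsupp.single_apply, eq_comm]

lemma simpleRoot_d_one (j : Ix b) : simpleRoot b j (d H 1) = 0 := by
  cases j <;> simp [simpleRoot, delta_zero_d_one, ext_d]

open scoped Classical in
lemma simpleRoot_fElt (A : Set (Ix b)) (j : Ix b) :
    simpleRoot b j (fElt b A) = if j ∈ A then 0 else 1 := by
  rw [fElt, map_sub, map_sum, map_smul, dualEltNegOne, simpleRoot_d_one, smul_zero, sub_zero]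
  simp only [simpleRoot_dualElt, Finset.sum_ite_eq', Finset.mem_filter, Finset.mem_univ, true_and,
    ite_not]

open scoped Classical in
lemma delta_one_fElt (A : Set (Ix b)) : delta H 1 (fElt b A) = 0 := by
  rw [fElt, map_sub, map_sum, map_smul, dualEltNegOne, delta_one_d_one, smul_eq_mul, mul_one,
    sub_eq_zero, Finset.sum_filter, Finset.sum_filter, Fintype.sum_option]
  simp only [delta_dualElt_some]
  rw [show dualElt b none = d H 0 from rfl, delta_one_d_zero]
  simp

/-- The coefficients of the highest root are natural numbers; here as integers. -/
lemma exists_theta_eq_sum : ∃ t : b.support → ℕ,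
    (rootSystem H).root (theta b) = ∑ i, t i • (rootSystem H).root i :=
  IsPos.exists_eq_sum b (theta_isPos b)

/-- The coefficients of the highest root. -/
def tc : b.support → ℕ := (exists_theta_eq_sum b).choose

lemma root_theta : (rootSystem H).root (theta b) = ∑ i, tc b i • (rootSystem H).root i :=
  (exists_theta_eq_sum b).choose_spec

lemma repr_sum_root (f : b.support → ℤ) (i : b.support) :
    b.toWeightBasis.repr (∑ i, f i • (rootSystem H).root i) i = f i := by
  rw [map_sum, Finsupp.finsetSum_apply]
  classical
  have h (j : b.support) : b.toWeightBasis.repr (f j • (rootSystem H).root j) i =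
      if j = i then (f i : ℂ) else 0 := by
    rw [map_zsmul, RootPairing.Base.toWeightBasis_repr_root, Finsupp.smul_apply,
      Finsupp.single_apply]
    split
    · next h => subst h; simp
    · simp
  rw [Finset.sum_congr rfl fun j _ => h j]
  simp only [Finset.sum_ite_eq', Finset.mem_univ, if_true]

lemma sum_root_injective {f f' : b.support → ℤ}
    (h : ∑ i, f i • (rootSystem H).root i = ∑ i, f' i • (rootSystem H).root i) (i : b.support) :
    f i = f' i := by
  have := congrArg (fun v => b.toWeightBasis.repr v i) h
  simp only [repr_sum_root] at this
  exact_mod_cast this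

lemma thetaCoeff_eq (i : b.support) : thetaCoeff b i = tc b i := by
  have := repr_sum_root b (fun i => (tc b i : ℤ)) i
  rw [thetaCoeff, root_theta]
  simpa using this

lemma height_theta : b.height (theta b) = ∑ i, (tc b i : ℤ) := by
  classical
  let f : H.root → ℤ := fun i => if h : i ∈ b.support then tc b ⟨i, h⟩ else 0
  have hf : ∀ i : b.support, f i = tc b i := fun i => by simp [f, i.2]
  have h : (rootSystem H).root (theta b) = ∑ j ∈ b.support, f j • (rootSystem H).root j := by
    rw [root_theta, ← Finset.sum_coe_sort b.support]
    refine Finset.sum_congr rfl fun i _ => ?_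
    rw [hf, natCast_zsmul]
  rw [RootPairing.Base.height_eq_sum h, ← Finset.sum_coe_sort b.support]
  exact Finset.sum_congr rfl fun i _ => hf i

/-- For empty `A` the grading element is `φ`. -/
lemma fElt_empty : fElt b ∅ = phiElt b := by
  classical
  have h : ∑ i : b.support with (some i : Ix b) ∉ (∅ : Set (Ix b)), thetaCoeff b i =
      (b.height (theta b) : ℂ) := by
    rw [height_theta, Finset.filter_true_of_mem (by simp)]
    push_cast
    exact Finset.sum_congr rfl fun i _ => thetaCoeff_eq b i
  have h' : (Finset.univ.filter fun i => i ∉ (∅ : Set (Ix b))) = (Finset.univ : Finset (Ix b)) :=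
    Finset.filter_true_of_mem (by simp)
  rw [fElt, phiElt]
  congr 1
  · exact Finset.sum_congr (by convert h') fun _ _ => rfl
  · congr 1
    convert h

lemma delta_zero_eq : delta H 0 =
    simpleRoot b none + ∑ i : b.support, tc b i • simpleRoot b (some i) := by
  have : ext H ((rootSystem H).root (theta b)) =
      ∑ i : b.support, tc b i • simpleRoot b (some i) := by
    rw [root_theta, ext_sum]
    refine Finset.sum_congr rfl fun i _ => ?_
    rw [← Nat.cast_smul_eq_nsmul ℂ, ext_smul, Nat.cast_smul_eq_nsmul]; rfl
  rw [← this, simpleRoot, sub_add_cancel]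

/-! ### Sign coherence of the affine roots -/

/-- Every weight of `g` lies in the cone with apex `-θ`. -/
lemma exists_add_theta_eq_sum {v : Dual ℂ H} {x : g} (hx : x ∈ eig H v) (h0 : x ≠ 0) :
    ∃ c : b.support → ℕ, v + (rootSystem H).root (theta b) = ∑ i, c i • (rootSystem H).root i := by
  obtain ⟨E⟩ := exists_adaptedBasis H
  by_contra hc
  -- otherwise the coordinates of weight `v` vanish on all of `g`
  have hz (y : g) (j : Fin E.N) (hj : E.w j = v) : E.e.repr y j = 0 := by
    have hy : y ∈ lowestSpan b := by rw [lowestSpan_eq_top]; trivial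
    induction hy using Submodule.span_induction with
    | mem y h =>
      obtain ⟨u, hu⟩ := h
      refine AdaptedBasis.repr_eq_zero hu.mem_eig ?_
      rintro rfl
      exact hc (hj ▸ hu.weight)
    | zero => simp
    | add x y _ _ hx hy => rw [map_add, Finsupp.add_apply, hx, hy, add_zero]
    | smul r x _ hx => rw [map_smul, Finsupp.smul_apply, hx, smul_zero]
  refine h0 (E.e.repr.map_eq_zero_iff.1 (Finsupp.ext fun j => ?_))
  by_cases hj : E.w j = v
  · exact hz x j hj
  · exact AdaptedBasis.repr_eq_zero hx hj

/-- The coefficients of a weight of `g` have the same sign and are bounded by those of the highest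
root. -/
lemma exists_weight_eq_sum {v : Dual ℂ H} {x : g} (hx : x ∈ eig H v) (h0 : x ≠ 0) :
    ∃ a : b.support → ℤ, v = ∑ i, a i • (rootSystem H).root i ∧
      ((∀ i, 0 ≤ a i ∧ a i ≤ tc b i) ∨ (∀ i, -(tc b i : ℤ) ≤ a i ∧ a i ≤ 0)) := by
  by_cases hv : v = 0
  · exact ⟨0, by simp [hv], Or.inl fun i => by simp⟩
  have key (α : H.root) (hα : b.IsPos α) : ∃ a : b.support → ℤ,
      (rootSystem H).root α = ∑ i, a i • (rootSystem H).root i ∧ ∀ i, 0 ≤ a i ∧ a i ≤ tc b i := by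
    obtain ⟨c, hc⟩ := IsPos.exists_eq_sum b hα
    refine ⟨fun i => c i, by simpa using hc, fun i => ⟨by positivity, ?_⟩⟩
    obtain ⟨y, hy, hy0⟩ := exists_mem_eig_root ((rootSystem H).reflectionPerm α α)
    rw [root_reflectionPerm_self] at hy
    obtain ⟨c', hc'⟩ := exists_add_theta_eq_sum b hy hy0
    have : ∑ i, (tc b i : ℤ) • (rootSystem H).root i =
        ∑ i, ((c i : ℤ) + c' i) • (rootSystem H).root i := by
      simp only [add_smul, natCast_zsmul, Finset.sum_add_distrib]
      rw [← root_theta, ← hc, ← hc']; abel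
    have := sum_root_injective b this i
    change (c i : ℤ) ≤ tc b i
    omega
  obtain ⟨α, rfl⟩ := exists_root_of_mem_eig hx h0 hv
  by_cases hp : b.IsPos α
  · obtain ⟨a, h, h'⟩ := key α hp
    exact ⟨a, h, Or.inl h'⟩
  · obtain ⟨δ, hδ, hδ'⟩ := neg_root_isPos b hp
    obtain ⟨a, h, h'⟩ := key δ hδ
    refine ⟨-a, ?_, Or.inr fun i => ?_⟩
    · rw [hδ'] at h
      simp only [Pi.neg_apply, neg_smul, Finset.sum_neg_distrib]
      rw [← h, neg_neg]
    · have := h' i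
      simp only [Pi.neg_apply]; omega

/-- The weight of `x(m₁, m₂)` for `x` of weight `v`. -/
def loopWt (v : Dual ℂ H) (m : ℤ × ℤ) : Dual ℂ (Cartan H) :=
  ext H v + m.1 • delta H 0 + m.2 • delta H 1

/-- Sign coherence: modulo `δ₂`, the weights of the double loop algebra are integral combinations of
the affine simple roots with coefficients of the same sign. -/
lemma loopWt_eq_sum {v : Dual ℂ H} {x : g} (hx : x ∈ eig H v) (h0 : x ≠ 0) (m : ℤ × ℤ) :
    ∃ n : Ix b → ℤ, loopWt v m = ∑ i, n i • simpleRoot b i + m.2 • delta H 1 ∧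
      ((∀ i, 0 ≤ n i) ∨ (∀ i, n i ≤ 0)) := by
  obtain ⟨a, ha, hs⟩ := exists_weight_eq_sum b hx h0
  refine ⟨fun i => i.elim m.1 fun i => a i + m.1 * tc b i, ?_, ?_⟩
  · have : ext H v = ∑ i : b.support, a i • simpleRoot b (some i) := by
      rw [ha, ext_sum]
      refine Finset.sum_congr rfl fun i _ => ?_
      rw [← Int.cast_smul_eq_zsmul ℂ, ext_smul, Int.cast_smul_eq_zsmul]; rfl
    rw [loopWt, this, Fintype.sum_option, delta_zero_eq b, smul_add]
    simp only [Option.elim, add_smul, Finset.sum_add_distrib, Finset.smul_sum, mul_smul,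
      natCast_zsmul]
    abel
  · have hcase : 1 ≤ m.1 ∨ m.1 = 0 ∨ m.1 ≤ -1 := by omega
    have ht (i) : 0 ≤ (tc b i : ℤ) := by positivity
    rcases hcase with hm | hm | hm
    · left
      rintro (_ | i)
      · exact (by omega : 0 ≤ m.1)
      · change 0 ≤ a i + m.1 * tc b i
        have h1 : -(tc b i : ℤ) ≤ a i := by
          rcases hs with h | h
          · have := h i; have := ht i; omega
          · exact (h i).1
        nlinarith [ht i]
    · rcases hs with h | h
      · left
        rintro (_ | i)
        · exact hm.ge
        · simp only [Option.elim, hm, zero_mul, add_zero]; exact (h i).1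
      · right
        rintro (_ | i)
        · exact hm.le
        · simp only [Option.elim, hm, zero_mul, add_zero]; exact (h i).2
    · right
      rintro (_ | i)
      · exact (by omega : m.1 ≤ 0)
      · change a i + m.1 * tc b i ≤ 0
        have h1 : a i ≤ (tc b i : ℤ) := by
          rcases hs with h | h
          · exact (h i).2
          · have := (h i).2; have := ht i; omega
        nlinarith [ht i]

/-! ### The centralizer of the degree-one part -/

/-- An element of `g` that commutes with all root vectors of degree `1` modulo the degree of `δ₁` is
zero: such elements form an ideal, because `g` is generated by its parts of degrees `0` and `1`. -/
lemma eq_zero_of_commutes {A : Set (Ix b)} (hA : A ≠ Set.univ) {z : g}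
    (hz : ∀ (v : Dual ℂ H) (x : g), x ∈ eig H v → (∃ m : ℤ, loopWt v (m, 0) (fElt b A) = 1) →
      ⁅x, z⁆ = 0) : z = 0 := by
  classical
  have hwt (v : Dual ℂ H) (m : ℤ) : loopWt v (m, 0) (fElt b A) =
      ext H v (fElt b A) + m * delta H 0 (fElt b A) := by
    simp [loopWt]
  let W : Submodule ℂ g :=
    { carrier := {z | ∀ (v : Dual ℂ H) (x : g), x ∈ eig H v →
        (∃ m : ℤ, loopWt v (m, 0) (fElt b A) = 1) → ⁅x, z⁆ = 0}
      add_mem' := fun hx hy v x h h' => by rw [lie_add, hx v x h h', hy v x h h', add_zero]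
      zero_mem' := fun v x h h' => lie_zero x
      smul_mem' := fun r y hy v x h h' => by rw [lie_smul, hy v x h h', smul_zero] }
  let S : LieSubalgebra ℂ g :=
    { carrier := {x | ∀ z ∈ W, ⁅x, z⁆ ∈ W}
      add_mem' := fun hx hy z hz => by rw [add_lie]; exact add_mem (hx z hz) (hy z hz)
      zero_mem' := fun z hz => by rw [zero_lie]; exact zero_mem _
      smul_mem' := fun r x hx z hz => by rw [smul_lie]; exact Submodule.smul_mem _ _ (hx z hz)
      lie_mem' := fun {x y} hx hy z hz => by
        rw [lie_lie]; exact sub_mem (hx _ (hy z hz)) (hy _ (hx z hz)) }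
  have hS0 (u : Dual ℂ H) (hu : ∃ m : ℤ, loopWt u (m, 0) (fElt b A) = 0) (y : g)
      (hy : y ∈ eig H u) : y ∈ S := by
    intro z hz v x hx hm
    rw [leibniz_lie, hz v x hx hm, lie_zero, add_zero]
    refine hz (v + u) _ (lie_mem_eig hx hy) ?_
    obtain ⟨m, hm⟩ := hm
    obtain ⟨m', hm'⟩ := hu
    refine ⟨m + m', ?_⟩
    rw [hwt] at hm hm' ⊢
    rw [ext_add, LinearMap.add_apply]
    push_cast
    linear_combination hm + hm'
  have hS1 (u : Dual ℂ H) (hu : ∃ m : ℤ, loopWt u (m, 0) (fElt b A) = 1) (y : g)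
      (hy : y ∈ eig H u) : y ∈ S := by
    intro z hz
    rw [hz u y hy hu]; exact zero_mem _
  have hθ : ext H (-(rootSystem H).root (theta b)) = simpleRoot b none - delta H 0 := by
    rw [ext_neg, simpleRoot]; abel
  have hθ' : loopWt (-(rootSystem H).root (theta b)) (1, 0) (fElt b A) =
      simpleRoot b none (fElt b A) := by
    rw [hwt, hθ, LinearMap.sub_apply]; push_cast; ring
  have hi (i : b.support) : loopWt ((rootSystem H).root i) (0, 0) (fElt b A) =
      simpleRoot b (some i) (fElt b A) := by
    rw [hwt]; simp [simpleRoot]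
  have hS : ∀ x, x ∈ S := by
    refine subalgebra_eq_top b S ?_ ?_
    · intro i hi' x hx
      by_cases h : (some ⟨i, hi'⟩ : Ix b) ∈ A
      · exact hS0 _ ⟨0, by rw [hi ⟨i, hi'⟩, simpleRoot_fElt, if_pos h]⟩ x hx
      · exact hS1 _ ⟨0, by rw [hi ⟨i, hi'⟩, simpleRoot_fElt, if_neg h]⟩ x hx
    · intro x hx
      by_cases h : (none : Ix b) ∈ A
      · exact hS0 _ ⟨1, by rw [hθ', simpleRoot_fElt, if_pos h]⟩ x hx
      · exact hS1 _ ⟨1, by rw [hθ', simpleRoot_fElt, if_neg h]⟩ x hx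
  let J : LieIdeal ℂ g := { W with lie_mem := fun {x m} hm => hS x m hm }
  rcases LieAlgebra.IsSimple.eq_bot_or_eq_top J with hJ | hJ
  · have : z ∈ J := hz
    rw [hJ] at this
    simpa using this
  · exfalso
    have htop (z : g) : z ∈ W := by
      have : z ∈ J := by rw [hJ]; trivial
      exact this
    -- a nonzero vector of degree one would be central
    obtain ⟨v, x, hx, hx0, hm⟩ : ∃ (v : Dual ℂ H) (x : g), x ∈ eig H v ∧ x ≠ 0 ∧
        ∃ m : ℤ, loopWt v (m, 0) (fElt b A) = 1 := by
      obtain ⟨i, hiA⟩ := (Set.ne_univ_iff_exists_notMem A).1 hA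
      cases i with
      | none =>
        obtain ⟨x, hx, h0⟩ :=
          exists_mem_eig_root ((rootSystem H).reflectionPerm (theta b) (theta b))
        rw [root_reflectionPerm_self] at hx
        exact ⟨_, x, hx, h0, 1, by rw [hθ', simpleRoot_fElt, if_neg hiA]⟩
      | some i =>
        obtain ⟨x, hx, h0⟩ := exists_mem_eig_root (i : H.root)
        exact ⟨_, x, hx, h0, 0, by rw [hi, simpleRoot_fElt, if_neg hiA]⟩
    have hc : x ∈ LieAlgebra.center ℂ g := by
      rw [LieModule.mem_maxTrivSubmodule]
      intro y
      rw [← lie_skew, htop y v x hx hm, neg_zero]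
    rw [LieAlgebra.center_eq_bot] at hc
    exact hx0 (by simpa using hc)

end Adapted

section Structure

variable {g : Type*} [LieRing g] [LieAlgebra ℂ g] [FiniteDimensional ℂ g] [IsSimple ℂ g]
  {H : LieSubalgebra ℂ g} [H.IsCartanSubalgebra]

/-! ### A basis of weight vectors of the double affine algebra -/

namespace AdaptedBasis

variable (E : AdaptedBasis H) (b : (rootSystem H).Base)

/-- The indices of the basis `x_j(m₁, m₂)` of the double loop algebra. -/
abbrev Idx : Type := Σ _ : ℤ × ℤ, Fin E.N

/-- The basis of the double loop algebra given by a basis of weight vectors of `g`. -/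
def loopBasis : Basis E.Idx ℂ (Loop g) := (Finsupp.basis fun _ => E.e).map (coeffs g).symm

lemma loopBasis_apply (k : E.Idx) : E.loopBasis k = mono k.1 (E.e k.2) := by
  rw [loopBasis, Basis.map_apply, Finsupp.coe_basis, coeffs_symm_single]

lemma loopBasis_repr (u : Loop g) (k : E.Idx) :
    E.loopBasis.repr u k = E.e.repr (coeffs g u k.1) k.2 := by
  simp [loopBasis, Finsupp.basis_repr]

/-- The basis of `T` that consists of the `x_j(m₁, m₂)`, the `cᵢ` and the `dᵢ`. -/
def basisT : Basis (E.Idx ⊕ Fin 2 ⊕ Fin 2) ℂ (T b) :=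
  E.loopBasis.prod ((Pi.basisFun ℂ (Fin 2)).prod (Pi.basisFun ℂ (Fin 2)))

lemma basisT_inl (k : E.Idx) : E.basisT b (Sum.inl k) = T.mk (mono k.1 (E.e k.2)) 0 0 := by
  refine (Basis.prod_apply _ _ _).trans ?_
  simp [loopBasis_apply]; rfl

lemma basisT_inr (k : Fin 2 ⊕ Fin 2) :
    E.basisT b (Sum.inr k) = incl b (k.elim (c H) (d H)) := by
  refine (Basis.prod_apply _ _ _).trans ?_
  have h0 : (mono 0 ((0 : H) : g)) = 0 := (coeffs g).injective (by simp [coeffs_mono])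
  change ((0, (((Pi.basisFun ℂ (Fin 2)).prod (Pi.basisFun ℂ (Fin 2))) k)) :
    Loop g × (Fin 2 → ℂ) × (Fin 2 → ℂ)) = _
  rw [Basis.prod_apply]
  rcases k with i | i
  · exact Prod.ext h0.symm (Prod.ext (Pi.basisFun_apply ℂ (Fin 2) i) rfl)
  · exact Prod.ext h0.symm (Prod.ext rfl (Pi.basisFun_apply ℂ (Fin 2) i))

lemma basisT_repr_inl (x : T b) (k : E.Idx) :
    (E.basisT b).repr x (Sum.inl k) = E.e.repr (coeffs g x.loop k.1) k.2 :=
  (Basis.prod_repr_inl _ _ _ _).trans (E.loopBasis_repr _ _)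

/-- The weights of the basis vectors. -/
def wtT : E.Idx ⊕ Fin 2 ⊕ Fin 2 → Dual ℂ (Cartan H) :=
  Sum.elim (fun k => loopWt (E.w k.2) k.1) 0

end AdaptedBasis

variable (b : (rootSystem H).Base)

lemma lie_incl_mono (h : Cartan H) {v : Dual ℂ H} {x : g} (hx : x ∈ eig H v) (m : ℤ × ℤ) :
    (⁅incl b h, T.mk (mono m x) 0 0⁆ : T b) = loopWt v m h • T.mk (mono m x) 0 0 := by
  refine T.ext' ?_ ?_ ?_
  · change ⁅mono 0 (h.1 : g), mono m x⁆ + ∑ i, h.2.2 i • deg i (mono m x) -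
      ∑ i, (0 : Fin 2 → ℂ) i • deg i (mono 0 (h.1 : g)) = loopWt v m h • mono m x
    rw [lie_mono, zero_add, hx h.1, mono_smul]
    simp only [deg_mono, Fin.sum_univ_two, Pi.zero_apply, smul_smul, ← add_smul]
    simp [loopWt, ext, delta, expo]
    ring_nf
  · funext i
    change cocycle (form b) i (mono 0 (h.1 : g)) (mono m x) = loopWt v m h • 0
    rw [cocycle_mono]
    split <;> simp [expo]
  · exact (smul_zero _).symm

lemma lie_incl_incl (h h' : Cartan H) : (⁅incl b h, incl b h'⁆ : T b) = 0 := by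
  have hx : (⁅(h.1 : g), (h'.1 : g)⁆ : g) = 0 := by
    rw [mem_eig_zero.2 h'.1.2 h.1]; simp
  refine T.ext' ?_ ?_ ?_
  · change ⁅mono 0 (h.1 : g), mono 0 (h'.1 : g)⁆ + ∑ i, h.2.2 i • deg i (mono 0 (h'.1 : g)) -
      ∑ i, h'.2.2 i • deg i (mono 0 (h.1 : g)) = 0
    rw [lie_mono, hx]
    simp [deg_mono, expo]
    exact (coeffs g).injective (by simp [coeffs_mono])
  · funext i
    change cocycle (form b) i (mono 0 (h.1 : g)) (mono 0 (h'.1 : g)) = 0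
    rw [cocycle_mono]
    simp [expo]
  · rfl

lemma lie_mem_rootSubspace {β γ : Dual ℂ (Cartan H)} {x y : T b} (hx : x ∈ rootSubspace b β)
    (hy : y ∈ rootSubspace b γ) : ⁅x, y⁆ ∈ rootSubspace b (β + γ) := by
  intro h
  rw [leibniz_lie, hx h, hy h, smul_lie, lie_smul, ← add_smul]; rfl

lemma mono_mem_rootSubspace {v : Dual ℂ H} {x : g} (hx : x ∈ eig H v) (m : ℤ × ℤ) :
    T.mk (mono m x) 0 0 ∈ rootSubspace b (loopWt v m) := fun h => lie_incl_mono b h hx m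

namespace AdaptedBasis

variable {b} (E : AdaptedBasis H)

lemma basisT_mem (k) : E.basisT b k ∈ rootSubspace b (E.wtT k) := by
  rcases k with k | k
  · rw [basisT_inl]; exact mono_mem_rootSubspace b (E.mem _) _
  · rw [basisT_inr]; intro h
    rw [lie_incl_incl]; simp [wtT]

lemma basisT_repr_eq_zero {β : Dual ℂ (Cartan H)} {x : T b} (hx : x ∈ rootSubspace b β) {k}
    (hk : E.wtT k ≠ β) : (E.basisT b).repr x k = 0 := by
  obtain ⟨h, hh⟩ : ∃ h, E.wtT k h ≠ β h := by
    by_contra hc; push Not at hc; exact hk (LinearMap.ext hc)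
  obtain ⟨D, hD⟩ : ∃ D : T b →ₗ[ℂ] T b, ∀ y, D y = ⁅incl b h, y⁆ :=
    ⟨{ toFun := fun x => ⁅incl b h, x⁆
       map_add' := lie_add _
       map_smul' := fun r x => lie_smul r _ x }, fun _ => rfl⟩
  have hD' (k) : D (E.basisT b k) = E.wtT k h • E.basisT b k := (hD _).trans (E.basisT_mem k h)
  exact Basis.repr_eq_zero_of_diag (E.basisT b) (D := D) (c := fun k => E.wtT k h) hD' (μ := β h)
    ((hD x).trans (hx h)) hh

end AdaptedBasis

/-! ### The pairing of opposite root spaces -/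

/-- The factor of the invariant form with respect to the Killing form. -/
def formScale : ℂ :=
  2 / killingForm ℂ g ((rootSystem H).coroot (theta b)) ((rootSystem H).coroot (theta b))

lemma form_apply (x y : g) : form b x y = formScale b * killingForm ℂ g x y := rfl

lemma killingForm_cartanEquivDual_symm (v : Dual ℂ H) (h : H) :
    killingForm ℂ g ((cartanEquivDual H).symm v : H) h = v h := by
  have : cartanEquivDual H ((cartanEquivDual H).symm v) h = v h := by
    rw [LinearEquiv.apply_symm_apply]
  rw [← this]; rfl

lemma coroot_eq_smul (α : H.root) : (rootSystem H).coroot α =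
    (2 / (rootSystem H).root α ((cartanEquivDual H).symm ((rootSystem H).root α))) •
      (cartanEquivDual H).symm ((rootSystem H).root α) := by
  rw [rootSystem_coroot_apply, div_eq_mul_inv, mul_smul]
  rw [coroot, ← Nat.cast_smul_eq_nsmul ℂ]; norm_num

lemma root_cartanEquivDual_ne_zero (α : H.root) :
    (rootSystem H).root α ((cartanEquivDual H).symm ((rootSystem H).root α)) ≠ 0 :=
  root_apply_cartanEquivDual_symm_ne_zero (LieSubalgebra.isNonZero_coe_root α)

lemma formScale_eq : formScale b = (rootSystem H).root (theta b)
    ((cartanEquivDual H).symm ((rootSystem H).root (theta b))) / 2 := by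
  have h0 := root_cartanEquivDual_ne_zero (theta b)
  rw [formScale, coroot_eq_smul]
  generalize hr : (rootSystem H).root (theta b)
    ((cartanEquivDual H).symm ((rootSystem H).root (theta b))) = r at *
  have h1 := killingForm_cartanEquivDual_symm ((rootSystem H).root (theta b))
    ((cartanEquivDual H).symm ((rootSystem H).root (theta b)))
  rw [hr] at h1
  rw [show ((((2 / r) • (cartanEquivDual H).symm ((rootSystem H).root (theta b)) : H)) : g) =
    (2 / r) • (((cartanEquivDual H).symm ((rootSystem H).root (theta b)) : H) : g) from rfl,
    map_smul, map_smul, LinearMap.smul_apply, h1, smul_eq_mul, smul_eq_mul]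
  field_simp

lemma formScale_ne_zero : formScale b ≠ 0 := by
  rw [formScale_eq]
  exact div_ne_zero (root_cartanEquivDual_ne_zero _) two_ne_zero

/-- The element `τ(β)` of `ĥ` that represents a functional `β`, for `β` vanishing on the centre. -/
def dualVec : Dual ℂ (Cartan H) →ₗ[ℂ] Cartan H where
  toFun β := ((formScale b)⁻¹ • (cartanEquivDual H).symm (β ∘ₗ LinearMap.inl ℂ H _),
    fun i => β (d H i), 0)
  map_add' β γ := by
    refine Prod.ext ?_ (Prod.ext rfl (add_zero _).symm)
    simp only [LinearMap.add_comp, map_add, smul_add, Prod.fst_add]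
  map_smul' r β := by
    refine Prod.ext ?_ (Prod.ext rfl (smul_zero _).symm)
    simp only [LinearMap.smul_comp, map_smul, Prod.smul_fst, RingHom.id_apply]
    rw [smul_comm]

lemma ext_comp_inl (v : Dual ℂ H) :
    ext H v ∘ₗ LinearMap.inl ℂ H ((Fin 2 → ℂ) × (Fin 2 → ℂ)) = v := by
  ext x; simp [ext]

lemma delta_comp_inl (i : Fin 2) :
    delta H i ∘ₗ LinearMap.inl ℂ H ((Fin 2 → ℂ) × (Fin 2 → ℂ)) = 0 := by
  ext x; simp [delta]

lemma dualVec_ext (v : Dual ℂ H) :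
    dualVec b (ext H v) = ((formScale b)⁻¹ • (cartanEquivDual H).symm v, 0, 0) := by
  refine Prod.ext ?_ (Prod.ext (funext fun i => ext_d v i) rfl)
  change (formScale b)⁻¹ • (cartanEquivDual H).symm (ext H v ∘ₗ _) = _
  rw [ext_comp_inl]

lemma dualVec_delta (i : Fin 2) : dualVec b (delta H i) = c H i := by
  refine Prod.ext ?_ (Prod.ext (funext fun j => ?_) rfl)
  · change (formScale b)⁻¹ • (cartanEquivDual H).symm (delta H i ∘ₗ _) = _
    rw [delta_comp_inl, map_zero, smul_zero]; rfl
  · change delta H i (d H j) = _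
    simp [delta, d, c, Pi.single_apply, eq_comm]

/-- The vectors of `ĥ` representing the simple roots are proportional to the simple coroots. -/
lemma dualVec_simpleRoot (i : Ix b) :
    ∃ r : ℂ, r ≠ 0 ∧ dualVec b (simpleRoot b i) = r • simpleCoroot b i := by
  cases i with
  | none =>
    refine ⟨1, one_ne_zero, ?_⟩
    have : ((formScale b)⁻¹ • (cartanEquivDual H).symm ((rootSystem H).root (theta b))) =
        (rootSystem H).coroot (theta b) := by
      rw [coroot_eq_smul, formScale_eq, inv_div]
    rw [simpleRoot, map_sub, dualVec_delta, dualVec_ext, this, one_smul]; rfl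
  | some i =>
    have h0 := root_cartanEquivDual_ne_zero (i : H.root)
    refine ⟨(formScale b)⁻¹ *
      ((rootSystem H).root i ((cartanEquivDual H).symm ((rootSystem H).root i)) / 2),
      mul_ne_zero (inv_ne_zero (formScale_ne_zero b)) (div_ne_zero h0 two_ne_zero), ?_⟩
    rw [simpleRoot, dualVec_ext, simpleCoroot, coroot_eq_smul]
    refine Prod.ext ?_ (Prod.ext (by simp) (by simp))
    simp only [Prod.smul_fst, smul_smul]
    congr 1
    field_simp

lemma lie_mk_mk (u v : Loop g) : (⁅(T.mk u 0 0 : T b), (T.mk v 0 0 : T b)⁆ : T b) =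
    T.mk ⁅u, v⁆ (fun i => cocycle (form b) i u v) 0 := by
  refine T.ext' ?_ rfl rfl
  change ⁅u, v⁆ + ∑ i, (0 : Fin 2 → ℂ) i • deg i v - ∑ i, (0 : Fin 2 → ℂ) i • deg i u = ⁅u, v⁆
  simp

lemma lie_eq_form_smul {v : Dual ℂ H} {x y : g} (hx : x ∈ eig H v) (hy : y ∈ eig H (-v)) :
    ⁅x, y⁆ = form b x y • (((formScale b)⁻¹ • (cartanEquivDual H).symm v : H) : g) := by
  rw [form_apply, H.coe_smul, smul_smul, mul_comm (formScale b), mul_assoc,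
    mul_inv_cancel₀ (formScale_ne_zero b), mul_one]
  by_cases h0 : v = 0
  · subst h0
    rw [neg_zero] at hy
    have := mem_eig.1 hy ⟨x, mem_eig_zero.1 hx⟩
    change ⁅x, y⁆ = _ at this
    rw [this]; simp
  · by_cases hx0 : x = 0
    · simp [hx0]
    obtain ⟨α, rfl⟩ := exists_root_of_mem_eig hx hx0 h0
    rw [mem_eig_iff_rootSpace] at hx hy
    have hx' : x ∈ rootSpace H (α.1 : H → ℂ) := hx
    have hy' : y ∈ rootSpace H (-(α.1 : H → ℂ)) := hy
    have h := lie_eq_killingForm_smul_of_mem_rootSpace_of_mem_rootSpace_neg hx' hy'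
    rw [h, rootSystem_root_apply]

/-- The bracket of opposite root vectors, as in a Kac–Moody algebra. -/
lemma lie_mono_mono_neg {v : Dual ℂ H} {x y : g} (hx : x ∈ eig H v) (hy : y ∈ eig H (-v))
    (m : ℤ × ℤ) : ⁅(T.mk (mono m x) 0 0 : T b), (T.mk (mono (-m) y) 0 0 : T b)⁆ =
      form b x y • incl b (dualVec b (loopWt v m)) := by
  have key := lie_eq_form_smul b hx hy
  have h1 : (dualVec b (loopWt v m)).1 = (formScale b)⁻¹ • (cartanEquivDual H).symm v := by
    rw [loopWt, map_add, map_add, map_zsmul, map_zsmul, dualVec_delta, dualVec_delta, dualVec_ext]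
    simp [c]
  have h2 (i) : (dualVec b (loopWt v m)).2.1 i = (expo i m : ℂ) := by
    rw [loopWt, map_add, map_add, map_zsmul, map_zsmul, dualVec_delta, dualVec_delta, dualVec_ext]
    fin_cases i <;> simp [c, expo]
  have h3 : (dualVec b (loopWt v m)).2.2 = 0 := rfl
  have h4 : form b x y • incl b (dualVec b (loopWt v m)) =
      T.mk (form b x y • mono 0 (((dualVec b (loopWt v m)).1 : H) : g))
        (form b x y • (dualVec b (loopWt v m)).2.1)
        (form b x y • (dualVec b (loopWt v m)).2.2) := rfl
  rw [h4, h1, h3, smul_zero, lie_mk_mk, lie_mono, add_neg_cancel, key, mono_smul]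
  congr 1
  funext i
  rw [cocycle_mono, if_pos (add_neg_cancel m), Pi.smul_apply, h2, mul_comm, smul_eq_mul]

end Structure

section Parabolic

variable {g : Type*} [LieRing g] [LieAlgebra ℂ g] [FiniteDimensional ℂ g] [IsSimple ℂ g]
  {H : LieSubalgebra ℂ g} [H.IsCartanSubalgebra]

/-! ### The grading by the defining element of a parabolic set -/

lemma loopWt_add (v v' : Dual ℂ H) (m m' : ℤ × ℤ) :
    loopWt (v + v') (m + m') = loopWt v m + loopWt v' m' := by
  simp only [loopWt, ext_add, Prod.fst_add, Prod.snd_add, add_smul]; abel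

lemma loopWt_zero : loopWt (0 : Dual ℂ H) 0 = 0 := by simp [loopWt, ext_zero]

lemma loopWt_neg (v : Dual ℂ H) (m : ℤ × ℤ) : loopWt (-v) (-m) = -loopWt v m := by
  simp only [loopWt, ext_neg, Prod.fst_neg, Prod.snd_neg, neg_smul]; abel

lemma loopWt_d_zero (v : Dual ℂ H) (m : ℤ × ℤ) : loopWt v m (d H 0) = m.1 := by
  simp [loopWt, ext_d, delta_zero_d_zero, delta_one_d_zero]

lemma loopWt_d_one (v : Dual ℂ H) (m : ℤ × ℤ) : loopWt v m (d H 1) = m.2 := by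
  simp [loopWt, ext_d, delta_zero_d_one, delta_one_d_one]

lemma loopWt_inl (v : Dual ℂ H) (m : ℤ × ℤ) (h : H) : loopWt v m (h, 0, 0) = v h := by
  simp [loopWt, ext, delta]

lemma loopWt_injective {v v' : Dual ℂ H} {m m' : ℤ × ℤ} (h : loopWt v m = loopWt v' m') :
    v = v' ∧ m = m' := by
  refine ⟨LinearMap.ext fun x => ?_, Prod.ext ?_ ?_⟩
  · rw [← loopWt_inl v m, h, loopWt_inl]
  · have := DFunLike.congr_fun h (d H 0)
    rw [loopWt_d_zero, loopWt_d_zero] at this; exact_mod_cast this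
  · have := DFunLike.congr_fun h (d H 1)
    rw [loopWt_d_one, loopWt_d_one] at this; exact_mod_cast this

variable (b : (rootSystem H).Base)

open scoped Classical in
/-- The degree of a root is the sum of its coefficients at the simple roots outside `A`. -/
lemma eval_fElt (A : Set (Ix b)) (n : Ix b → ℤ) (m : ℤ) :
    (∑ i, n i • simpleRoot b i + m • delta H 1) (fElt b A) =
      ((∑ i, if i ∈ A then 0 else n i : ℤ) : ℂ) := by
  simp only [LinearMap.add_apply, LinearMap.smul_apply, delta_one_fElt, smul_zero, add_zero,
    LinearMap.sum_apply, simpleRoot_fElt]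
  push_cast
  refine Finset.sum_congr rfl fun i _ => ?_
  split <;> simp

namespace AdaptedBasis

variable (E : AdaptedBasis H) (A : Set (Ix b))

lemma wtT_inl (k : E.Idx) : E.wtT (Sum.inl k) = loopWt (E.w k.2) k.1 := rfl
lemma wtT_inr (k) : E.wtT (Sum.inr k) = 0 := rfl

lemma exists_expansion (k) : ∃ (n : Ix b → ℤ) (m : ℤ),
    E.wtT k = ∑ i, n i • simpleRoot b i + m • delta H 1 ∧ ((∀ i, 0 ≤ n i) ∨ (∀ i, n i ≤ 0)) := by
  rcases k with k | k
  · obtain ⟨n, h, h'⟩ := loopWt_eq_sum b (E.mem k.2) (E.e.ne_zero k.2) k.1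
    exact ⟨n, k.1.2, h, h'⟩
  · exact ⟨0, 0, by simp [wtT_inr], Or.inl fun i => le_rfl⟩

lemma exists_lev (k) : ∃ n : ℤ, E.wtT k (fElt b A) = n := by
  obtain ⟨n, m, h, -⟩ := E.exists_expansion b k
  exact ⟨_, by rw [h, eval_fElt]⟩

/-- The degree of a basis vector in the grading of `T` defined by `f_A`. -/
def lev (k : E.Idx ⊕ Fin 2 ⊕ Fin 2) : ℤ := (E.exists_lev b A k).choose

lemma lev_spec (k) : E.wtT k (fElt b A) = E.lev b A k := (E.exists_lev b A k).choose_spec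

lemma lev_inr (k) : E.lev b A (Sum.inr k) = 0 := by
  have := E.lev_spec b A (Sum.inr k)
  rw [wtT_inr, LinearMap.zero_apply] at this
  exact_mod_cast this.symm

lemma lev_eq_of_wt {k k'} {β : Dual ℂ (Cartan H)} (h : E.wtT k = E.wtT k' + β)
    {n : ℤ} (hβ : β (fElt b A) = n) : E.lev b A k = E.lev b A k' + n := by
  have := E.lev_spec b A k
  rw [h, LinearMap.add_apply, lev_spec, hβ] at this
  exact_mod_cast this.symm

/-- The degree does not depend on the exponent of `t₂`. -/
lemma lev_shift (m₁ m₂ m₂' : ℤ) (j : Fin E.N) :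
    E.lev b A (Sum.inl ⟨(m₁, m₂), j⟩) = E.lev b A (Sum.inl ⟨(m₁, m₂'), j⟩) := by
  have h : E.wtT (Sum.inl ⟨(m₁, m₂), j⟩) = E.wtT (Sum.inl ⟨(m₁, m₂'), j⟩) +
      (m₂ - m₂') • delta H 1 := by
    simp only [wtT_inl, loopWt, sub_smul]; abel
  have := E.lev_eq_of_wt b A h (n := 0) (by simp [delta_one_fElt])
  simpa using this

lemma exists_neg (k) : ∃ k', E.wtT k' = -E.wtT k := by
  rcases k with ⟨m, j⟩ | k
  · by_cases hj : E.w j = 0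
    · refine ⟨Sum.inl ⟨-m, j⟩, ?_⟩
      rw [wtT_inl, wtT_inl, ← loopWt_neg]; simp [hj]
    · obtain ⟨α, hα⟩ := E.exists_root hj
      obtain ⟨j', hj'⟩ := E.exists_index ((rootSystem H).reflectionPerm α α)
      rw [root_reflectionPerm_self, hα] at hj'
      refine ⟨Sum.inl ⟨-m, j'⟩, ?_⟩
      rw [wtT_inl, wtT_inl, ← loopWt_neg]; simp [hj']
  · exact ⟨Sum.inr k, by simp [wtT_inr]⟩

variable {b} in
lemma exists_wt_eq {β : Dual ℂ (Cartan H)} {x : T b} (hx : x ∈ rootSubspace b β) (h0 : x ≠ 0) :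
    ∃ k, E.wtT k = β := by
  by_contra hc
  push Not at hc
  exact h0 ((E.basisT b).repr.map_eq_zero_iff.1
    (Finsupp.ext fun k => E.basisT_repr_eq_zero hx (hc k)))

lemma mem_roots {k} (h : E.wtT k ≠ 0) : E.wtT k ∈ roots b :=
  ⟨h, fun e => (E.basisT b).ne_zero k (by simpa [e] using E.basisT_mem (b := b) k)⟩

variable {b} in
lemma exists_of_mem_roots {β : Dual ℂ (Cartan H)} (h : β ∈ roots b) : ∃ k, E.wtT k = β := by
  obtain ⟨x, hx, h0⟩ := Submodule.exists_mem_ne_zero_of_ne_bot h.2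
  exact E.exists_wt_eq hx h0

lemma mem_setQ_iff {k} (h : E.wtT k ≠ 0) : E.wtT k ∈ setQ b A ↔ 0 ≤ E.lev b A k := by
  rw [setQ, Set.mem_ofPred_eq, lev_spec, and_iff_right (E.mem_roots b h)]
  simp

/-! ### The nilpotent subalgebra and the complementary projection -/

/-- The projection of `T` to the span of some of the basis vectors. -/
def proj (p : E.Idx ⊕ Fin 2 ⊕ Fin 2 → Prop) : T b →ₗ[ℂ] T b :=
  open scoped Classical in (E.basisT b).constr ℂ fun k => if p k then E.basisT b k else 0

open scoped Classical in
lemma repr_proj (p : E.Idx ⊕ Fin 2 ⊕ Fin 2 → Prop) (x : T b) (k) :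
    (E.basisT b).repr (E.proj b p x) k = if p k then (E.basisT b).repr x k else 0 := by
  have h (k) : E.proj b p (E.basisT b k) = (if p k then (1 : ℂ) else 0) • E.basisT b k := by
    rw [proj, Basis.constr_basis]; split <;> simp
  rw [Basis.repr_diag (E.basisT b) (E.proj b p) _ h]
  split <;> simp

lemma proj_of_mem {p : E.Idx ⊕ Fin 2 ⊕ Fin 2 → Prop} {x : T b}
    (h : ∀ k, ¬ p k → (E.basisT b).repr x k = 0) : E.proj b p x = x := by
  refine (E.basisT b).ext_elem fun k => ?_
  rw [repr_proj]
  split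
  · rfl
  · next hk => exact (h k hk).symm

lemma mem_span_of_repr {p : E.Idx ⊕ Fin 2 ⊕ Fin 2 → Prop} {x : T b}
    (h : ∀ k, ¬ p k → (E.basisT b).repr x k = 0) :
    x ∈ Submodule.span ℂ (E.basisT b '' {k | p k}) := by
  rw [Basis.mem_span_image]
  intro k hk
  by_contra hp
  exact (Finsupp.mem_support_iff.1 hk) (h k hp)

lemma repr_of_mem_span {p : E.Idx ⊕ Fin 2 ⊕ Fin 2 → Prop} {x : T b}
    (h : x ∈ Submodule.span ℂ (E.basisT b '' {k | p k})) (k) (hk : ¬ p k) :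
    (E.basisT b).repr x k = 0 := by
  rw [Basis.mem_span_image] at h
  by_contra h0
  exact hk (h (Finsupp.mem_support_iff.2 h0))

lemma lie_repr_eq_zero {k k' k''} (h : E.lev b A k'' ≠ E.lev b A k + E.lev b A k') :
    (E.basisT b).repr ⁅E.basisT b k, E.basisT b k'⁆ k'' = 0 := by
  refine E.basisT_repr_eq_zero (lie_mem_rootSubspace b (E.basisT_mem k) (E.basisT_mem k')) ?_
  intro e
  exact h (E.lev_eq_of_wt b A e (E.lev_spec b A k'))

/-- The span of the basis vectors of negative degree. -/
def negPart : LieSubalgebra ℂ (T b) :=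
  { Submodule.span ℂ (E.basisT b '' {k | E.lev b A k < 0}) with
    lie_mem' := by
      intro x y hx hy
      change x ∈ Submodule.span ℂ _ at hx
      change y ∈ Submodule.span ℂ _ at hy
      change ⁅x, y⁆ ∈ Submodule.span ℂ _
      induction hx using Submodule.span_induction with
      | zero => simp
      | add x x' _ _ h h' => rw [add_lie]; exact add_mem h h'
      | smul r x _ h => rw [smul_lie]; exact Submodule.smul_mem _ _ h
      | mem x h =>
        obtain ⟨k, hk, rfl⟩ := h
        induction hy using Submodule.span_induction with
        | zero => simp
        | add x x' _ _ h h' => rw [lie_add]; exact add_mem h h'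
        | smul r x _ h => rw [lie_smul]; exact Submodule.smul_mem _ _ h
        | mem y h =>
          obtain ⟨k', hk', rfl⟩ := h
          refine E.mem_span_of_repr b fun k'' hk'' => E.lie_repr_eq_zero b A ?_
          simp only [Set.mem_ofPred_eq] at hk hk' hk''
          omega }

/-- The subalgebra generated by the root spaces of negative degree is their sum. -/
lemma nilMinus_eq : nilMinus b A = E.negPart b A := by
  refine le_antisymm (LieSubalgebra.lieSpan_le.2 ?_) ?_
  · intro x hx
    simp only [Set.mem_iUnion] at hx
    obtain ⟨β, hβ, hx⟩ := hx
    refine E.mem_span_of_repr b fun k hk => ?_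
    refine E.basisT_repr_eq_zero hx fun e => hβ.2 ?_
    have h0 : E.wtT k ≠ 0 := by
      rw [e]; exact neg_ne_zero.2 hβ.1.1.1
    rw [← e]
    exact (E.mem_setQ_iff b A h0).2 (not_lt.1 hk)
  · change Submodule.span ℂ _ ≤ (nilMinus b A).toSubmodule
    refine Submodule.span_le.2 ?_
    rintro _ ⟨k, hk, rfl⟩
    have hk : E.lev b A k < 0 := hk
    refine LieSubalgebra.subset_lieSpan ?_
    have h0 : E.wtT k ≠ 0 := by
      intro e
      have := E.lev_spec b A k
      rw [e, LinearMap.zero_apply] at this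
      have : E.lev b A k = 0 := by exact_mod_cast this.symm
      omega
    obtain ⟨k', hk'⟩ := E.exists_neg k
    have hl : E.lev b A k' = -E.lev b A k := by
      have := E.lev_spec b A k'
      rw [hk', LinearMap.neg_apply, lev_spec] at this
      exact_mod_cast this.symm
    simp only [Set.mem_iUnion]
    refine ⟨-E.wtT k, ⟨?_, ?_⟩, ?_⟩
    · rw [← hk', E.mem_setQ_iff b A (by rw [hk']; exact neg_ne_zero.2 h0)]; omega
    · rw [neg_neg, E.mem_setQ_iff b A h0]; omega
    · rw [neg_neg]; exact E.basisT_mem k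

lemma mem_nilMinus_iff {x : T b} :
    x ∈ nilMinus b A ↔ ∀ k, ¬ E.lev b A k < 0 → (E.basisT b).repr x k = 0 := by
  rw [E.nilMinus_eq b A]
  exact ⟨fun h k hk => E.repr_of_mem_span b h k hk, fun h => E.mem_span_of_repr b h⟩

/-- The indices of the basis vectors of negative degree. -/
@[ext]
structure NegIdx where
  /-- The underlying index. -/
  idx : E.Idx
  neg : E.lev b A (Sum.inl idx) < 0

lemma basisT_mem_nilMinus (i : E.NegIdx b A) : E.basisT b (Sum.inl i.1) ∈ nilMinus b A := by
  rw [E.nilMinus_eq b A]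
  exact Submodule.subset_span ⟨_, i.2, rfl⟩

/-- A basis vector of negative degree as an element of the nilpotent subalgebra. -/
def negVec (i : E.NegIdx b A) : nilMinus b A :=
  ⟨E.basisT b (Sum.inl i.1), E.basisT_mem_nilMinus b A i⟩

lemma linearIndependent_negVec : LinearIndependent ℂ (E.negVec b A) := by
  have h : LinearIndependent ℂ (fun i : E.NegIdx b A => E.basisT b (Sum.inl i.1)) :=
    (E.basisT b).linearIndependent.comp (fun i : E.NegIdx b A => Sum.inl i.1) fun i j e =>
      NegIdx.ext (Sum.inl_injective e)
  exact LinearIndependent.of_comp ((nilMinus b A).incl : nilMinus b A →ₗ[ℂ] T b) h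

lemma span_negVec : ⊤ ≤ Submodule.span ℂ (Set.range (E.negVec b A)) := by
  rintro ⟨x, hx⟩ -
  have hx' := hx
  rw [E.nilMinus_eq b A] at hx'
  change x ∈ Submodule.span ℂ _ at hx'
  have hle : Submodule.span ℂ (E.basisT b '' {k | E.lev b A k < 0}) ≤
      (Submodule.span ℂ (Set.range (E.negVec b A))).map
          ((nilMinus b A).incl : nilMinus b A →ₗ[ℂ] T b) := by
    refine Submodule.span_le.2 ?_
    rintro _ ⟨k | k, hk, rfl⟩
    · exact ⟨_, Submodule.subset_span ⟨⟨k, hk⟩, rfl⟩, rfl⟩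
    · have hk : E.lev b A (Sum.inr k) < 0 := hk
      rw [lev_inr] at hk
      exact absurd hk (lt_irrefl _)
  obtain ⟨y, hy, e⟩ := hle hx'
  have : y = ⟨x, hx⟩ := Subtype.ext e
  rw [← this]; exact hy

/-- The basis vectors of negative degree form a basis of the nilpotent subalgebra. -/
def negBasis : Basis (E.NegIdx b A) ℂ (nilMinus b A) :=
  Basis.mk (E.linearIndependent_negVec b A) (E.span_negVec b A)

lemma negBasis_apply (i : E.NegIdx b A) : (E.negBasis b A i : T b) = E.basisT b (Sum.inl i.1) := by
  rw [negBasis, Basis.mk_apply]; rfl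

lemma basisT_repr_val (x : nilMinus b A) (i : E.NegIdx b A) :
    (E.basisT b).repr (x : T b) (Sum.inl i.1) = (E.negBasis b A).repr x i := by
  have h := (E.negBasis b A).ext (f₁ := (E.basisT b).coord (Sum.inl i.1) ∘ₗ
    ((nilMinus b A).incl : nilMinus b A →ₗ[ℂ] T b)) (f₂ := (E.negBasis b A).coord i) fun j => by
      simp only [LinearMap.comp_apply, Basis.coord_apply]
      have : ((nilMinus b A).incl : nilMinus b A →ₗ[ℂ] T b) (E.negBasis b A j) =
          E.basisT b (Sum.inl j.1) :=
        E.negBasis_apply b A j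
      rw [this, Basis.repr_self, Basis.repr_self]
      rcases eq_or_ne j i with rfl | hj
      · simp
      · rw [Finsupp.single_eq_of_ne hj.symm, Finsupp.single_eq_of_ne]
        intro e
        exact hj (NegIdx.ext (Sum.inl_injective e)).symm
  exact DFunLike.congr_fun h x

/-- The projection of `T` to the nilpotent subalgebra along the vectors of nonnegative degree. -/
def negProj : T b →ₗ[ℂ] nilMinus b A :=
  LinearMap.codRestrict (nilMinus b A).toSubmodule (E.proj b fun k => E.lev b A k < 0) fun x => by
    change _ ∈ nilMinus b A
    rw [E.mem_nilMinus_iff b A]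
    intro k hk
    rw [repr_proj, if_neg hk]

lemma negProj_apply (x : T b) : (E.negProj b A x : T b) = E.proj b (fun k => E.lev b A k < 0) x :=
  rfl

lemma negProj_of_mem (x : nilMinus b A) : E.negProj b A x = x :=
  Subtype.ext (E.proj_of_mem b ((E.mem_nilMinus_iff b A).1 x.2))

lemma negProj_repr (x : T b) (i : E.NegIdx b A) :
    (E.negBasis b A).repr (E.negProj b A x) i = (E.basisT b).repr x (Sum.inl i.1) := by
  rw [← basisT_repr_val, negProj_apply, repr_proj, if_pos i.2]

lemma negProj_eq_zero_iff {x : T b} :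
    E.negProj b A x = 0 ↔ ∀ k, E.lev b A k < 0 → (E.basisT b).repr x k = 0 := by
  rw [← Subtype.coe_inj, negProj_apply]
  constructor
  · intro h k hk
    have := E.repr_proj b (fun k => E.lev b A k < 0) x k
    rw [if_pos hk, h] at this
    rw [← this]; simp
  · intro h
    refine (E.basisT b).ext_elem fun k => ?_
    rw [repr_proj]
    split
    · next hk => rw [h k hk]; simp
    · simp

end AdaptedBasis

/-! ### The character of the parabolic subalgebra -/

lemma incl_mem (h : Cartan H) : incl b h ∈ rootSubspace b 0 := fun h' => by
  rw [lie_incl_incl, LinearMap.zero_apply, zero_smul]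

lemma incl_injective : Function.Injective (incl b) := by
  intro h h' e
  have h1 := congrArg (fun x : T b => coeffs g x.loop 0) e
  have h2 := congrArg T.cen e
  have h3 := congrArg T.der e
  change coeffs g (mono 0 (h.1 : g)) 0 = coeffs g (mono 0 (h'.1 : g)) 0 at h1
  rw [coeffs_mono, coeffs_mono, Finsupp.single_eq_same, Finsupp.single_eq_same] at h1
  exact Prod.ext (Subtype.ext h1) (Prod.ext h2 h3)

lemma AdaptedBasis.exists_incl_eq (E : AdaptedBasis H) {k} (hk : E.wtT k = 0) :
    ∃ h, incl b h = E.basisT b k := by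
  rcases k with ⟨m, j⟩ | k
  · rw [wtT_inl, ← loopWt_zero] at hk
    obtain ⟨hv, hm⟩ := loopWt_injective hk
    change E.w j = 0 at hv
    change m = 0 at hm
    have := E.mem j
    rw [hv, mem_eig_zero] at this
    refine ⟨(⟨E.e j, this⟩, 0, 0), ?_⟩
    rw [basisT_inl, hm]; rfl
  · exact ⟨_, (E.basisT_inr b k).symm⟩

lemma exists_chi (l : Dual ℂ (Cartan H)) : ∃ χ : T b →ₗ[ℂ] ℂ, (∀ h, χ (incl b h) = l h) ∧
    ∀ β ≠ 0, ∀ x ∈ rootSubspace b β, χ x = 0 := by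
  obtain ⟨E⟩ := exists_adaptedBasis H
  obtain ⟨q, hq⟩ := (incl b).exists_leftInverse_of_injective
    (LinearMap.ker_eq_bot.2 (incl_injective b))
  refine ⟨l ∘ₗ q ∘ₗ E.proj b (fun k => E.wtT k = 0), fun h => ?_, fun β hβ x hx => ?_⟩
  · rw [LinearMap.comp_apply, LinearMap.comp_apply,
      E.proj_of_mem b fun k hk => E.basisT_repr_eq_zero (incl_mem b h) hk]
    exact congrArg l (DFunLike.congr_fun hq h)
  · have : E.proj b (fun k => E.wtT k = 0) x = 0 := by
      refine (E.basisT b).ext_elem fun k => ?_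
      rw [E.repr_proj]
      split
      · next hk =>
        rw [E.basisT_repr_eq_zero hx (by rw [hk]; exact hβ.symm)]; simp
      · simp
    rw [LinearMap.comp_apply, LinearMap.comp_apply, this, map_zero, map_zero]

/-- The functional on `T` that is `λ` on `ĥ` and `0` on the root spaces. -/
def chi (l : Dual ℂ (Cartan H)) : T b →ₗ[ℂ] ℂ := (exists_chi b l).choose

lemma chi_incl (l : Dual ℂ (Cartan H)) (h : Cartan H) : chi b l (incl b h) = l h :=
  (exists_chi b l).choose_spec.1 h

lemma chi_of_mem (l : Dual ℂ (Cartan H)) {β : Dual ℂ (Cartan H)} (hβ : β ≠ 0) {x : T b}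
    (hx : x ∈ rootSubspace b β) : chi b l x = 0 :=
  (exists_chi b l).choose_spec.2 β hβ x hx

variable {b} {A : Set (Ix b)} {l : Dual ℂ (Cartan H)}

/-- An admissible weight kills the vectors that represent combinations of `δ₂` and of the simple
roots with indices in `A`. -/
lemma dualVec_sum (n : Ix b → ℤ) (m : ℤ) (hl : Vanishes b A l)
    (hn : ∀ i ∉ A, n i = 0) :
    l (dualVec b (∑ i, n i • simpleRoot b i + m • delta H 1)) = 0 := by
  rw [map_add, map_add, map_zsmul, map_zsmul, dualVec_delta, hl.2, smul_zero, add_zero, map_sum,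
    map_sum]
  refine Finset.sum_eq_zero fun i _ => ?_
  by_cases hi : i ∈ A
  · obtain ⟨r, -, hr⟩ := dualVec_simpleRoot b i
    rw [map_zsmul, map_zsmul, hr, map_smul,
      hl.1 _ (Submodule.subset_span ⟨i, hi, rfl⟩), smul_zero, smul_zero]
  · rw [hn i hi, zero_smul, map_zero, map_zero]

namespace AdaptedBasis

variable (E : AdaptedBasis H)

/-- An admissible weight kills the vectors of `ĥ` that represent the roots of degree zero. -/
lemma apply_dualVec_eq_zero (hl : Vanishes b A l) {k} (hk : E.lev b A k = 0) :
    l (dualVec b (E.wtT k)) = 0 := by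
  classical
  obtain ⟨n, m, h, hs⟩ := E.exists_expansion b k
  have h1 := E.lev_spec b A k
  rw [h, eval_fElt, hk] at h1
  have h1 : (∑ i, if i ∈ A then 0 else n i : ℤ) = 0 := by exact_mod_cast h1
  rw [h]
  refine dualVec_sum n m hl fun i hi => ?_
  rcases hs with hs | hs
  · have := (Finset.sum_eq_zero_iff_of_nonneg (fun i _ => by split; exacts [le_rfl, hs i])).1 h1 i
      (Finset.mem_univ i)
    simpa [hi] using this
  · have := (Finset.sum_eq_zero_iff_of_nonpos (fun i _ => by split; exacts [le_rfl, hs i])).1 h1 i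
      (Finset.mem_univ i)
    simpa [hi] using this

lemma chi_lie_basisT (hl : Vanishes b A l) {k k'} (hk : 0 ≤ E.lev b A k) (hk' : 0 ≤ E.lev b A k') :
    chi b l ⁅E.basisT b k, E.basisT b k'⁆ = 0 := by
  by_cases h0 : E.wtT k + E.wtT k' = 0
  swap
  · exact chi_of_mem b l h0 (lie_mem_rootSubspace b (E.basisT_mem k) (E.basisT_mem k'))
  have hw : E.wtT k' = -E.wtT k := (neg_eq_of_add_eq_zero_right h0).symm
  by_cases hk0 : E.wtT k = 0
  · obtain ⟨h, hh⟩ := E.exists_incl_eq b hk0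
    rw [← hh, E.basisT_mem k' h, hw, hk0, neg_zero, LinearMap.zero_apply, zero_smul, map_zero]
  rcases k with ⟨m, j⟩ | k
  swap
  · exact absurd (E.wtT_inr k) hk0
  rcases k' with ⟨m', j'⟩ | k'
  swap
  · rw [wtT_inr, add_zero] at h0; exact absurd h0 hk0
  have hlev : E.lev b A (Sum.inl ⟨m', j'⟩) = -E.lev b A (Sum.inl ⟨m, j⟩) := by
    have := E.lev_spec b A (Sum.inl ⟨m', j'⟩)
    rw [hw, LinearMap.neg_apply, lev_spec] at this
    exact_mod_cast this.symm
  have hz : E.lev b A (Sum.inl ⟨m, j⟩) = 0 := by omega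
  rw [wtT_inl, wtT_inl, ← loopWt_neg] at hw
  obtain ⟨hv, hm⟩ := loopWt_injective hw
  change E.w j' = -E.w j at hv
  change m' = -m at hm
  have hj' := E.mem j'
  rw [hv] at hj'
  rw [basisT_inl, basisT_inl, hm]
  have := lie_mono_mono_neg b (E.mem j) hj' m
  rw [this, map_smul, chi_incl]
  have := E.apply_dualVec_eq_zero hl hz
  rw [wtT_inl] at this
  rw [this, smul_zero]

/-- The elements of nonnegative degree form a subalgebra of which `λ` is a character. -/
lemma lie_mem_parabolic (hl : Vanishes b A l) (x y : T b) (hx : E.negProj b A x = 0)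
    (hy : E.negProj b A y = 0) : E.negProj b A ⁅x, y⁆ = 0 ∧ chi b l ⁅x, y⁆ = 0 := by
  have key (z : T b) (hz : E.negProj b A z = 0) :
      z ∈ Submodule.span ℂ (E.basisT b '' {k | ¬ E.lev b A k < 0}) :=
    E.mem_span_of_repr b fun k hk => (E.negProj_eq_zero_iff b A).1 hz k (not_not.1 hk)
  replace hx := key x hx
  replace hy := key y hy
  clear key
  induction hx using Submodule.span_induction with
  | zero => simp
  | add x x' _ _ h h' => rw [add_lie, map_add, map_add, h.1, h.2, h'.1, h'.2]; simp
  | smul r x _ h => rw [smul_lie, map_smul, map_smul, h.1, h.2]; simp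
  | mem x h =>
    obtain ⟨k, hk, rfl⟩ := h
    induction hy using Submodule.span_induction with
    | zero => simp
    | add x x' _ _ h h' => rw [lie_add, map_add, map_add, h.1, h.2, h'.1, h'.2]; simp
    | smul r x _ h => rw [lie_smul, map_smul, map_smul, h.1, h.2]; simp
    | mem y h =>
      obtain ⟨k', hk', rfl⟩ := h
      simp only [Set.mem_ofPred_eq, not_lt] at hk hk'
      refine ⟨(E.negProj_eq_zero_iff b A).2 fun k'' hk'' => E.lie_repr_eq_zero b A (by omega),
        E.chi_lie_basisT hl hk hk'⟩

end AdaptedBasis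

lemma chi_of_mem_nilMinus (x : nilMinus b A) : chi b l (x : T b) = 0 := by
  obtain ⟨E⟩ := exists_adaptedBasis H
  obtain ⟨x, h⟩ := x
  change chi b l x = 0
  rw [E.nilMinus_eq b A] at h
  change x ∈ Submodule.span ℂ _ at h
  induction h using Submodule.span_induction with
  | zero => simp
  | add x x' _ _ h h' => rw [map_add, h, h', add_zero]
  | smul r x _ h => rw [map_smul, h, smul_zero]
  | mem x h =>
    obtain ⟨k, hk, rfl⟩ := h
    have hk : E.lev b A k < 0 := hk
    refine chi_of_mem b l (β := E.wtT k) ?_ (E.basisT_mem k)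
    intro e
    have := E.lev_spec b A k
    rw [e, LinearMap.zero_apply] at this
    have : E.lev b A k = 0 := by exact_mod_cast this.symm
    omega

end Parabolic

section VermaModules

variable {g : Type*} [LieRing g] [LieAlgebra ℂ g] [FiniteDimensional ℂ g] [IsSimple ℂ g]
  {H : LieSubalgebra ℂ g} [H.IsCartanSubalgebra]

attribute [local instance 100] LieRing.ofAssociativeRing

variable {b : (rootSystem H).Base}

/-! ### The induced module on the enveloping algebra of the nilpotent subalgebra -/

lemma ι_smul_vac {S : Set (Dual ℂ (Cartan H))} {l : Dual ℂ (Cartan H)} {β : Dual ℂ (Cartan H)}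
    (hβ : β ∈ S) {x : T b} (hx : x ∈ rootSubspace b β) :
    UniversalEnvelopingAlgebra.ι ℂ x • vac b S l = 0 := by
  change Submodule.Quotient.mk (UniversalEnvelopingAlgebra.ι ℂ x • (1 : U b)) = 0
  rw [Submodule.Quotient.mk_eq_zero, smul_eq_mul, mul_one]
  exact Submodule.subset_span (Or.inl ⟨β, hβ, x, hx, rfl⟩)

lemma incl_smul_vac (S : Set (Dual ℂ (Cartan H))) (l : Dual ℂ (Cartan H)) (h : Cartan H) :
    UniversalEnvelopingAlgebra.ι ℂ (incl b h) • vac b S l =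
      algebraMap ℂ (U b) (l h) • vac b S l := by
  rw [← sub_eq_zero, ← sub_smul]
  change Submodule.Quotient.mk (_ • (1 : U b)) = 0
  rw [Submodule.Quotient.mk_eq_zero, smul_eq_mul, mul_one]
  exact Submodule.subset_span (Or.inr ⟨h, rfl⟩)

/-- The generator spans the induced module. -/
lemma exists_smul_vac (S : Set (Dual ℂ (Cartan H))) (l : Dual ℂ (Cartan H)) (v : Verma b S l) :
    ∃ w : U b, w • vac b S l = v := by
  obtain ⟨w, rfl⟩ := Submodule.Quotient.mk_surjective _ v
  exact ⟨w, by change Submodule.Quotient.mk (w • (1 : U b)) = _; rw [smul_eq_mul, mul_one]⟩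

variable (E : AdaptedBasis H) {A : Set (Ix b)} {l : Dual ℂ (Cartan H)}

namespace AdaptedBasis

lemma ne_zero_of_lev_ne_zero {k} (h : E.lev b A k ≠ 0) : E.wtT k ≠ 0 := by
  intro e
  have := E.lev_spec b A k
  rw [e, LinearMap.zero_apply] at this
  exact h (by exact_mod_cast this.symm)

lemma parabolic_smul_vac (x : T b) (hx : E.negProj b A x = 0) :
    UniversalEnvelopingAlgebra.ι ℂ x • vac b (setQ b A) l =
      algebraMap ℂ (U b) (chi b l x) • vac b (setQ b A) l := by
  replace hx : x ∈ Submodule.span ℂ (E.basisT b '' {k | ¬ E.lev b A k < 0}) :=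
    E.mem_span_of_repr b fun k hk => (E.negProj_eq_zero_iff b A).1 hx k (not_not.1 hk)
  induction hx using Submodule.span_induction with
  | zero => simp
  | add x x' _ _ h h' => rw [map_add, map_add, map_add, add_smul, add_smul, h, h']
  | smul r x _ h =>
    rw [map_smul, map_smul, smul_eq_mul, map_mul, mul_smul, ← h, Algebra.smul_def, mul_smul]
  | mem x h =>
    obtain ⟨k, hk, rfl⟩ := h
    by_cases h0 : E.wtT k = 0
    · obtain ⟨h, hh⟩ := E.exists_incl_eq b h0
      rw [← hh, chi_incl, incl_smul_vac]
    · rw [chi_of_mem b l h0 (E.basisT_mem k), map_zero, zero_smul]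
      exact ι_smul_vac ((E.mem_setQ_iff b A h0).2 (not_lt.1 hk)) (E.basisT_mem k)

variable (hl : Vanishes b A l)

/-- The action of `U(T)` on the enveloping algebra of the nilpotent subalgebra, regarded as the
underlying space of the induced module. -/
def actU : U b →ₐ[ℂ] Module.End ℂ (UniversalEnvelopingAlgebra ℂ (nilMinus b A)) :=
  Induced.uact (E.negProj_of_mem b A) chi_of_mem_nilMinus (E.lie_mem_parabolic hl)

lemma actU_ι (x : T b) (u : UniversalEnvelopingAlgebra ℂ (nilMinus b A)) :
    E.actU hl (UniversalEnvelopingAlgebra.ι ℂ x) u =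
      Induced.op (E.negProj b A) (chi b l) x u := Induced.uact_ι _ _ _ x u

lemma actU_nilMinusToU (w u : UniversalEnvelopingAlgebra ℂ (nilMinus b A)) :
    E.actU hl (nilMinusToU b A w) u = w * u := Induced.uact_toU _ _ _ w u

lemma smul_vac (w : U b) : w • vac b (setQ b A) l =
    nilMinusToU b A (E.actU hl w 1) • vac b (setQ b A) l :=
  Induced.smul_eq_toU_smul (E.negProj_of_mem b A) chi_of_mem_nilMinus (E.lie_mem_parabolic hl)
    (vac b (setQ b A) l) E.parabolic_smul_vac w

lemma actU_one_of_mem {w : U b} (hw : w ∈ vermaIdeal b (setQ b A) l) : E.actU hl w 1 = 0 := by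
  induction hw using Submodule.span_induction with
  | zero => simp
  | add x y _ _ h h' => rw [map_add, LinearMap.add_apply, h, h', add_zero]
  | smul a x _ h => rw [smul_eq_mul, map_mul, Module.End.mul_apply, h, map_zero]
  | mem u h =>
    rcases h with ⟨β, hβ, x, hx, rfl⟩ | ⟨h, rfl⟩
    · have h1 : E.negProj b A x = 0 := by
        rw [E.negProj_eq_zero_iff]
        intro k hk
        refine E.basisT_repr_eq_zero hx fun e => ?_
        have h0 := E.ne_zero_of_lev_ne_zero hk.ne
        rw [← e, E.mem_setQ_iff b A h0] at hβ
        omega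
      rw [actU_ι, Induced.op_one, h1, chi_of_mem b l hβ.1.1 hx]
      simp
    · have h1 : E.negProj b A (incl b h) = 0 := by
        rw [E.negProj_eq_zero_iff]
        intro k hk
        exact E.basisT_repr_eq_zero (incl_mem b h) (E.ne_zero_of_lev_ne_zero hk.ne)
      rw [map_sub, LinearMap.sub_apply, actU_ι, Induced.op_one, h1, chi_incl, AlgHom.commutes]
      simp [Algebra.algebraMap_eq_smul_one]

/-- `M(λ, A)` is free of rank one over the enveloping algebra of the nilpotent subalgebra: it acts
on that algebra with the relations of the generator, which gives the inverse map. -/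
lemma bijective_smul_vac (hl : Vanishes b A l) : Function.Bijective
    (fun u : UniversalEnvelopingAlgebra ℂ (nilMinus b A) =>
      nilMinusToU b A u • vac b (setQ b A) l) := by
  obtain ⟨E⟩ := exists_adaptedBasis H
  constructor
  · intro u u' h
    have h1 : nilMinusToU b A (u - u') ∈ vermaIdeal b (setQ b A) l := by
      rw [← Submodule.Quotient.mk_eq_zero]
      have : (nilMinusToU b A (u - u')) • vac b (setQ b A) l = 0 := by
        rw [map_sub, sub_smul, sub_eq_zero]; exact h
      rw [← this]
      change _ = Submodule.Quotient.mk (_ • (1 : U b))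
      rw [smul_eq_mul, mul_one]
    have := E.actU_one_of_mem hl h1
    rw [actU_nilMinusToU, mul_one, sub_eq_zero] at this
    exact this
  · intro v
    obtain ⟨w, rfl⟩ := exists_smul_vac _ _ v
    exact ⟨_, (E.smul_vac hl w).symm⟩

/-- The identification of `M(λ, A)` with the enveloping algebra of the nilpotent subalgebra. -/
def equivM : UniversalEnvelopingAlgebra ℂ (nilMinus b A) ≃ₗ[ℂ] GIVM b l A :=
  LinearEquiv.ofBijective
    { toFun := fun u => nilMinusToU b A u • vac b (setQ b A) l
      map_add' := fun u v => by rw [map_add, add_smul]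
      map_smul' := fun r u => by rw [map_smul, smul_assoc, RingHom.id_apply] }
    (bijective_smul_vac hl)

lemma equivM_apply (u : UniversalEnvelopingAlgebra ℂ (nilMinus b A)) :
    equivM hl u = nilMinusToU b A u • vac b (setQ b A) l := rfl

lemma equivM_one : equivM hl 1 = vac b (setQ b A) l := by
  rw [equivM_apply, map_one, one_smul]

lemma smul_equivM (w : U b) (u : UniversalEnvelopingAlgebra ℂ (nilMinus b A)) :
    w • equivM hl u = equivM hl (E.actU hl w u) := by
  rw [equivM_apply, ← mul_smul, E.smul_vac hl, map_mul, Module.End.mul_apply, actU_nilMinusToU,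
    mul_one, equivM_apply]

/-! ### The monomial basis -/

/-- The order of the negative root vectors, by the exponent of `t₂` first. -/
instance : LinearOrder (E.NegIdx b A) :=
  LinearOrder.lift' (fun i => toLex (i.1.1.2, toLex (i.1.1.1, i.1.2)) :
    E.NegIdx b A → ℤ ×ₗ (ℤ ×ₗ Fin E.N)) (by
      rintro ⟨⟨⟨m, n⟩, j⟩, hi⟩ ⟨⟨⟨m', n'⟩, j'⟩, hi'⟩ h
      simp only [EmbeddingLike.apply_eq_iff_eq, Prod.mk.injEq] at h
      obtain ⟨rfl, rfl, rfl⟩ := h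
      rfl)

lemma lt_of_snd_lt {i j : E.NegIdx b A} (h : i.1.1.2 < j.1.1.2) : i < j := by
  change toLex (i.1.1.2, toLex (i.1.1.1, i.1.2)) < toLex (j.1.1.2, toLex (j.1.1.1, j.1.2))
  exact Prod.Lex.toLex_lt_toLex.2 (Or.inl h)

/-- The basis of `M(λ, A)` that consists of the ordered monomials. -/
def basisM : Basis (E.NegIdx b A →₀ ℕ) ℂ (GIVM b l A) :=
  ((MvPolynomial.basisMonomials (E.NegIdx b A) ℂ).map (PBW.equiv (E.negBasis b A))).map
    (equivM hl)

/-- The weight of a monomial. -/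
def wtM (a : E.NegIdx b A →₀ ℕ) : Dual ℂ (Cartan H) :=
  ((Finsupp.toMultiset a).map fun i => E.wtT (Sum.inl i.1)).sum

/-- The degree of a monomial. -/
def levM (a : E.NegIdx b A →₀ ℕ) : ℤ :=
  ((Finsupp.toMultiset a).map fun i => E.lev b A (Sum.inl i.1)).sum

lemma basisM_apply (a : E.NegIdx b A →₀ ℕ) : E.basisM hl a =
    equivM hl (PBW.word (E.negBasis b A) ((Finsupp.toMultiset a).sort (· ≤ ·))) := by
  rw [basisM, Basis.map_apply, Basis.map_apply, MvPolynomial.coe_basisMonomials, PBW.equiv_monomial]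

lemma basisM_zero : E.basisM hl 0 = vac b (setQ b A) l := by
  rw [basisM_apply, map_zero, Multiset.sort_zero, PBW.word, List.map_nil, List.prod_nil, equivM_one]

lemma basisM_single (i : E.NegIdx b A) : E.basisM hl (Finsupp.single i 1) =
    UniversalEnvelopingAlgebra.ι ℂ (E.basisT b (Sum.inl i.1)) • vac b (setQ b A) l := by
  rw [basisM_apply, Finsupp.toMultiset_single, one_smul, Multiset.sort_singleton, PBW.word,
    List.map_singleton, List.prod_singleton, equivM_apply, ← negBasis_apply]
  congr 1
  exact Induced.toU_ι _ _

lemma wtM_add (a a' : E.NegIdx b A →₀ ℕ) : E.wtM (a + a') = E.wtM a + E.wtM a' := by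
  simp [wtM]

lemma levM_add (a a' : E.NegIdx b A →₀ ℕ) : E.levM (a + a') = E.levM a + E.levM a' := by
  simp [levM]

lemma wtM_zero : E.wtM (0 : E.NegIdx b A →₀ ℕ) = 0 := by simp [wtM]
lemma levM_zero : E.levM (0 : E.NegIdx b A →₀ ℕ) = 0 := by simp [levM]

lemma wtM_single (i : E.NegIdx b A) : E.wtM (Finsupp.single i 1) = E.wtT (Sum.inl i.1) := by
  simp [wtM]

lemma levM_single (i : E.NegIdx b A) :
    E.levM (Finsupp.single i 1) = E.lev b A (Sum.inl i.1) := by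
  simp [levM]

lemma exists_eq_single_add {a : E.NegIdx b A →₀ ℕ} (ha : a ≠ 0) :
    ∃ (i : E.NegIdx b A) (a' : E.NegIdx b A →₀ ℕ), a = Finsupp.single i 1 + a' := by
  obtain ⟨i, hi⟩ := Finsupp.support_nonempty_iff.2 ha
  exact ⟨i, a - Finsupp.single i 1, (PBW.single_add_sub hi).symm⟩

lemma wtM_fElt (a : E.NegIdx b A →₀ ℕ) : E.wtM a (fElt b A) = E.levM a := by
  rw [wtM, levM]
  induction Finsupp.toMultiset a using Multiset.induction with
  | empty => simp
  | cons i s ih =>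
    rw [Multiset.map_cons, Multiset.sum_cons, LinearMap.add_apply, ih, lev_spec, Multiset.map_cons,
      Multiset.sum_cons, Int.cast_add]

lemma levM_nonpos (a : E.NegIdx b A →₀ ℕ) : E.levM a ≤ 0 := by
  rw [levM]
  induction Finsupp.toMultiset a using Multiset.induction with
  | empty => simp
  | cons i s ih =>
    rw [Multiset.map_cons, Multiset.sum_cons]
    have := i.2
    omega

lemma levM_neg {a : E.NegIdx b A →₀ ℕ} (ha : a ≠ 0) : E.levM a < 0 := by
  obtain ⟨i, a', rfl⟩ := E.exists_eq_single_add ha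
  rw [levM_add, levM_single]
  have := i.2
  have := E.levM_nonpos a'
  omega

lemma incl_act_word (h : Cartan H) (L : List (E.NegIdx b A)) :
    Induced.op (E.negProj b A) (chi b l) (incl b h) (PBW.word (E.negBasis b A) L) =
      (l h + (L.map fun i => E.wtT (Sum.inl i.1)).sum h) • PBW.word (E.negBasis b A) L := by
  induction L with
  | nil =>
    have h1 : E.negProj b A (incl b h) = 0 := by
      rw [E.negProj_eq_zero_iff]
      intro k hk
      exact E.basisT_repr_eq_zero (incl_mem b h) (E.ne_zero_of_lev_ne_zero hk.ne)
    simp only [PBW.word, List.map_nil, List.prod_nil, List.sum_nil]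
    rw [Induced.op_one, h1, chi_incl]
    simp [Algebra.algebraMap_eq_smul_one]
  | cons i L ih =>
    have hw : PBW.word (E.negBasis b A) (i :: L) =
        UniversalEnvelopingAlgebra.ι ℂ (E.negBasis b A i) * PBW.word (E.negBasis b A) L := by
      simp [PBW.word]
    have hb : ⁅incl b h, (E.negBasis b A i : T b)⁆ =
        E.wtT (Sum.inl i.1) h • (E.negBasis b A i : T b) := by
      rw [negBasis_apply]; exact E.basisT_mem _ h
    rw [hw, Induced.op_mul, ih, hb, map_smul, LinearMap.smul_apply,
      Induced.op_sub (E.negProj_of_mem b A) chi_of_mem_nilMinus, List.map_cons, List.sum_cons,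
      LinearMap.add_apply, mul_smul_comm, ← add_smul]
    congr 1; ring

lemma incl_smul_basisM (h : Cartan H) (a : E.NegIdx b A →₀ ℕ) :
    UniversalEnvelopingAlgebra.ι ℂ (incl b h) • E.basisM hl a =
      (l h + E.wtM a h) • E.basisM hl a := by
  rw [basisM_apply, smul_equivM, actU_ι, incl_act_word, map_smul]
  congr 3
  rw [wtM, ← Multiset.sum_coe, ← Multiset.map_coe, Multiset.sort_eq]

/-- The action of an element of `ĥ` on `M(λ, A)`. -/
def inclEnd (A : Set (Ix b)) (l : Dual ℂ (Cartan H)) (h : Cartan H) :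
    GIVM b l A →ₗ[ℂ] GIVM b l A where
  toFun v := UniversalEnvelopingAlgebra.ι ℂ (incl b h) • v
  map_add' := smul_add _
  map_smul' r v := smul_algebra_smul_comm r _ v

lemma inclEnd_basisM (h : Cartan H) (a : E.NegIdx b A →₀ ℕ) :
    inclEnd A l h (E.basisM hl a) = (l h + E.wtM a h) • E.basisM hl a :=
  E.incl_smul_basisM hl h a

/-- The weight spaces of `M(λ, A)` are spanned by monomials. -/
lemma weightSpace_eq_span (μ : Dual ℂ (Cartan H)) : weightSpace b (GIVM b l A) μ =
    Submodule.span ℂ (E.basisM hl '' {a | l + E.wtM a = μ}) := by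
  ext v
  rw [Basis.mem_span_image]
  constructor
  · intro hv a ha
    by_contra hc
    refine (Finsupp.mem_support_iff.1 ha) ?_
    obtain ⟨h, hh⟩ : ∃ h, (l + E.wtM a) h ≠ μ h := by
      by_contra hc'; push Not at hc'; exact hc (LinearMap.ext hc')
    exact Basis.repr_eq_zero_of_diag (E.basisM hl) (D := inclEnd A l h)
      (c := fun a => l h + E.wtM a h) (fun a => E.inclEnd_basisM hl h a) (μ := μ h) (hv h) hh
  · intro hv
    rw [← (E.basisM hl).linearCombination_repr v, Finsupp.linearCombination_apply]
    refine Submodule.sum_mem _ fun a ha => Submodule.smul_mem _ _ fun h => ?_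
    have : l + E.wtM a = μ := hv ha
    rw [E.incl_smul_basisM hl h a, ← this]; rfl

lemma rank_weightSpace (μ : Dual ℂ (Cartan H)) :
    Module.rank ℂ (weightSpace b (GIVM b l A) μ) =
      Cardinal.mk (E.basisM hl '' {a | l + E.wtM a = μ}) := by
  rw [E.weightSpace_eq_span hl μ]
  exact rank_span_set
    (LinearIndepOn.id_image ((E.basisM hl).linearIndependent.comp _ Subtype.val_injective))

end AdaptedBasis

end VermaModules

section Weights

variable {g : Type*} [LieRing g] [LieAlgebra ℂ g] [FiniteDimensional ℂ g] [IsSimple ℂ g]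
  {H : LieSubalgebra ℂ g} [H.IsCartanSubalgebra]

attribute [local instance 100] LieRing.ofAssociativeRing

variable {b : (rootSystem H).Base} {A : Set (Ix b)} {l : Dual ℂ (Cartan H)}

/-! ### Weight multiplicities -/

namespace AdaptedBasis

variable (E : AdaptedBasis H)

lemma lev_eq_iff {k} {n : ℤ} : E.lev b A k = n ↔ E.wtT k (fElt b A) = n := by
  rw [lev_spec]; norm_cast

lemma exists_negIdx {k} (hk : E.lev b A k < 0) : ∃ i : E.NegIdx b A, Sum.inl i.1 = k := by
  rcases k with k | k
  · exact ⟨⟨k, hk⟩, rfl⟩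
  · rw [lev_inr] at hk; exact absurd hk (lt_irrefl _)

lemma eq_zero_of_levM {a : E.NegIdx b A →₀ ℕ} (ha : E.levM a = 0) : a = 0 := by
  by_contra h
  exact (E.levM_neg h).ne ha

lemma eq_single_of_levM {a : E.NegIdx b A →₀ ℕ} (ha : E.levM a = -1) :
    ∃ i, a = Finsupp.single i 1 := by
  obtain ⟨i, a', rfl⟩ := E.exists_eq_single_add (a := a) (by rintro rfl; simp [levM_zero] at ha)
  rw [levM_add, levM_single] at ha
  have h1 := i.2
  have h2 := E.levM_nonpos a'
  refine ⟨i, ?_⟩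
  rw [E.eq_zero_of_levM (a := a') (by omega), add_zero]

lemma levM_eq_of_add {a : E.NegIdx b A →₀ ℕ} {β : Dual ℂ (Cartan H)} {n : ℤ}
    (h : l + E.wtM a = l + β) (hβ : β (fElt b A) = n) : E.levM a = n := by
  have := E.wtM_fElt a
  rw [add_left_cancel h, hβ] at this
  exact_mod_cast this.symm

lemma rank_weightSpace_self (hl : Vanishes b A l) :
    Module.rank ℂ (weightSpace b (GIVM b l A) l) = 1 := by
  obtain ⟨E⟩ := exists_adaptedBasis H
  rw [E.rank_weightSpace hl]
  have : {a : E.NegIdx b A →₀ ℕ | l + E.wtM a = l} = {0} := by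
    ext a
    simp only [Set.mem_ofPred_eq, Set.mem_singleton_iff]
    constructor
    · intro h
      exact E.eq_zero_of_levM (E.levM_eq_of_add (β := 0) (n := 0) (by rw [h, add_zero]) (by simp))
    · rintro rfl; rw [wtM_zero, add_zero]
  rw [this, Set.image_singleton, Cardinal.mk_singleton]

end AdaptedBasis

lemma FirstLayer.exists_eq_add {μ : Dual ℂ (Cartan H)} (h : FirstLayer b A l μ) :
    ∃ β : Dual ℂ (Cartan H), μ = l + β ∧ β (fElt b A) = (-1 : ℤ) := by
  classical
  obtain ⟨k, hk, j, hj, n, rfl⟩ := h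
  refine ⟨-∑ i, k i • simpleRoot b i - simpleRoot b j + n • delta H 1, by abel, ?_⟩
  have : (∑ i, k i • simpleRoot b i) (fElt b A) = 0 := by
    rw [LinearMap.sum_apply]
    refine Finset.sum_eq_zero fun i _ => ?_
    rw [LinearMap.smul_apply, simpleRoot_fElt]
    split
    · simp
    · next hi => rw [hk i hi, zero_smul]
  rw [LinearMap.add_apply, LinearMap.sub_apply, LinearMap.neg_apply, this, simpleRoot_fElt,
    if_neg hj, LinearMap.smul_apply, delta_one_fElt]
  simp

/-- The degree of `δ₁` is a nonnegative integer. -/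
lemma exists_delta_zero_fElt (b : (rootSystem H).Base) (A : Set (Ix b)) :
    ∃ K : ℤ, 0 ≤ K ∧ delta H 0 (fElt b A) = K := by
  classical
  refine ⟨((if none ∈ A then 0 else 1 : ℕ) +
    ∑ i : b.support, tc b i * (if some i ∈ A then 0 else 1) : ℕ),
    Int.natCast_nonneg _, ?_⟩
  rw [delta_zero_eq b, LinearMap.add_apply, LinearMap.sum_apply, simpleRoot_fElt]
  push_cast
  congr 1
  refine Finset.sum_congr rfl fun i _ => ?_
  rw [LinearMap.smul_apply, simpleRoot_fElt]
  split <;> simp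

namespace AdaptedBasis

variable (E : AdaptedBasis H)

/-- The monomials of weight `-δ₁ + n δ₂` and degree `-1` are the single factors `h(-1, n)` with `h`
in the Cartan subalgebra. -/
lemma rank_weightSpace_imaginary (hl : Vanishes b A l) {n : ℤ}
    (h : (-delta H 0 + n • delta H 1) (fElt b A) = (-1 : ℤ)) :
    Module.rank ℂ (weightSpace b (GIVM b l A) (l - delta H 0 + n • delta H 1)) =
      Module.rank ℂ H := by
  obtain ⟨E⟩ := exists_adaptedBasis H
  have hw (j) (hj : E.w j = 0) :
      E.wtT (Sum.inl ⟨(-1, n), j⟩) = -delta H 0 + n • delta H 1 := by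
    rw [wtT_inl]
    change loopWt (E.w j) (-1, n) = _
    rw [hj]; simp [loopWt, ext_zero]
  have hlev (j) (hj : E.w j = 0) : E.lev b A (Sum.inl ⟨(-1, n), j⟩) < 0 := by
    have : E.lev b A (Sum.inl ⟨(-1, n), j⟩) = -1 := by
      rw [lev_eq_iff, hw j hj, h]
    omega
  have hrank : Module.rank ℂ H = Cardinal.mk (E.e '' {j | E.w j = 0}) := by
    rw [← E.rank_eig, eig_zero_eq]; rfl
  let φ : {j | E.w j = 0} →
      {a : E.NegIdx b A →₀ ℕ | l + E.wtM a = l - delta H 0 + n • delta H 1} := fun j =>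
    ⟨Finsupp.single ⟨⟨(-1, n), j.1⟩, hlev j.1 j.2⟩ 1, by
      change l + E.wtM _ = _
      rw [wtM_single]
      change l + E.wtT (Sum.inl ⟨(-1, n), j.1⟩) = _
      rw [hw j.1 j.2]; abel⟩
  have hφ : Function.Bijective φ := by
    constructor
    · intro j j' e
      have e1 := congrArg Subtype.val e
      have e2 := (Finsupp.single_left_injective one_ne_zero) e1
      have e3 : (⟨(-1, n), j.1⟩ : E.Idx) = ⟨(-1, n), j'.1⟩ := congrArg NegIdx.idx e2
      simp only [Sigma.mk.injEq, heq_eq_eq, true_and] at e3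
      exact Subtype.ext e3
    · rintro ⟨a, ha⟩
      have ha : l + E.wtM a = l - delta H 0 + n • delta H 1 := ha
      have ha : l + E.wtM a = l + (-delta H 0 + n • delta H 1) := by rw [ha]; abel
      obtain ⟨⟨⟨m, j⟩, hi⟩, rfl⟩ := E.eq_single_of_levM (E.levM_eq_of_add ha h)
      rw [wtM_single] at ha
      have ha : loopWt (E.w j) m = loopWt 0 (-1, n) := by
        refine (add_left_cancel ha).trans ?_
        simp [loopWt, ext_zero]
      obtain ⟨hj, rfl⟩ := loopWt_injective ha
      exact ⟨⟨j, hj⟩, rfl⟩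
  rw [E.rank_weightSpace hl, hrank]
  have h1 := Cardinal.mk_image_eq_lift (E.basisM hl)
    {a : E.NegIdx b A →₀ ℕ | l + E.wtM a = l - delta H 0 + n • delta H 1} (E.basisM hl).injective
  have h2 := Cardinal.mk_image_eq_lift E.e {j | E.w j = 0} E.e.injective
  rw [← Cardinal.mk_congr (Equiv.ofBijective φ hφ), ← h2] at h1
  exact Cardinal.lift_injective h1

/-- A monomial of degree `-1` is a single root vector, and real root spaces are one-dimensional. -/
lemma rank_weightSpace_real (hl : Vanishes b A l) {β : Dual ℂ (Cartan H)}
    (h : β (fElt b A) = (-1 : ℤ)) (hβ : ¬ ∃ n : ℤ, β = -delta H 0 + n • delta H 1) :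
    Module.rank ℂ (weightSpace b (GIVM b l A) (l + β)) = 0 ∨
      Module.rank ℂ (weightSpace b (GIVM b l A) (l + β)) = 1 := by
  obtain ⟨E⟩ := exists_adaptedBasis H
  rw [E.rank_weightSpace hl]
  have hs : {a : E.NegIdx b A →₀ ℕ | l + E.wtM a = l + β}.Subsingleton := by
    intro a ha a' ha'
    simp only [Set.mem_ofPred_eq] at ha ha'
    obtain ⟨⟨⟨m, j⟩, hi⟩, rfl⟩ := E.eq_single_of_levM (E.levM_eq_of_add ha h)
    obtain ⟨⟨⟨m', j'⟩, hi'⟩, rfl⟩ := E.eq_single_of_levM (E.levM_eq_of_add ha' h)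
    rw [wtM_single] at ha ha'
    have ha : loopWt (E.w j) m = β := add_left_cancel ha
    have ha' : loopWt (E.w j') m' = β := add_left_cancel ha'
    obtain ⟨hw, rfl⟩ := loopWt_injective (ha.trans ha'.symm)
    have hj : E.w j ≠ 0 := by
      intro hj
      obtain ⟨K, hK0, hK⟩ := exists_delta_zero_fElt b A
      rw [hj] at ha
      have h1 : m.1 * K = -1 := by
        rw [← ha] at h
        simp only [loopWt, ext_zero, zero_add, LinearMap.add_apply, LinearMap.smul_apply, hK,
          delta_one_fElt, smul_zero, add_zero, zsmul_eq_mul] at h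
        exact_mod_cast h
      have hm : m.1 = -1 := by
        rcases Int.eq_one_or_neg_one_of_mul_eq_neg_one h1 with h2 | h2
        · rw [h2] at h1; omega
        · exact h2
      refine hβ ⟨m.2, ?_⟩
      rw [← ha, loopWt, hm, ext_zero]; simp
    obtain rfl := E.eq_of_w_eq hw hj
    rfl
  rcases hs.eq_empty_or_singleton with h0 | ⟨a, h0⟩
  · left; rw [h0, Set.image_empty, Cardinal.mk_eq_zero]
  · right; rw [h0, Set.image_singleton, Cardinal.mk_singleton]

/-- Shifting the exponent of `t₂`. -/
def shift (i : E.NegIdx b A) (t : ℤ) : E.NegIdx b A :=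
  ⟨⟨(i.1.1.1, i.1.1.2 + t), i.1.2⟩, by
    rw [E.lev_shift b A i.1.1.1 (i.1.1.2 + t) i.1.1.2]; exact i.2⟩

lemma wtT_shift (i : E.NegIdx b A) (t : ℤ) :
    E.wtT (Sum.inl (E.shift i t).1) = E.wtT (Sum.inl i.1) + t • delta H 1 := by
  change loopWt (E.w i.1.2) (i.1.1.1, i.1.1.2 + t) = loopWt (E.w i.1.2) i.1.1 + t • delta H 1
  simp only [loopWt, add_smul]; abel

/-- A weight that is a sum of at least two negative roots has infinite multiplicity: the exponents
of `t₂` in two factors of a monomial can be moved in opposite directions. -/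
lemma infinite_of_two (i i' : E.NegIdx b A) (a' : E.NegIdx b A →₀ ℕ) :
    {a : E.NegIdx b A →₀ ℕ |
      E.wtM a = E.wtM (Finsupp.single i 1 + Finsupp.single i' 1 + a')}.Infinite := by
  classical
  -- beyond the distance `c` the two moved factors cannot trade places
  let c : ℕ := (i'.1.1.2 - i.1.1.2).natAbs + 1
  refine Set.infinite_of_injective_forall_mem (f := fun N : ℕ =>
    Finsupp.single (E.shift i ((N + c : ℕ) : ℤ)) 1 +
      Finsupp.single (E.shift i' (-((N + c : ℕ) : ℤ))) 1 + a')
    ?_ fun N => ?_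
  · intro N N' h
    have h := add_right_cancel h
    have h1 := DFunLike.congr_fun h (E.shift i ((N + c : ℕ) : ℤ))
    simp only [Finsupp.add_apply, Finsupp.single_apply, if_true] at h1
    by_cases e1 : E.shift i ((N' + c : ℕ) : ℤ) = E.shift i ((N + c : ℕ) : ℤ)
    · have e2 : i.1.1.2 + ((N' + c : ℕ) : ℤ) = i.1.1.2 + ((N + c : ℕ) : ℤ) :=
        congrArg (fun x : E.NegIdx b A => x.1.1.2) e1
      omega
    · rw [if_neg e1] at h1
      by_cases e2 : E.shift i' (-((N' + c : ℕ) : ℤ)) = E.shift i ((N + c : ℕ) : ℤ)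
      · have e3 : i'.1.1.2 + -((N' + c : ℕ) : ℤ) = i.1.1.2 + ((N + c : ℕ) : ℤ) :=
          congrArg (fun x : E.NegIdx b A => x.1.1.2) e2
        omega
      · rw [if_neg e2] at h1; omega
  · simp only [Set.mem_ofPred_eq, wtM_add, wtM_single, wtT_shift]
    simp only [neg_smul]; abel

/-- If `A` is everything, the grading is trivial. -/
lemma ne_univ (i : E.NegIdx b A) : A ≠ Set.univ := by
  classical
  intro hA
  obtain ⟨n, m, h, -⟩ := E.exists_expansion b (Sum.inl i.1)
  have h1 := E.lev_spec b A (Sum.inl i.1)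
  rw [h, eval_fElt] at h1
  simp only [hA, Set.mem_univ, if_true, Finset.sum_const_zero, Int.cast_zero] at h1
  have h2 : E.lev b Set.univ (Sum.inl i.1) = 0 := by subst hA; exact_mod_cast h1.symm
  have h3 := i.2
  subst hA
  omega

/-- A root of degree at most `-2` is a sum of two roots of negative degree. -/
lemma exists_split (i : E.NegIdx b A) (hi : E.lev b A (Sum.inl i.1) ≤ -2) :
    ∃ i' i'' : E.NegIdx b A,
      E.wtT (Sum.inl i.1) = E.wtT (Sum.inl i'.1) + E.wtT (Sum.inl i''.1) := by
  obtain ⟨v, x, hx, m, hm, hxz⟩ : ∃ (v : Dual ℂ H) (x : g), x ∈ eig H v ∧ ∃ m : ℤ,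
      loopWt v (m, 0) (fElt b A) = 1 ∧ ⁅x, E.e i.1.2⁆ ≠ 0 := by
    by_contra hc
    push Not at hc
    refine E.e.ne_zero i.1.2 (eq_zero_of_commutes b (E.ne_univ i) ?_)
    rintro v x hx ⟨m, hm⟩
    exact hc v x hx m hm
  have hx0 : x ≠ 0 := by rintro rfl; simp at hxz
  have hmk (n : ℤ × ℤ) {y : g} (hy : y ≠ 0) : (T.mk (mono n y) 0 0 : T b) ≠ 0 := by
    intro e
    have e1 := congrArg (fun x : T b => coeffs g x.loop n) e
    change coeffs g (mono n y) n = coeffs g 0 n at e1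
    rw [coeffs_mono, map_zero, Finsupp.single_eq_same] at e1
    exact hy e1
  obtain ⟨k, hk⟩ := E.exists_wt_eq (mono_mem_rootSubspace b hx (m, 0)) (hmk _ hx0)
  obtain ⟨k', hk'⟩ := E.exists_neg k
  obtain ⟨k'', hk''⟩ := E.exists_wt_eq
    (mono_mem_rootSubspace b (lie_mem_eig hx (E.mem i.1.2)) ((m, 0) + i.1.1)) (hmk _ hxz)
  rw [loopWt_add] at hk''
  have h1 : E.lev b A k' = -1 := by
    rw [lev_eq_iff, hk', LinearMap.neg_apply, hk, hm]; simp
  have h2 : E.lev b A k'' = E.lev b A (Sum.inl i.1) + 1 := by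
    rw [lev_eq_iff, hk'', LinearMap.add_apply, hm, ← wtT_inl, lev_spec]; push_cast; ring
  obtain ⟨i', hi'⟩ := E.exists_negIdx (A := A) (k := k') (by omega)
  obtain ⟨i'', hi''⟩ := E.exists_negIdx (A := A) (k := k'') (by omega)
  refine ⟨i', i'', ?_⟩
  rw [hi', hi'', hk', hk'', hk, wtT_inl]; abel

/-- By sign coherence, exactly one simple root outside `A` occurs in a root of degree `-1`, with
coefficient `-1`. -/
lemma firstLayer_of_lev (i : E.NegIdx b A) (hi : E.lev b A (Sum.inl i.1) = -1) :
    FirstLayer b A l (l + E.wtT (Sum.inl i.1)) := by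
  classical
  obtain ⟨n, m, h, hs⟩ := E.exists_expansion b (Sum.inl i.1)
  have h1 := E.lev_spec b A (Sum.inl i.1)
  rw [h, eval_fElt, hi] at h1
  have h1 : (∑ i, if i ∈ A then 0 else n i : ℤ) = -1 := by exact_mod_cast h1
  have hneg : ∀ i, n i ≤ 0 := by
    rcases hs with hs | hs
    · have : 0 ≤ (∑ i, if i ∈ A then 0 else n i : ℤ) :=
        Finset.sum_nonneg fun i _ => by split; exacts [le_rfl, hs i]
      omega
    · exact hs
  obtain ⟨j, hj, hnj⟩ : ∃ j ∉ A, n j ≠ 0 := by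
    by_contra hc
    push Not at hc
    rw [Finset.sum_eq_zero fun i _ => by split; exacts [rfl, hc i ‹_›]] at h1
    omega
  have h2 := Finset.add_sum_erase Finset.univ (fun i => if i ∈ A then 0 else n i)
    (Finset.mem_univ j)
  have h2 : n j + ∑ i ∈ Finset.univ.erase j, (if i ∈ A then 0 else n i) = -1 := by
    rw [← h1, ← h2, if_neg hj]
  have h3 : ∀ i ∈ Finset.univ.erase j, (if i ∈ A then 0 else n i) ≤ 0 := fun i _ => by
    split; exacts [le_rfl, hneg i]
  have h4 := Finset.sum_nonpos h3
  have h5 := hneg j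
  have hj1 : n j = -1 := by omega
  have h6 := (Finset.sum_eq_zero_iff_of_nonpos h3).1 (by omega)
  refine ⟨fun i => if i ∈ A then (-n i).toNat else 0, fun i hi => if_neg hi, j, hj, m, ?_⟩
  have h7 : ∑ i, n i • simpleRoot b i =
      -∑ i, (if i ∈ A then (-n i).toNat else 0) • simpleRoot b i - simpleRoot b j := by
    have : simpleRoot b j = ∑ i, if i = j then simpleRoot b i else 0 := by simp
    conv_rhs => rw [this]
    rw [← Finset.sum_neg_distrib, ← Finset.sum_sub_distrib]
    refine Finset.sum_congr rfl fun i _ => ?_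
    by_cases hij : i = j
    · subst hij
      rw [if_neg hj, if_pos rfl, hj1]; simp
    · rw [if_neg hij, sub_zero]
      by_cases hiA : i ∈ A
      · rw [if_pos hiA, ← natCast_zsmul, Int.toNat_of_nonneg (by have := hneg i; omega), neg_smul,
          neg_neg]
      · have := h6 i (Finset.mem_erase.2 ⟨hij, Finset.mem_univ i⟩)
        rw [if_neg hiA] at this
        rw [if_neg hiA, this]; simp
  rw [h, h7]; abel

lemma rank_weightSpace_of_not_firstLayer (hl : Vanishes b A l) {μ : Dual ℂ (Cartan H)} (hμ : μ ≠ l)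
    (h : ¬ FirstLayer b A l μ) : Module.rank ℂ (weightSpace b (GIVM b l A) μ) = 0 ∨
      Cardinal.aleph0 ≤ Module.rank ℂ (weightSpace b (GIVM b l A) μ) := by
  obtain ⟨E⟩ := exists_adaptedBasis H
  rw [E.rank_weightSpace hl]
  rcases Set.eq_empty_or_nonempty {a : E.NegIdx b A →₀ ℕ | l + E.wtM a = μ} with h0 | ⟨a, ha⟩
  · left; rw [h0, Set.image_empty, Cardinal.mk_eq_zero]
  right
  have ha : l + E.wtM a = μ := ha
  suffices hinf : {a' : E.NegIdx b A →₀ ℕ | E.wtM a' = E.wtM a}.Infinite by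
    have h2 : {a : E.NegIdx b A →₀ ℕ | l + E.wtM a = μ}.Infinite := by
      refine hinf.mono fun a' ha' => ?_
      have ha' : E.wtM a' = E.wtM a := ha'
      change l + E.wtM a' = μ
      rw [ha', ha]
    have := (h2.image (E.basisM hl).injective.injOn).to_subtype
    exact Cardinal.aleph0_le_mk _
  obtain ⟨i, a1, rfl⟩ := E.exists_eq_single_add (a := a) (by
    rintro rfl; rw [wtM_zero, add_zero] at ha; exact hμ ha.symm)
  by_cases ha1 : a1 = 0
  · subst ha1
    rw [add_zero] at ha ⊢
    have hi : E.lev b A (Sum.inl i.1) ≤ -2 := by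
      by_contra hc
      have := i.2
      rw [wtM_single] at ha
      exact h (ha ▸ E.firstLayer_of_lev i (by omega))
    obtain ⟨i', i'', hs⟩ := E.exists_split i hi
    have := E.infinite_of_two i' i'' 0
    rwa [add_zero, wtM_add, wtM_single, wtM_single, ← hs, ← wtM_single] at this
  · obtain ⟨i', a2, rfl⟩ := E.exists_eq_single_add ha1
    rw [← add_assoc]
    exact E.infinite_of_two i i' a2

end AdaptedBasis

end Weights

section Submodules

variable {g : Type*} [LieRing g] [LieAlgebra ℂ g] [FiniteDimensional ℂ g] [IsSimple ℂ g]
  {H : LieSubalgebra ℂ g} [H.IsCartanSubalgebra]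

attribute [local instance 100] LieRing.ofAssociativeRing

variable {b : (rootSystem H).Base} {A : Set (Ix b)} {l : Dual ℂ (Cartan H)}

/-! ### Submodules and the irreducible quotient -/

namespace AdaptedBasis

variable (E : AdaptedBasis H)

/-- A submodule contains the homogeneous components of its elements for the grading by `f_A`. -/
lemma exists_component (hl : Vanishes b A l) (N : Submodule (U b) (GIVM b l A)) {v : GIVM b l A}
    (hv : v ∈ N) (n : ℤ) : ∃ v' ∈ N, ∀ a, (E.levM a = n →
      (E.basisM hl).repr v' a = (E.basisM hl).repr v a) ∧
      (E.levM a ≠ n → (E.basisM hl).repr v' a = 0) := by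
  obtain ⟨v', hv', h⟩ := (E.basisM hl).exists_component (inclEnd A l (fElt b A))
    (fun a => l (fElt b A) + E.wtM a (fElt b A)) (fun a => E.inclEnd_basisM hl _ a)
    (N.restrictScalars ℂ) (fun v hv => N.smul_mem _ hv) hv (l (fElt b A) + n)
  refine ⟨v', hv', fun a => ⟨fun ha => (h a).1 ?_, fun ha => (h a).2 fun e => ha ?_⟩⟩
  · rw [wtM_fElt, ha]
  · have := add_left_cancel e
    rw [wtM_fElt] at this
    exact_mod_cast this

lemma vac_mem_of_repr_ne_zero (hl : Vanishes b A l) {N : Submodule (U b) (GIVM b l A)}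
    {v : GIVM b l A} (hv : v ∈ N) (h : (E.basisM hl).repr v 0 ≠ 0) : vac b (setQ b A) l ∈ N := by
  obtain ⟨v', hv', h'⟩ := E.exists_component hl N hv 0
  have h1 : (E.basisM hl).repr v' = Finsupp.single 0 ((E.basisM hl).repr v 0) := by
    ext a
    by_cases ha : a = 0
    · subst ha; rw [(h' 0).1 E.levM_zero, Finsupp.single_eq_same]
    · rw [Finsupp.single_eq_of_ne ha, (h' a).2 (E.levM_neg ha).ne]
  have h2 : v' = (E.basisM hl).repr v 0 • vac b (setQ b A) l := by
    rw [← E.basisM_zero hl, ← (E.basisM hl).repr_symm_single, ← h1, LinearEquiv.symm_apply_apply]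
  rw [h2] at hv'
  have := (N.restrictScalars ℂ).smul_mem ((E.basisM hl).repr v 0)⁻¹ hv'
  rwa [smul_smul, inv_mul_cancel₀ h, one_smul] at this

end AdaptedBasis

lemma eq_top_of_vac_mem {S : Set (Dual ℂ (Cartan H))} {N : Submodule (U b) (Verma b S l)}
    (h : vac b S l ∈ N) : N = ⊤ := by
  rw [eq_top_iff]
  rintro v -
  obtain ⟨w, rfl⟩ := exists_smul_vac _ _ v
  exact N.smul_mem w h

lemma vac_ne_zero (hl : Vanishes b A l) : vac b (setQ b A) l ≠ 0 := by
  obtain ⟨E⟩ := exists_adaptedBasis H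
  rw [← E.basisM_zero hl]
  exact (E.basisM hl).ne_zero 0

/-- The sum of all proper submodules is proper, because none of them meets the line through the
generator. -/
lemma existsUnique_isSimpleModule_quotient (hl : Vanishes b A l) :
    ∃! N : Submodule (U b) (GIVM b l A), IsSimpleModule (U b) (GIVM b l A ⧸ N) := by
  obtain ⟨E⟩ := exists_adaptedBasis H
  set M := sSup {N : Submodule (U b) (GIVM b l A) | N ≠ ⊤} with hM
  have hle (N : Submodule (U b) (GIVM b l A)) (hN : N ≠ ⊤) : N ≤ M := le_sSup hN
  have hM0 : ∀ v ∈ M, (E.basisM hl).repr v 0 = 0 := by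
    intro v hv
    rw [hM, sSup_eq_iSup'] at hv
    induction hv using Submodule.iSup_induction' with
    | mem N v hv =>
      by_contra h0
      exact N.2 (eq_top_of_vac_mem (E.vac_mem_of_repr_ne_zero hl hv h0))
    | zero => simp
    | add x y _ _ hx hy => rw [map_add, Finsupp.add_apply, hx, hy, add_zero]
  have htop : M ≠ ⊤ := by
    intro e
    have := hM0 (vac b (setQ b A) l) (by rw [e]; trivial)
    rw [← E.basisM_zero hl, Basis.repr_self, Finsupp.single_eq_same] at this
    exact one_ne_zero this
  refine ⟨M, ?_, fun N hN => ?_⟩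
  · refine isSimpleModule_iff_isCoatom.2 ⟨htop, fun N hN => ?_⟩
    by_contra hc
    exact hN.not_ge (hle N hc)
  · replace hN := isSimpleModule_iff_isCoatom.1 hN
    rcases (hle N hN.1).eq_or_lt with h | h
    · exact h
    · exact absurd (hN.2 M h) htop

/-! ### Homomorphisms -/

/-- Enlarging the set of roots gives a quotient. -/
lemma exists_surjective_of_subset (l : Dual ℂ (Cartan H)) {S S' : Set (Dual ℂ (Cartan H))}
    (h : S ⊆ S') : ∃ p : Verma b S l →ₗ[U b] Verma b S' l, Function.Surjective p ∧
      p (vac b S l) = vac b S' l := by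
  have hle : vermaIdeal b S l ≤ vermaIdeal b S' l := by
    refine Submodule.span_mono (Set.union_subset_union_left _ ?_)
    rintro u ⟨β, hβ, x, hx, rfl⟩
    exact ⟨β, h hβ, x, hx, rfl⟩
  exact ⟨Submodule.factor hle, Submodule.factor_surjective hle, rfl⟩

/-- By sign coherence the parabolic sets are nested. -/
lemma setQ_mono {A' : Set (Ix b)} (h : A' ⊆ A) : setQ b A' ⊆ setQ b A := by
  classical
  obtain ⟨E⟩ := exists_adaptedBasis H
  rintro β ⟨hβ, hp⟩
  refine ⟨hβ, ?_⟩
  obtain ⟨k, rfl⟩ := E.exists_of_mem_roots hβ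
  obtain ⟨n, m, hk, hs⟩ := E.exists_expansion b k
  rw [hk, eval_fElt, Complex.intCast_re] at hp ⊢
  norm_cast at hp ⊢
  rcases hs with hs | hs
  · exact Finset.sum_nonneg fun i _ => by split; exacts [le_rfl, hs i]
  · have h1 : ∀ i ∈ Finset.univ, (if i ∈ A' then 0 else n i) ≤ 0 := fun i _ => by
      split; exacts [le_rfl, hs i]
    have h2 := (Finset.sum_eq_zero_iff_of_nonpos h1).1 (le_antisymm (Finset.sum_nonpos h1) hp)
    refine (Finset.sum_eq_zero fun i hi => ?_).ge
    split
    · rfl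
    · next hiA =>
      have := h2 i hi
      rwa [if_neg fun h' => hiA (h h')] at this

/-- The roots of positive degree for `φ` and the `n δ₂` lie in the parabolic set of the empty set. -/
lemma setI_subset : setI b ⊆ setQ b ∅ := by
  rintro β (⟨hβ, hp⟩ | ⟨n, hn, rfl⟩)
  · refine ⟨hβ, ?_⟩
    rw [fElt_empty]; exact hp.le
  · refine ⟨⟨?_, ?_⟩, ?_⟩
    · intro e
      have := DFunLike.congr_fun e (d H 1)
      rw [LinearMap.smul_apply, delta_one_d_one] at this
      simp at this
      omega
    · -- the coroot of the highest root provides an imaginary root vector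
      intro e
      have h0 : ((rootSystem H).coroot (theta b) : H) ≠ 0 := by
        intro h0
        have h3 : (rootSystem H).toLinearMap ((rootSystem H).root (theta b))
          ((rootSystem H).coroot (theta b)) = 2 := (rootSystem H).root_coroot_two (theta b)
        rw [h0, map_zero] at h3
        exact two_ne_zero h3.symm
      have h1 : (T.mk (mono (0, (n : ℤ)) (((rootSystem H).coroot (theta b) : H) : g)) 0 0 : T b) ∈
          rootSubspace b (n • delta H 1) := by
        have := mono_mem_rootSubspace b (v := (0 : Dual ℂ H))
          (x := (((rootSystem H).coroot (theta b) : H) : g))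
          (mem_eig_zero.2 (Subtype.property _)) (0, (n : ℤ))
        rwa [loopWt, ext_zero, zero_smul, zero_add, zero_add, natCast_zsmul] at this
      rw [e, Submodule.mem_bot] at h1
      have h2 := congrArg (fun x : T b => coeffs g x.loop (0, (n : ℤ))) h1
      change coeffs g (mono _ _) _ = coeffs g 0 _ at h2
      rw [coeffs_mono, map_zero, Finsupp.single_eq_same] at h2
      exact h0 (Subtype.ext h2)
    · rw [LinearMap.smul_apply, delta_one_fElt]; simp

/-- A homomorphism is right multiplication by an element of the enveloping algebra of the nilpotent
subalgebra, which has no zero divisors. -/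
lemma injective_of_ne_zero {m : Dual ℂ (Cartan H)} (hl : Vanishes b A l) (hm : Vanishes b A m)
    (f : GIVM b l A →ₗ[U b] GIVM b m A) (hf : f ≠ 0) : Function.Injective f := by
  obtain ⟨E⟩ := exists_adaptedBasis H
  obtain ⟨w, hw⟩ := (AdaptedBasis.bijective_smul_vac hm).2 (f (vac b (setQ b A) l))
  have hw0 : w ≠ 0 := by
    rintro rfl
    apply hf
    refine LinearMap.ext fun v => ?_
    obtain ⟨u, rfl⟩ := exists_smul_vac _ _ v
    rw [map_smul, ← hw]
    simp
  rw [← LinearMap.ker_eq_bot, LinearMap.ker_eq_bot']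
  intro v hv
  obtain ⟨u, rfl⟩ := (AdaptedBasis.bijective_smul_vac hl).2 v
  change f (nilMinusToU b A u • vac b (setQ b A) l) = 0 at hv
  rw [map_smul, ← hw] at hv
  change nilMinusToU b A u • nilMinusToU b A w • vac b (setQ b A) m = 0 at hv
  rw [← mul_smul, ← map_mul] at hv
  have h1 : u * w = 0 := by
    refine (AdaptedBasis.bijective_smul_vac hm).1 ?_
    change nilMinusToU b A (u * w) • vac b (setQ b A) m = nilMinusToU b A 0 • vac b (setQ b A) m
    rw [hv]; simp
  have := PBW.eq_zero_of_mul_eq_zero (E.negBasis b A) h1 hw0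
  rw [this]; simp

/-- If `λ` vanishes on a further simple coroot, the kernel of the projection to the smaller module
is a proper nonzero submodule. -/
lemma ne_zero_of_isSimpleModule (hl : Vanishes b A l) (hs : IsSimpleModule (U b) (GIVM b l A))
    {i : Ix b} (hi : i ∉ A) : l (simpleCoroot b i) ≠ 0 := by
  classical
  intro h0
  obtain ⟨E⟩ := exists_adaptedBasis H
  have hl' : Vanishes b (insert i A) l := by
    refine ⟨fun h hh => ?_, hl.2⟩
    induction hh using Submodule.span_induction with
    | zero => simp
    | add x y _ _ hx hy => rw [map_add, hx, hy, add_zero]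
    | smul r x _ hx => rw [map_smul, hx, smul_zero]
    | mem x hx =>
      obtain ⟨j, hj, rfl⟩ := hx
      rcases hj with rfl | hj
      · exact h0
      · exact hl.1 _ (Submodule.subset_span ⟨j, hj, rfl⟩)
  obtain ⟨p, hp, hpv⟩ := exists_surjective_of_subset (b := b) l
    (setQ_mono (Set.subset_insert i A))
  have hinj : Function.Injective p := by
    rcases LinearMap.injective_or_eq_zero p with h | h
    · exact h
    · rw [h, LinearMap.zero_apply] at hpv
      exact absurd hpv.symm (vac_ne_zero hl')
  obtain ⟨k, hk⟩ : ∃ k, E.wtT k = -simpleRoot b i := by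
    have : ∃ k, E.wtT k = simpleRoot b i := by
      cases i with
      | none =>
        obtain ⟨j, hj⟩ := E.exists_index ((rootSystem H).reflectionPerm (theta b) (theta b))
        refine ⟨Sum.inl ⟨(1, 0), j⟩, ?_⟩
        rw [E.wtT_inl]
        change loopWt (E.w j) (1, 0) = _
        rw [hj, root_reflectionPerm_self, loopWt, ext_neg, simpleRoot]
        simp only [one_smul, zero_smul]; abel
      | some i =>
        obtain ⟨j, hj⟩ := E.exists_index i
        refine ⟨Sum.inl ⟨(0, 0), j⟩, ?_⟩
        rw [E.wtT_inl]
        change loopWt (E.w j) (0, 0) = _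
        rw [hj, loopWt, simpleRoot]; simp
    obtain ⟨k, hk⟩ := this
    obtain ⟨k', hk'⟩ := E.exists_neg k
    exact ⟨k', hk'.trans (by rw [hk])⟩
  have h1 : E.lev b A k = -1 := by
    rw [E.lev_eq_iff, hk, LinearMap.neg_apply, simpleRoot_fElt, if_neg hi]; simp
  have h2 : E.lev b (insert i A) k = 0 := by
    rw [E.lev_eq_iff, hk, LinearMap.neg_apply, simpleRoot_fElt, if_pos (Set.mem_insert i A)]; simp
  obtain ⟨j, hj⟩ := E.exists_negIdx (A := A) (k := k) (by omega)
  have hk0 : E.wtT k ≠ 0 := E.ne_zero_of_lev_ne_zero (A := A) (by omega)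
  have h3 : p (E.basisM hl (Finsupp.single j 1)) = 0 := by
    rw [E.basisM_single, map_smul, hpv, hj]
    exact ι_smul_vac ((E.mem_setQ_iff b _ hk0).2 h2.ge) (E.basisT_mem k)
  exact (E.basisM hl).ne_zero _ (hinj (h3.trans (map_zero p).symm))

end Submodules

section Singular

variable {g : Type*} [LieRing g] [LieAlgebra ℂ g] [FiniteDimensional ℂ g] [IsSimple ℂ g]
  {H : LieSubalgebra ℂ g} [H.IsCartanSubalgebra]

attribute [local instance 100] LieRing.ofAssociativeRing

variable {b : (rootSystem H).Base} {A : Set (Ix b)} {l : Dual ℂ (Cartan H)}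

/-! ### Shifting the exponent of `t₂` -/

variable (g) in
/-- Multiplication by `t₂^N`. -/
def shiftLoop (N : ℤ) : Loop g →ₗ[ℂ] Loop g :=
  (coeffs g).symm.toLinearMap ∘ₗ Finsupp.lmapDomain g ℂ (fun m : ℤ × ℤ => (m.1, m.2 + N)) ∘ₗ
    (coeffs g).toLinearMap

lemma shiftLoop_mono (N : ℤ) (m : ℤ × ℤ) (x : g) :
    shiftLoop g N (mono m x) = mono (m.1, m.2 + N) x := by
  simp [shiftLoop, coeffs_mono, coeffs_symm_single]

lemma lie_shiftLoop (N : ℤ) (u v : Loop g) : ⁅shiftLoop g N u, v⁆ = shiftLoop g N ⁅u, v⁆ := by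
  induction u using loop_induction with
  | h0 => simp
  | ha u u' h h' => simp only [map_add, add_lie, h, h']
  | hm m x =>
    induction v using loop_induction with
    | h0 => simp
    | ha u u' h h' => simp only [map_add, lie_add, h, h']
    | hm n y =>
      rw [shiftLoop_mono, lie_mono, lie_mono, shiftLoop_mono]
      congr 1
      simp only [Prod.fst_add, Prod.snd_add]
      exact Prod.ext rfl (by simp only [Prod.snd_add]; abel)

lemma coeffs_shiftLoop (N : ℤ) (u : Loop g) (m : ℤ × ℤ) :
    coeffs g (shiftLoop g N u) m = coeffs g u (m.1, m.2 - N) := by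
  induction u using loop_induction with
  | h0 => simp
  | ha u u' h h' => simp only [map_add, Finsupp.add_apply, h, h']
  | hm k x =>
    classical
    rw [shiftLoop_mono, coeffs_mono, coeffs_mono, Finsupp.single_apply, Finsupp.single_apply]
    congr 1
    rw [eq_iff_iff, Prod.ext_iff, Prod.ext_iff]
    simp only
    constructor <;> rintro ⟨h1, h2⟩ <;> exact ⟨h1, by omega⟩

variable (b) in
/-- The pairs of elements of `T` without `dᵢ`-components whose loop components differ by the factor
`t₂^N`. -/
def shiftRel (N : ℤ) : Submodule ℂ (T b × T b) where
  carrier := {p | p.1.der = 0 ∧ p.2.der = 0 ∧ p.2.loop = shiftLoop g N p.1.loop}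
  add_mem' := by
    rintro p q ⟨h1, h2, h3⟩ ⟨h1', h2', h3'⟩
    refine ⟨?_, ?_, ?_⟩
    · change (p.1 + q.1).der = 0
      rw [der_add, h1, h1', add_zero]
    · change (p.2 + q.2).der = 0
      rw [der_add, h2, h2', add_zero]
    · change (p.2 + q.2).loop = shiftLoop g N (p.1 + q.1).loop
      rw [loop_add, loop_add, map_add, h3, h3']
  zero_mem' := ⟨rfl, rfl, (map_zero _).symm⟩
  smul_mem' := by
    rintro r p ⟨h1, h2, h3⟩
    refine ⟨?_, ?_, ?_⟩
    · change (r • p.1).der = 0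
      rw [der_smul, h1, smul_zero]
    · change (r • p.2).der = 0
      rw [der_smul, h2, smul_zero]
    · change (r • p.2).loop = shiftLoop g N (r • p.1).loop
      rw [loop_smul, loop_smul, map_smul, h3]

lemma lie_mem_shiftRel {N : ℤ} {x x' y : T b} (h : (x, x') ∈ shiftRel b N) (hy : y.der = 0) :
    (⁅x, y⁆, ⁅x', y⁆) ∈ shiftRel b N := by
  obtain ⟨h1, h2, h3⟩ := h
  have h1 : x.der = 0 := h1
  have h2 : x'.der = 0 := h2
  have h3 : x'.loop = shiftLoop g N x.loop := h3
  refine ⟨rfl, rfl, ?_⟩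
  change (⁅x', y⁆ : T b).loop = shiftLoop g N (⁅x, y⁆ : T b).loop
  rw [loop_lie, loop_lie, h1, h2, h3, hy, lie_shiftLoop]
  simp

/-- Normal ordering commutes with multiplication by a power of `t₂`, except for central terms. -/
lemma kap_mem_shiftRel {I : Type*} (y : I → T b) (hy : ∀ i, (y i).der = 0) {N : ℤ} (s : List I)
    {x x' : T b} (h : (x, x') ∈ shiftRel b N) (t : List I) :
    (Induced.kap ℂ y s x t, Induced.kap ℂ y s x' t) ∈ shiftRel b N := by
  classical
  induction s generalizing t x x' with
  | nil =>
    rw [Induced.kap_nil, Induced.kap_nil, Finsupp.single_apply, Finsupp.single_apply]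
    split
    · exact h
    · exact zero_mem _
  | cons i s ih =>
    rw [Induced.kap_cons, Induced.kap_cons, Finsupp.add_apply, Finsupp.add_apply]
    refine (shiftRel b N).add_mem (x := (_, _)) (y := (_, _)) ?_ (ih (lie_mem_shiftRel h (hy i)) t)
    cases t with
    | nil =>
      rw [Induced.mapDomain_cons_nil, Induced.mapDomain_cons_nil]; exact zero_mem _
    | cons j t =>
      by_cases hij : i = j
      · subst hij
        rw [Induced.mapDomain_cons_self, Induced.mapDomain_cons_self]
        exact ih h t
      · rw [Induced.mapDomain_cons_of_ne hij, Induced.mapDomain_cons_of_ne hij]; exact zero_mem _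

namespace AdaptedBasis

variable (E : AdaptedBasis H)

lemma repr_of_mem_shiftRel {N : ℤ} {x x' : T b} (h : (x, x') ∈ shiftRel b N) (m : ℤ × ℤ)
    (j : Fin E.N) : (E.basisT b).repr x' (Sum.inl ⟨m, j⟩) =
      (E.basisT b).repr x (Sum.inl ⟨(m.1, m.2 - N), j⟩) := by
  rw [basisT_repr_inl, basisT_repr_inl]
  have h3 : x'.loop = shiftLoop g N x.loop := h.2.2
  rw [h3, coeffs_shiftLoop]

lemma basisT_mem_shiftRel (m₁ m₂ N : ℤ) (j : Fin E.N) :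
    (E.basisT b (Sum.inl ⟨(m₁, m₂), j⟩), E.basisT b (Sum.inl ⟨(m₁, m₂ + N), j⟩)) ∈
      shiftRel b N := by
  rw [basisT_inl, basisT_inl]
  refine ⟨rfl, rfl, ?_⟩
  exact (shiftLoop_mono N (m₁, m₂) (E.e j)).symm

/-! ### Vectors killed by the positive part -/

/-- The result of moving `x` to the right through the monomials of an element of `M(λ, A)`. -/
def normal (hl : Vanishes b A l) (v : GIVM b l A) :
    T b →ₗ[ℂ] (List (E.NegIdx b A) →₀ T b) :=
  ∑ a ∈ ((E.basisM hl).repr v).support, (E.basisM hl).repr v a •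
    Induced.kap ℂ (fun i => (E.negBasis b A i : T b)) ((Finsupp.toMultiset a).sort (· ≤ ·))

lemma normal_apply (hl : Vanishes b A l) (v : GIVM b l A) (x : T b) (t : List (E.NegIdx b A)) :
    E.normal hl v x t = ∑ a ∈ ((E.basisM hl).repr v).support, (E.basisM hl).repr v a •
      Induced.kap ℂ (fun i => (E.negBasis b A i : T b))
        ((Finsupp.toMultiset a).sort (· ≤ ·)) x t := by
  rw [normal, LinearMap.sum_apply, Finsupp.finsetSum_apply]
  rfl

/-- The normal ordered form of `x • v`. -/
lemma smul_eq_ev (hl : Vanishes b A l) (v : GIVM b l A) (x : T b) :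
    UniversalEnvelopingAlgebra.ι ℂ x • v =
      equivM hl (Induced.ev (E.negProj b A) (chi b l) (E.negBasis b A) (E.normal hl v x)) := by
  have h1 : v = equivM hl (∑ a ∈ ((E.basisM hl).repr v).support, (E.basisM hl).repr v a •
      PBW.word (E.negBasis b A) ((Finsupp.toMultiset a).sort (· ≤ ·))) := by
    conv_lhs => rw [← (E.basisM hl).linearCombination_repr v, Finsupp.linearCombination_apply,
      Finsupp.sum]
    rw [map_sum]
    refine Finset.sum_congr rfl fun a _ => ?_
    rw [map_smul, basisM_apply]
  conv_lhs => rw [h1]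
  rw [smul_equivM (E := E), actU_ι, map_sum]
  congr 1
  rw [normal, LinearMap.sum_apply, map_sum]
  refine Finset.sum_congr rfl fun a _ => ?_
  rw [map_smul, LinearMap.smul_apply, map_smul, Induced.op_word]

lemma sublist_of_normal_ne_zero (hl : Vanishes b A l) {v : GIVM b l A} {x : T b}
    {t : List (E.NegIdx b A)} (h : E.normal hl v x t ≠ 0) :
    ∃ a ∈ ((E.basisM hl).repr v).support, t.Sublist ((Finsupp.toMultiset a).sort (· ≤ ·)) := by
  rw [normal_apply] at h
  obtain ⟨a, ha, h0⟩ := Finset.exists_ne_zero_of_sum_ne_zero h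
  exact ⟨a, ha, Induced.sublist_of_kap_ne_zero _ (right_ne_zero_of_smul h0)⟩

lemma negBasis_der (i : E.NegIdx b A) : (E.negBasis b A i : T b).der = 0 := by
  rw [negBasis_apply, basisT_inl]; rfl

/-- If a vector is killed by all elements `x(m₁, m₂)` of positive degree, then the individual terms
of the normal ordered form vanish: multiplying `x` by a high power of `t₂` makes the new factors
larger than all others, so that no cancellation is possible. -/
lemma normal_eq_zero (hl : Vanishes b A l) {v : GIVM b l A}
    (hv : ∀ k, 0 < E.lev b A k → UniversalEnvelopingAlgebra.ι ℂ (E.basisT b k) • v = 0)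
    {k} (hk : 0 < E.lev b A k) (t : List (E.NegIdx b A)) :
    E.negProj b A (E.normal hl v (E.basisT b k) t) = 0 ∧
      chi b l (E.normal hl v (E.basisT b k) t) = 0 := by
  rcases k with ⟨⟨m₁, m₂⟩, j⟩ | k
  swap
  · rw [lev_inr] at hk; exact absurd hk (lt_irrefl _)
  have hlev (n : ℤ) : 0 < E.lev b A (Sum.inl ⟨(m₁, n), j⟩) := by
    rw [E.lev_shift b A m₁ n m₂]; exact hk
  set Z : ℤ → (List (E.NegIdx b A) →₀ T b) := fun n =>
    E.normal hl v (E.basisT b (Sum.inl ⟨(m₁, n), j⟩)) with hZ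
  have hev (n) : Induced.ev (E.negProj b A) (chi b l) (E.negBasis b A) (Z n) = 0 := by
    have := hv _ (hlev n)
    rw [E.smul_eq_ev hl] at this
    exact (equivM hl).map_eq_zero_iff.1 this
  have hrel (n N : ℤ) (t) : (Z n t, Z (n + N) t) ∈ shiftRel b N := by
    simp only [hZ, normal_apply]
    have : (∑ a ∈ ((E.basisM hl).repr v).support, (E.basisM hl).repr v a •
        ((Induced.kap ℂ (fun i => (E.negBasis b A i : T b)) ((Finsupp.toMultiset a).sort (· ≤ ·))
          (E.basisT b (Sum.inl ⟨(m₁, n), j⟩)) t,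
        Induced.kap ℂ (fun i => (E.negBasis b A i : T b)) ((Finsupp.toMultiset a).sort (· ≤ ·))
          (E.basisT b (Sum.inl ⟨(m₁, n + N), j⟩)) t) : T b × T b)) ∈ shiftRel b N :=
      Submodule.sum_mem _ fun a _ => Submodule.smul_mem _ _
        (kap_mem_shiftRel _ E.negBasis_der _ (E.basisT_mem_shiftRel m₁ n N j) t)
    convert this using 1
    refine Prod.ext ?_ ?_
    · rw [Prod.fst_sum]; rfl
    · rw [Prod.snd_sum]; rfl
  have hrepr (n N : ℤ) (t) (m : ℤ × ℤ) (j') : (E.basisT b).repr (Z (n + N) t) (Sum.inl ⟨m, j'⟩) =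
      (E.basisT b).repr (Z n t) (Sum.inl ⟨(m.1, m.2 - N), j'⟩) :=
    E.repr_of_mem_shiftRel (hrel n N t) m j'
  have hsort (n) : ∀ t ∈ (Z n).support, t.Pairwise (· ≤ ·) := by
    intro t ht
    obtain ⟨a, -, hs⟩ := E.sublist_of_normal_ne_zero hl (Finsupp.mem_support_iff.1 ht)
    exact (Multiset.pairwise_sort _ _).sublist hs
  -- `B` bounds the exponents of `t₂` in the old factors from above, `C` those in the new ones from
  -- below
  obtain ⟨B, hB⟩ : ∃ B : ℤ, ∀ n, ∀ t ∈ (Z n).support, ∀ i ∈ t, i.idx.1.2 ≤ B := by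
    obtain ⟨B, hB⟩ := (((E.basisM hl).repr v).support.biUnion fun a =>
      a.support.image fun i : E.NegIdx b A => i.idx.1.2).bddAbove
    refine ⟨B, fun n t ht i hi => hB ?_⟩
    obtain ⟨a, ha, hs⟩ := E.sublist_of_normal_ne_zero hl (Finsupp.mem_support_iff.1 ht)
    have h1 := hs.subset hi
    rw [Multiset.mem_sort, Finsupp.mem_toMultiset] at h1
    exact Finset.mem_coe.2 (Finset.mem_biUnion.2 ⟨a, ha, Finset.mem_image_of_mem _ h1⟩)
  obtain ⟨C, hC⟩ : ∃ C : ℤ, ∀ t m j',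
      (E.basisT b).repr (Z m₂ t) (Sum.inl ⟨m, j'⟩) ≠ 0 → C ≤ m.2 := by
    obtain ⟨C, hC⟩ := ((Z m₂).support.biUnion fun t =>
      ((E.basisT b).repr (Z m₂ t)).support.image fun k =>
        Sum.elim (fun k : E.Idx => k.1.2) (fun _ => 0) k).bddBelow
    refine ⟨C, fun t m j' h => hC ?_⟩
    refine Finset.mem_coe.2 (Finset.mem_biUnion.2 ⟨t, ?_, Finset.mem_image.2
      ⟨Sum.inl ⟨m, j'⟩, Finsupp.mem_support_iff.2 h, rfl⟩⟩)
    rw [Finsupp.mem_support_iff]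
    intro e
    rw [e, map_zero] at h
    exact h rfl
  -- the shift by `B - C + 1` makes all new factors larger than the old ones
  have hlarge (t) : E.negProj b A (Z (m₂ + (B - C + 1)) t) = 0 := by
    refine Induced.proj_eq_zero_of_ev_eq_zero _ _ _ (hev _) (hsort _) ?_ t
    intro t ht i hi t' ht' i' hi'
    apply E.lt_of_snd_lt
    rw [negProj_repr] at hi
    obtain ⟨⟨m, j'⟩, hi0⟩ := i
    rw [hrepr] at hi
    have h1 := hC t _ j' hi
    have h2 := hB _ t' ht' i' hi'
    simp only at h1
    change i'.idx.1.2 < m.2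
    omega
  have hall (t) : E.negProj b A (Z m₂ t) = 0 := by
    rw [negProj_eq_zero_iff]
    intro k hk
    rcases k with ⟨m, j'⟩ | k
    · have h1 := (E.negProj_eq_zero_iff b A).1 (hlarge t) (Sum.inl ⟨(m.1, m.2 + (B - C + 1)), j'⟩)
        (by rw [E.lev_shift b A m.1 _ m.2]; exact hk)
      rw [hrepr] at h1
      simpa using h1
    · rw [lev_inr] at hk; exact absurd hk (lt_irrefl _)
  exact ⟨hall t, Induced.chi_eq_zero_of_ev_eq_zero _ _ _ (hev m₂) (hsort m₂) hall t⟩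

end AdaptedBasis

end Singular

section Simplicity

variable {g : Type*} [LieRing g] [LieAlgebra ℂ g] [FiniteDimensional ℂ g] [IsSimple ℂ g]
  {H : LieSubalgebra ℂ g} [H.IsCartanSubalgebra]

attribute [local instance 100] LieRing.ofAssociativeRing

variable {b : (rootSystem H).Base} {A : Set (Ix b)} {l : Dual ℂ (Cartan H)}

/-! ### Elements of the negative part annihilated by raising operators -/

lemma coeffs_lie_mono (m n : ℤ × ℤ) (x : g) (u : Loop g) :
    coeffs g ⁅mono m x, u⁆ (m + n) = ⁅x, coeffs g u n⁆ := by
  classical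
  induction u using loop_induction with
  | h0 => simp
  | ha u u' h h' => simp only [map_add, lie_add, Finsupp.add_apply, h, h']
  | hm k y =>
    rw [lie_mono, coeffs_mono, coeffs_mono, Finsupp.single_apply, Finsupp.single_apply]
    simp only [add_right_inj]
    split <;> simp

/-- The Killing form pairs opposite weight spaces without degeneration. -/
lemma exists_form_ne_zero (b : (rootSystem H).Base) {v : Dual ℂ H} {z : g} (hz : z ∈ eig H v)
    (h0 : z ≠ 0) : ∃ x ∈ eig H (-v), form b x z ≠ 0 := by
  by_contra hc
  push Not at hc
  refine h0 ?_
  have h1 : z ∈ LinearMap.ker (killingForm ℂ g) := by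
    refine mem_ker_killingForm_of_mem_rootSpace_of_forall_rootSpace_neg ℂ g H
      (α := (v : H → ℂ)) (mem_eig_iff_rootSpace.1 hz) fun y hy => ?_
    have h2 := hc y (mem_eig_iff_rootSpace.2 hy)
    rw [form_apply, LieModule.traceForm_comm] at h2
    exact (mul_eq_zero.1 h2).resolve_left (formScale_ne_zero b)
  rwa [LieAlgebra.IsKilling.ker_killingForm_eq_bot, Submodule.mem_bot] at h1

namespace AdaptedBasis

variable (E : AdaptedBasis H)

lemma mem_span_of_mem_rootSubspace {β : Dual ℂ (Cartan H)} {x : T b}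
    (hx : x ∈ rootSubspace b β) : x ∈ Submodule.span ℂ (E.basisT b '' {k | E.wtT k = β}) :=
  E.mem_span_of_repr b fun _ hk => E.basisT_repr_eq_zero hx hk

/-- The root vectors of weight `v + m₁ δ₁ + m₂ δ₂` are the elements `z(m₁, m₂)` with `z` of weight
`v`. -/
lemma exists_eq_mono {v : Dual ℂ H} {m : ℤ × ℤ} (h0 : loopWt v m ≠ 0) {x : T b}
    (hx : x ∈ rootSubspace b (loopWt v m)) : ∃ z ∈ eig H v, x = T.mk (mono m z) 0 0 := by
  obtain ⟨E⟩ := exists_adaptedBasis H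
  have h := E.mem_span_of_mem_rootSubspace hx
  clear hx
  have hadd (y z : g) : (mono m (y + z)) = mono m y + mono m z := TensorProduct.tmul_add _ _ _
  induction h using Submodule.span_induction with
  | zero =>
    refine ⟨0, zero_mem _, T.ext' ?_ rfl rfl⟩
    exact (coeffs g).injective (by
      change coeffs g 0 = coeffs g (mono m 0)
      rw [coeffs_mono, map_zero, Finsupp.single_zero])
  | add x y _ _ hx hy =>
    obtain ⟨z, hz, rfl⟩ := hx
    obtain ⟨z', hz', rfl⟩ := hy
    exact ⟨z + z', add_mem hz hz', T.ext' (hadd z z').symm (add_zero _) (add_zero _)⟩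
  | smul r x _ hx =>
    obtain ⟨z, hz, rfl⟩ := hx
    exact ⟨r • z, Submodule.smul_mem _ r hz,
      T.ext' (mono_smul m r z).symm (smul_zero r) (smul_zero r)⟩
  | mem x hx =>
    obtain ⟨k, hk, rfl⟩ := hx
    change E.wtT k = _ at hk
    rcases k with ⟨m', j⟩ | k
    · rw [wtT_inl] at hk
      obtain ⟨hv, hm⟩ := loopWt_injective hk
      change E.w j = v at hv
      change m' = m at hm
      subst hv hm
      exact ⟨E.e j, E.mem j, E.basisT_inl b ⟨m', j⟩⟩
    · rw [wtT_inr] at hk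
      exact absurd hk.symm h0

/-- An element `y` of degree at most `-2` whose brackets with the elements of positive degree have
no components of negative degree is zero: it commutes with the elements of degree one. -/
lemma eq_zero_of_lie_of_le {y : T b} {n : ℤ} (hn : n ≤ -2)
    (hy : ∀ k, (E.basisT b).repr y k ≠ 0 → E.lev b A k = n)
    (h : ∀ k, 0 < E.lev b A k → E.negProj b A ⁅E.basisT b k, y⁆ = 0) : y = 0 := by
  by_contra h0
  obtain ⟨k0, hk0⟩ : ∃ k, (E.basisT b).repr y k ≠ 0 := by
    by_contra hc
    push Not at hc
    exact h0 ((E.basisT b).repr.map_eq_zero_iff.1 (Finsupp.ext hc))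
  have hspan : y ∈ Submodule.span ℂ (E.basisT b '' {k | E.lev b A k = n}) :=
    E.mem_span_of_repr b fun k hk => by
      by_contra hc
      exact hk (hy k hc)
  obtain ⟨i, rfl⟩ := E.exists_negIdx (A := A) (k := k0) (by rw [hy k0 hk0]; omega)
  -- elements of degree one commute with `y`, because the bracket has negative degree
  have h1 (k) (hk : E.lev b A k = 1) : ⁅E.basisT b k, y⁆ = 0 := by
    refine (E.basisT b).repr.map_eq_zero_iff.1 (Finsupp.ext fun k' => ?_)
    by_cases hk' : E.lev b A k' = 1 + n
    · exact (E.negProj_eq_zero_iff b A).1 (h k (by omega)) k' (by omega)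
    · have : ∀ y ∈ Submodule.span ℂ (E.basisT b '' {k | E.lev b A k = n}),
          (E.basisT b).repr ⁅E.basisT b k, y⁆ k' = 0 := by
        intro y hy
        induction hy using Submodule.span_induction with
        | zero => simp
        | add x y _ _ hx hy => rw [lie_add, map_add, Finsupp.add_apply, hx, hy, add_zero]
        | smul r x _ hx => rw [lie_smul, map_smul, Finsupp.smul_apply, hx, smul_zero]
        | mem x hx =>
          obtain ⟨k'', hk'', rfl⟩ := hx
          change E.lev b A k'' = n at hk''
          exact E.lie_repr_eq_zero b A (by rw [hk, hk'']; exact hk')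
      exact this y hspan
  have h2 (β : Dual ℂ (Cartan H)) (hβ : β (fElt b A) = 1) (x : T b) (hx : x ∈ rootSubspace b β) :
      ⁅x, y⁆ = 0 := by
    replace hx := E.mem_span_of_mem_rootSubspace hx
    induction hx using Submodule.span_induction with
    | zero => simp
    | add x y _ _ hx hy => rw [add_lie, hx, hy, add_zero]
    | smul r x _ hx => rw [smul_lie, hx, smul_zero]
    | mem x hx =>
      obtain ⟨k, hk, rfl⟩ := hx
      exact h1 k (E.lev_eq_iff.2 (by rw [show E.wtT k = β from hk, hβ]; simp))
  have hder : y.der = 0 := by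
    have hder' : ∀ y ∈ Submodule.span ℂ (E.basisT b '' {k | E.lev b A k = n}), y.der = 0 := by
      intro y hy
      induction hy using Submodule.span_induction with
      | zero => rfl
      | add x y _ _ hx hy => rw [der_add, hx, hy, add_zero]
      | smul r x _ hx => rw [der_smul, hx, smul_zero]
      | mem x hx =>
        obtain ⟨k, hk, rfl⟩ := hx
        change E.lev b A k = n at hk
        rcases k with k | k
        · rw [basisT_inl]; rfl
        · rw [lev_inr] at hk; omega
    exact hder' y hspan
  have h3 (m : ℤ × ℤ) : coeffs g y.loop m = 0 := by
    refine eq_zero_of_commutes b (E.ne_univ i) fun v x hx ⟨p, hp⟩ => ?_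
    have h4 := h2 _ hp _ (mono_mem_rootSubspace b hx (p, 0))
    have h5 := congrArg T.loop h4
    rw [loop_lie, hder, loop_zero] at h5
    change ⁅mono (p, 0) x, y.loop⁆ + ∑ i, (0 : Fin 2 → ℂ) i • deg i y.loop -
      ∑ i, (0 : Fin 2 → ℂ) i • deg i (mono (p, 0) x) = 0 at h5
    simp only [Pi.zero_apply, zero_smul, Finset.sum_const_zero, add_zero, sub_zero] at h5
    rw [← coeffs_lie_mono (p, 0) m, h5, map_zero, Finsupp.zero_apply]
  rw [basisT_repr_inl, h3, map_zero] at hk0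
  exact hk0 rfl

/-- A root of degree `-1` involves exactly one simple root outside `A`. -/
lemma apply_dualVec_ne_zero (hl : Vanishes b A l) (h : ∀ i ∉ A, l (simpleCoroot b i) ≠ 0)
    (i : E.NegIdx b A) (hi : E.lev b A (Sum.inl i.1) = -1) :
    l (dualVec b (E.wtT (Sum.inl i.1))) ≠ 0 := by
  obtain ⟨k, hk, j, hj, n, e⟩ := E.firstLayer_of_lev (l := 0) i hi
  have e' : E.wtT (Sum.inl i.1) =
      (∑ i, (-(k i : ℤ)) • simpleRoot b i + n • delta H 1) - simpleRoot b j := by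
    rw [zero_add, zero_sub] at e
    rw [e]
    simp only [neg_smul, natCast_zsmul, Finset.sum_neg_distrib]
    abel
  obtain ⟨r, hr, hr'⟩ := dualVec_simpleRoot b j
  rw [e', map_sub, map_sub, dualVec_sum _ n hl fun i hi => by rw [hk i hi]; rfl, hr', map_smul,
    zero_sub, neg_ne_zero, smul_eq_mul]
  exact mul_ne_zero hr (h j hj)

/-- An element `y` of degree `-1` is zero if the character kills its brackets with the elements of
positive degree, because opposite root spaces are paired without degeneration and `λ` does not
vanish on the vectors that represent roots of degree `-1`. -/
lemma eq_zero_of_chi_lie (hl : Vanishes b A l) (hne : ∀ i ∉ A, l (simpleCoroot b i) ≠ 0) {y : T b}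
    (hy : ∀ k, (E.basisT b).repr y k ≠ 0 → E.lev b A k = -1)
    (h : ∀ k, 0 < E.lev b A k → chi b l ⁅E.basisT b k, y⁆ = 0) : y = 0 := by
  by_contra h0
  obtain ⟨k0, hk0⟩ : ∃ k, (E.basisT b).repr y k ≠ 0 := by
    by_contra hc
    push Not at hc
    exact h0 ((E.basisT b).repr.map_eq_zero_iff.1 (Finsupp.ext hc))
  have hlev := hy k0 hk0
  obtain ⟨i, rfl⟩ := E.exists_negIdx (A := A) (k := k0) (by omega)
  have hwt : E.wtT (Sum.inl i.1) ≠ 0 := E.ne_zero_of_lev_ne_zero (A := A) (by omega)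
  -- the component `y0` of `y` of weight `wt i`
  set y0 := E.proj b (fun k => E.wtT k = E.wtT (Sum.inl i.1)) y with hy0
  have hy0mem : y0 ∈ rootSubspace b (E.wtT (Sum.inl i.1)) := by
    have : y0 ∈ Submodule.span ℂ (E.basisT b '' {k | E.wtT k = E.wtT (Sum.inl i.1)}) :=
      E.mem_span_of_repr b fun k hk => by rw [hy0, repr_proj, if_neg hk]
    refine Submodule.span_le.2 ?_ this
    rintro _ ⟨k, hk, rfl⟩
    rw [← (show E.wtT k = _ from hk)]
    exact E.basisT_mem k
  obtain ⟨z, hz, hyz⟩ := exists_eq_mono (v := E.w i.1.2) (m := i.1.1) hwt hy0mem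
  have hz0 : z ≠ 0 := by
    rintro rfl
    have h1 := E.repr_proj b (fun k => E.wtT k = E.wtT (Sum.inl i.1)) y (Sum.inl i.1)
    rw [if_pos rfl, ← hy0, hyz, basisT_repr_inl] at h1
    change E.e.repr (coeffs g (mono i.1.1 0) _) _ = _ at h1
    rw [coeffs_mono, Finsupp.single_zero, Finsupp.zero_apply, map_zero] at h1
    exact hk0 h1.symm
  obtain ⟨x, hx, hxz⟩ := exists_form_ne_zero b hz hz0
  set X : T b := T.mk (mono (-i.1.1) x) 0 0 with hX
  have hXmem : X ∈ rootSubspace b (-E.wtT (Sum.inl i.1)) := by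
    have := mono_mem_rootSubspace b hx (-i.1.1)
    rwa [loopWt_neg] at this
  have h1 : chi b l ⁅X, y⁆ = 0 := by
    have hXs := E.mem_span_of_mem_rootSubspace hXmem
    clear_value X
    clear hX hXmem
    induction hXs using Submodule.span_induction with
    | zero => simp
    | add x y _ _ hx hy => rw [add_lie, map_add, hx, hy, add_zero]
    | smul r x _ hx => rw [smul_lie, map_smul, hx, smul_zero]
    | mem x hx =>
      obtain ⟨k, hk, rfl⟩ := hx
      have : E.lev b A k = 1 := E.lev_eq_iff.2 (by
        rw [show E.wtT k = _ from hk, LinearMap.neg_apply, lev_spec, hlev]; simp)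
      exact h k (by omega)
  have h2 : chi b l ⁅X, y - y0⁆ = 0 := by
    have hs : y - y0 ∈ Submodule.span ℂ (E.basisT b '' {k | E.wtT k ≠ E.wtT (Sum.inl i.1)}) :=
      E.mem_span_of_repr b fun k hk => by
        rw [map_sub, Finsupp.sub_apply, hy0, repr_proj, if_pos (not_not.1 hk), sub_self]
    generalize y - y0 = y1 at hs ⊢
    induction hs using Submodule.span_induction with
    | zero => simp
    | add x y _ _ hx hy => rw [lie_add, map_add, hx, hy, add_zero]
    | smul r x _ hx => rw [lie_smul, map_smul, hx, smul_zero]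
    | mem x hx =>
      obtain ⟨k, hk, rfl⟩ := hx
      refine chi_of_mem b l ?_ (lie_mem_rootSubspace b hXmem (E.basisT_mem k))
      intro e
      rw [neg_add_eq_zero] at e
      exact hk e.symm
  have h3 : chi b l ⁅X, y0⁆ = 0 := by
    rw [lie_sub, map_sub, h1, zero_sub, neg_eq_zero] at h2
    exact h2
  have h4 := lie_mono_mono_neg b hx (by rwa [neg_neg]) (-i.1.1) (y := z)
  rw [neg_neg, ← hyz, ← hX, loopWt_neg] at h4
  rw [h4, map_smul, chi_incl, map_neg, map_neg, smul_eq_mul] at h3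
  exact (mul_ne_zero hxz (neg_ne_zero.2 (E.apply_dualVec_ne_zero hl hne i hlev))) h3

/-! ### Simplicity -/

/-- The part of `[x, ·]` that is responsible for the monomial `t` in the normal ordered form of
`x • v`, if no monomial of `v` has more than one factor more than `t`. -/
def leading (hl : Vanishes b A l) (v : GIVM b l A) (t : List (E.NegIdx b A)) : T b :=
  ∑ a ∈ ((E.basisM hl).repr v).support, (E.basisM hl).repr v a •
    Finsupp.linearCombination ℕ (fun i => (E.negBasis b A i : T b))
      (Induced.del ((Finsupp.toMultiset a).sort (· ≤ ·)) t)

lemma normal_apply_of_card_le (hl : Vanishes b A l) (v : GIVM b l A) (t : List (E.NegIdx b A))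
    (ht : ∀ a ∈ ((E.basisM hl).repr v).support, (Finsupp.toMultiset a).card ≤ t.length + 1)
    (x : T b) : ∃ r : ℂ, E.normal hl v x t = ⁅x, E.leading hl v t⁆ + r • x := by
  classical
  refine ⟨∑ a ∈ ((E.basisM hl).repr v).support, (E.basisM hl).repr v a *
    if (Finsupp.toMultiset a).sort (· ≤ ·) = t then 1 else 0, ?_⟩
  rw [normal_apply, leading, lie_sum, Finset.sum_smul, ← Finset.sum_add_distrib]
  refine Finset.sum_congr rfl fun a ha => ?_
  rw [Induced.kap_apply_of_length_le_succ _ (by rw [Multiset.length_sort]; exact ht a ha), smul_add,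
    lie_smul, mul_smul]
  congr 2
  split <;> simp

lemma repr_leading (hl : Vanishes b A l) (v : GIVM b l A) (t : List (E.NegIdx b A))
    (i : E.NegIdx b A) : (E.basisT b).repr (E.leading hl v t) (Sum.inl i.1) =
      ∑ a ∈ ((E.basisM hl).repr v).support, (E.basisM hl).repr v a *
        (Induced.del ((Finsupp.toMultiset a).sort (· ≤ ·)) t i : ℂ) := by
  classical
  rw [leading, map_sum, Finsupp.finsetSum_apply]
  refine Finset.sum_congr rfl fun a _ => ?_
  rw [map_smul, Finsupp.smul_apply, smul_eq_mul]
  congr 1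
  generalize Induced.del _ t = D
  induction D using Finsupp.induction_linear with
  | zero => simp
  | add D D' h h' =>
    rw [map_add, map_add, Finsupp.add_apply, h, h', Finsupp.add_apply, Nat.cast_add]
  | single j n =>
    rw [Finsupp.linearCombination_single, negBasis_apply, map_nsmul, Basis.repr_self,
      Finsupp.smul_apply, Finsupp.single_apply, Finsupp.single_apply]
    by_cases hij : j = i
    · subst hij; simp
    · rw [if_neg hij, if_neg fun e => hij (NegIdx.ext (Sum.inl_injective e))]; simp

lemma exists_of_repr_leading (hl : Vanishes b A l) {v : GIVM b l A} {t : List (E.NegIdx b A)} {k}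
    (hk : (E.basisT b).repr (E.leading hl v t) k ≠ 0) : ∃ i : E.NegIdx b A, Sum.inl i.1 = k ∧
      ∃ a ∈ ((E.basisM hl).repr v).support,
        ((Finsupp.toMultiset a).sort (· ≤ ·)).Perm (i :: t) := by
  have h1 : E.leading hl v t ∈ nilMinus b A := by
    rw [leading]
    refine sum_mem fun a _ => (nilMinus b A).smul_mem _ ?_
    rw [Finsupp.linearCombination_apply]
    exact sum_mem fun i _ => nsmul_mem (Subtype.property _) _
  obtain ⟨i, rfl⟩ : ∃ i : E.NegIdx b A, Sum.inl i.1 = k := by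
    refine E.exists_negIdx (A := A) ?_
    by_contra hc
    exact hk ((E.mem_nilMinus_iff b A).1 h1 k hc)
  refine ⟨i, rfl, ?_⟩
  rw [repr_leading] at hk
  obtain ⟨a, ha, h0⟩ := Finset.exists_ne_zero_of_sum_ne_zero hk
  exact ⟨a, ha, Induced.perm_of_del_ne_zero (by exact_mod_cast right_ne_zero_of_mul h0)⟩

/-- If `λ` does not vanish on the remaining coroots, there is no singular vector `v` of negative
degree. Take a monomial `i0 t0` of `v` with the greatest number of factors. In the normal ordered
form of `x • v` the term at `t0` is `[x, y]` up to a multiple of `x`, where `y` is the sum over the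
monomials `i t0` of `v` of their coefficients times the root vectors with index `i`. So `[x, y]`
vanishes modulo the kernel of the character, for all `x` of positive degree, which forces `y = 0`.
-/
lemma eq_zero_of_smul_eq_zero (hl : Vanishes b A l) (hne : ∀ i ∉ A, l (simpleCoroot b i) ≠ 0)
    {v : GIVM b l A} {n : ℤ} (hn : n < 0)
    (hhom : ∀ a, (E.basisM hl).repr v a ≠ 0 → E.levM a = n)
    (hv : ∀ k, 0 < E.lev b A k → UniversalEnvelopingAlgebra.ι ℂ (E.basisT b k) • v = 0) :
    v = 0 := by
  classical
  by_contra hv0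
  have hsupp : ((E.basisM hl).repr v).support.Nonempty := by
    rw [Finsupp.support_nonempty_iff]
    exact fun e => hv0 ((E.basisM hl).repr.map_eq_zero_iff.1 e)
  obtain ⟨a0, ha0, hmax⟩ := Finset.exists_max_image _
    (fun a : E.NegIdx b A →₀ ℕ => (Finsupp.toMultiset a).card) hsupp
  have hu0 := Finsupp.mem_support_iff.1 ha0
  obtain ⟨i0, t0, hsort⟩ : ∃ i0 t0, (Finsupp.toMultiset a0).sort (· ≤ ·) = i0 :: t0 := by
    refine List.exists_cons_of_ne_nil fun e => ?_
    have h1 : Finsupp.toMultiset a0 = 0 := by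
      rw [← Multiset.sort_eq (Finsupp.toMultiset a0) (· ≤ ·), e]; rfl
    have h2 := hhom a0 hu0
    rw [levM, h1] at h2
    simp at h2
    omega
  have hperm (a) (i) (h : ((Finsupp.toMultiset a).sort (· ≤ ·)).Perm (i :: t0)) :
      Finsupp.toMultiset a = i ::ₘ (t0 : Multiset (E.NegIdx b A)) := by
    rw [← Multiset.sort_eq (Finsupp.toMultiset a) (· ≤ ·), Multiset.cons_coe, Multiset.coe_eq_coe]
    exact h
  have hm0 := hperm a0 i0 (by rw [hsort])
  set y := E.leading hl v t0 with hy
  have hlevy (k) (hk : (E.basisT b).repr y k ≠ 0) :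
      E.lev b A k = E.lev b A (Sum.inl i0.1) := by
    obtain ⟨i, rfl, a, ha, hp⟩ := E.exists_of_repr_leading hl hk
    have h1 := hhom a (Finsupp.mem_support_iff.1 ha)
    have h2 := hhom a0 hu0
    rw [levM, hperm a i hp, Multiset.map_cons, Multiset.sum_cons] at h1
    rw [levM, hm0, Multiset.map_cons, Multiset.sum_cons] at h2
    omega
  have hy0 : y ≠ 0 := by
    intro e
    have h1 := E.repr_leading hl v t0 i0
    rw [← hy, e, map_zero, Finsupp.zero_apply, Finset.sum_eq_single a0] at h1
    · refine mul_ne_zero hu0 ?_ h1.symm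
      rw [hsort]
      exact_mod_cast Induced.del_cons_self_ne_zero i0 t0
    · intro a _ haa
      by_contra hc
      refine haa (Multiset.toFinsupp.symm.injective ?_)
      change Finsupp.toMultiset a = Finsupp.toMultiset a0
      rw [hm0, hperm a i0 (Induced.perm_of_del_ne_zero (by exact_mod_cast right_ne_zero_of_mul hc))]
    · exact fun h => absurd ha0 h
  have hlie (k) (hk : 0 < E.lev b A k) :
      E.negProj b A ⁅E.basisT b k, y⁆ = 0 ∧ chi b l ⁅E.basisT b k, y⁆ = 0 := by
    obtain ⟨h1, h2⟩ := E.normal_eq_zero hl hv hk t0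
    obtain ⟨r, hr⟩ := E.normal_apply_of_card_le hl v t0 (fun a ha => by
      have := hmax a ha
      rw [hm0] at this
      simpa using this) (E.basisT b k)
    have h3 : E.negProj b A (E.basisT b k) = 0 := by
      rw [negProj_eq_zero_iff]
      intro k' hk'
      rw [Basis.repr_self, Finsupp.single_apply, if_neg]
      rintro rfl
      omega
    have h4 : chi b l (E.basisT b k) = 0 :=
      chi_of_mem b l (E.ne_zero_of_lev_ne_zero (A := A) (by omega)) (E.basisT_mem k)
    rw [hr, map_add, map_smul, h3, smul_zero, add_zero] at h1
    rw [hr, map_add, map_smul, h4, smul_zero, add_zero] at h2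
    exact ⟨h1, h2⟩
  have hneg := i0.2
  rcases (show E.lev b A (Sum.inl i0.1) = -1 ∨ E.lev b A (Sum.inl i0.1) ≤ -2 by omega) with h | h
  · exact hy0 (E.eq_zero_of_chi_lie hl hne (fun k hk => (hlevy k hk).trans h) fun k hk =>
      (hlie k hk).2)
  · exact hy0 (E.eq_zero_of_lie_of_le h hlevy fun k hk => (hlie k hk).1)

/-- Root vectors shift the degree. -/
lemma levM_of_smul (hl : Vanishes b A l) {v : GIVM b l A} {n : ℤ}
    (hhom : ∀ a, (E.basisM hl).repr v a ≠ 0 → E.levM a = n) (k) (a)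
    (ha : (E.basisM hl).repr (UniversalEnvelopingAlgebra.ι ℂ (E.basisT b k) • v) a ≠ 0) :
    E.levM a = E.lev b A k + n := by
  have hD (a) : inclEnd A l (fElt b A) (E.basisM hl a) =
      (l (fElt b A) + E.levM a) • E.basisM hl a := by
    rw [inclEnd_basisM, wtM_fElt]
  have h1 : inclEnd A l (fElt b A) v = (l (fElt b A) + n) • v := by
    refine (E.basisM hl).ext_elem fun a => ?_
    rw [(E.basisM hl).repr_diag _ _ hD, map_smul, Finsupp.smul_apply, smul_eq_mul]
    by_cases h0 : (E.basisM hl).repr v a = 0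
    · rw [h0, mul_zero, mul_zero]
    · rw [hhom a h0]
  have h2 : inclEnd A l (fElt b A) (UniversalEnvelopingAlgebra.ι ℂ (E.basisT b k) • v) =
      (l (fElt b A) + (E.lev b A k + n : ℤ)) •
        UniversalEnvelopingAlgebra.ι ℂ (E.basisT b k) • v := by
    have h3 : UniversalEnvelopingAlgebra.ι ℂ (incl b (fElt b A)) *
        UniversalEnvelopingAlgebra.ι ℂ (E.basisT b k) =
        UniversalEnvelopingAlgebra.ι ℂ (E.basisT b k) *
          UniversalEnvelopingAlgebra.ι ℂ (incl b (fElt b A)) +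
        (E.lev b A k : ℂ) • UniversalEnvelopingAlgebra.ι ℂ (E.basisT b k) := by
      rw [← E.lev_spec b A k, ← map_smul, ← E.basisT_mem k (fElt b A), LieHom.map_lie,
        LieRing.of_associative_ring_bracket]
      abel
    change UniversalEnvelopingAlgebra.ι ℂ (incl b (fElt b A)) •
      UniversalEnvelopingAlgebra.ι ℂ (E.basisT b k) • v = _
    change UniversalEnvelopingAlgebra.ι ℂ (incl b (fElt b A)) • v = _ at h1
    rw [← mul_smul, h3, add_smul, mul_smul, h1, smul_algebra_smul_comm, smul_assoc, ← add_smul]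
    congr 1
    push_cast; ring
  by_contra hc
  refine ha ((E.basisM hl).repr_eq_zero_of_diag hD h2 fun e => hc ?_)
  exact_mod_cast add_left_cancel e

end AdaptedBasis

/-- A nonzero homogeneous element of greatest degree in a submodule is singular, hence of degree
`0`. -/
lemma isSimpleModule_of_ne_zero (hl : Vanishes b A l) (hne : ∀ i ∉ A, l (simpleCoroot b i) ≠ 0) :
    IsSimpleModule (U b) (GIVM b l A) := by
  classical
  obtain ⟨E⟩ := exists_adaptedBasis H
  have : Nontrivial (GIVM b l A) := ⟨⟨vac b (setQ b A) l, 0, vac_ne_zero hl⟩⟩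
  suffices h : IsSimpleOrder (Submodule (U b) (GIVM b l A)) from (isSimpleModule_iff _ _).2 h
  refine ⟨fun N => or_iff_not_imp_left.2 fun hN => ?_⟩
  have hex : ∃ n : ℕ, ∃ v ∈ N, v ≠ 0 ∧ ∀ a, (E.basisM hl).repr v a ≠ 0 → E.levM a = -(n : ℤ) := by
    obtain ⟨v, hv, hv0⟩ := Submodule.exists_mem_ne_zero_of_ne_bot hN
    obtain ⟨a, ha⟩ : ∃ a, (E.basisM hl).repr v a ≠ 0 := by
      by_contra hc
      push Not at hc
      exact hv0 ((E.basisM hl).repr.map_eq_zero_iff.1 (Finsupp.ext hc))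
    obtain ⟨v', hv', h⟩ := E.exists_component hl N hv (E.levM a)
    have hneg := E.levM_nonpos a
    refine ⟨(E.levM a).natAbs, v', hv', ?_, fun a' ha' => ?_⟩
    · rintro rfl
      have := (h a).1 rfl
      rw [map_zero, Finsupp.zero_apply] at this
      exact ha this.symm
    · by_contra hc
      exact ha' ((h a').2 (by omega))
  obtain ⟨v, hv, hv0, hhom⟩ := Nat.find_spec hex
  set n := Nat.find hex with hn
  have hsing (k) (hk : 0 < E.lev b A k) :
      UniversalEnvelopingAlgebra.ι ℂ (E.basisT b k) • v = 0 := by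
    by_contra hc
    have h1 := E.levM_of_smul hl hhom k
    obtain ⟨a, ha⟩ : ∃ a, (E.basisM hl).repr
        (UniversalEnvelopingAlgebra.ι ℂ (E.basisT b k) • v) a ≠ 0 := by
      by_contra hc'
      push Not at hc'
      exact hc ((E.basisM hl).repr.map_eq_zero_iff.1 (Finsupp.ext hc'))
    have h2 := h1 a ha
    have h3 := E.levM_nonpos a
    refine Nat.find_min hex (m := (E.levM a).natAbs) (by omega)
      ⟨_, N.smul_mem _ hv, hc, fun a' ha' => ?_⟩
    rw [h1 a' ha', ← h2]; omega
  rcases Nat.eq_zero_or_pos n with h0 | hpos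
  · refine eq_top_of_vac_mem (E.vac_mem_of_repr_ne_zero hl hv fun h => hv0 ?_)
    refine (E.basisM hl).repr.map_eq_zero_iff.1 (Finsupp.ext fun a => ?_)
    by_contra hc
    have := hhom a hc
    rw [E.eq_zero_of_levM (a := a) (by omega)] at hc
    exact hc h
  · exact absurd (E.eq_zero_of_smul_eq_zero hl hne (by omega) hhom hsing) hv0

end Simplicity

end DoubleAffine

end

open DoubleAffine in
theorem mainTheorem3 {g : Type*} [LieRing g] [LieAlgebra ℂ g] [FiniteDimensional ℂ g]
    [LieAlgebra.IsSimple ℂ g] (H : LieSubalgebra ℂ g) [H.IsCartanSubalgebra]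
    (b : (LieAlgebra.IsKilling.rootSystem H).Base) (hsl : b.cartanMatrix.IsSimplyLaced)
    (A : Set (Ix b)) (l : Module.Dual ℂ (Cartan H)) (hl : Vanishes b A l) :
    -- (1) `M(λ, A)` is free over the enveloping algebra of `nilMinus` with basis `1 ⊗ 1_λ`
    Function.Bijective (fun u : UniversalEnvelopingAlgebra ℂ (nilMinus b A) =>
      nilMinusToU b A u • vac b (setQ b A) l) ∧
    -- (2) weight multiplicities
    (Module.rank ℂ (weightSpace b (GIVM b l A) l) = 1 ∧
      (∀ μ, FirstLayer b A l μ →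
        ((∃ n : ℤ, μ = l - delta H 0 + n • delta H 1) →
          Module.rank ℂ (weightSpace b (GIVM b l A) μ) = Module.rank ℂ H) ∧
        ((¬ ∃ n : ℤ, μ = l - delta H 0 + n • delta H 1) →
          Module.rank ℂ (weightSpace b (GIVM b l A) μ) = 0 ∨
          Module.rank ℂ (weightSpace b (GIVM b l A) μ) = 1)) ∧
      (∀ μ, μ ≠ l → ¬ FirstLayer b A l μ →
        Module.rank ℂ (weightSpace b (GIVM b l A) μ) = 0 ∨
        Cardinal.aleph0 ≤ Module.rank ℂ (weightSpace b (GIVM b l A) μ))) ∧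
    -- (3) unique irreducible quotient
    (∃! N : Submodule (U b) (GIVM b l A), IsSimpleModule (U b) (GIVM b l A ⧸ N)) ∧
    -- (4) surjections
    (∀ A'' : Set (Ix b), A'' ⊆ A →
      ∃ (p : IVM b l →ₗ[U b] GIVM b l A'') (q : GIVM b l A'' →ₗ[U b] GIVM b l A),
        Function.Surjective p ∧ Function.Surjective q) ∧
    -- (5) nonzero homomorphisms are injective
    (∀ m : Module.Dual ℂ (Cartan H), Vanishes b A m →
      ∀ f : GIVM b l A →ₗ[U b] GIVM b m A, f ≠ 0 → Function.Injective f) ∧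
    -- (6) irreducibility criterion
    (IsSimpleModule (U b) (GIVM b l A) ↔ ∀ i ∉ A, l (simpleCoroot b i) ≠ 0) := by
  refine ⟨AdaptedBasis.bijective_smul_vac hl, ⟨AdaptedBasis.rank_weightSpace_self hl,
    fun μ hμ => ⟨?_, fun hn => ?_⟩,
    fun μ hμ h => AdaptedBasis.rank_weightSpace_of_not_firstLayer hl hμ h⟩,
    existsUnique_isSimpleModule_quotient hl, fun A'' h => ?_,
    fun m hm f hf => injective_of_ne_zero hl hm f hf,
    fun hs i hi => ne_zero_of_isSimpleModule hl hs hi, isSimpleModule_of_ne_zero hl⟩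
  · rintro ⟨n, rfl⟩
    obtain ⟨β, h, hβ⟩ := hμ.exists_eq_add
    have h' : β = -delta H 0 + n • delta H 1 := by
      rw [sub_add_eq_add_sub, add_sub_assoc] at h
      rw [← add_left_cancel h]; abel
    exact AdaptedBasis.rank_weightSpace_imaginary hl (h' ▸ hβ)
  · obtain ⟨β, rfl, hβ⟩ := hμ.exists_eq_add
    refine AdaptedBasis.rank_weightSpace_real hl hβ ?_
    rintro ⟨n, rfl⟩
    exact hn ⟨n, by abel⟩
  · obtain ⟨p, hp, -⟩ := exists_surjective_of_subset (b := b) l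
      (setI_subset.trans (setQ_mono (Set.empty_subset A'')))
    obtain ⟨q, hq, -⟩ := exists_surjective_of_subset (b := b) l (setQ_mono (b := b) h)
    exact ⟨p, q, hp, hq⟩
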